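/- Let $R$ be a commutative semilocal ring (i.e. with finitely many maximal ideals) in which $2$ is invertible. Let $(A,\sigma)$ be an Azumaya algebra with involution over $R$: $A$ is an $R$-algebra that is Azumaya over its center $S:=\mathrm{Cent}(A)$, $S$ is finite étale over $R$, $\sigma\colon A\to A$ is an $R$-linear involution, and $r\mapsto r\cdot 1_A$ identifies $R$ with the ring of $\sigma$-fixed elements of $S$. For an Azumaya $S$-algebra $B$ and a finite projective right $B$-module $P$ put $\deg B:=\sqrt{\operatorname{rank}_S B}$, $\operatorname{rrk}_B P:=\operatorname{rank}_S P/\deg B$ and $\operatorname{ind} B:=\gcd\{\deg B' : B'\text{ is an Azumaya } S\text{-algebra Brauer equivalent to } B\}$; these are functions on $\operatorname{Spec} S$, and sums, gcd's, divisibility and inequalities of such functions are taken pointwise. We say that $\sigma$ is symplectic at $\mathfrak p\in\operatorname{Spec} R$ if the $k(\mathfrak p)$-algebra $A\otimes_R k(\mathfrak p)$ is central simple over $k(\mathfrak p)$ and the involution induced on it by $\sigma$ is symplectic, i.e. over an algebraic closure of $k(\mathfrak p)$ it becomes adjoint to a nondegenerate alternating bilinear form. Let $n\colon\operatorname{Spec}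 S\to\{0,1,2,\dots\}$ be a locally constant function which is invariant under the action of $\sigma|_S$ on $\operatorname{Spec} S$ and satisfies $\operatorname{ind} A\mid n$ and $n\le\deg A$. Suppose further that $n(\mathfrak q)$ is even for every $\mathfrak q\in\operatorname{Spec} S$ lying over a prime $\mathfrak p\in\operatorname{Spec} R$ at which $\sigma$ is symplectic. Then there exists an idempotent $e\in A$ such that $e^\sigma=e$ and $$\deg eAe=\operatorname{rrk}_A eA=n .$$ Here $eAe$ is Azumaya over its center, this center is $eS$, and $\deg eAe:=\sqrt{\operatorname{rank}_S eAe}$ is regarded as a function on $\operatorname{Spec} S$ (if $n>0$ everywhere, then $eS\cong S$ and $eAe$ is an Azumaya $S$-algebra). -/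

import Mathlib

open scoped TensorProduct

/-- An algebra is an algebra over its centre, by inclusion. -/
instance centerAlgebra (R A : Type*) [CommRing R] [Ring A] [Algebra R A] :
    Algebra (Subalgebra.center R A) A where
  algebraMap := (Subalgebra.center R A).val.toRingHom
  commutes' s a := ((Subalgebra.mem_center_iff.mp s.2) a).symm
  smul_def' _ _ := rfl

/-- `s • x` for `x` in the corner ring `eAe` of an `S`-algebra `A`, computed in `A`. -/
instance cornerSMul {S A : Type*} [CommRing S] [Ring A] [Algebra S A] {e : A}
    (he : IsIdempotentElem e) : SMul S he.Corner where
  smul s x := ⟨s • x.1, by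
    obtain ⟨h₁, h₂⟩ := (Subsemigroup.mem_corner_iff he).mp x.2
    exact (Subsemigroup.mem_corner_iff he).mpr
      ⟨by rw [mul_smul_comm, h₁], by rw [smul_mul_assoc, h₂]⟩⟩

instance cornerModule {S A : Type*} [CommRing S] [Ring A] [Algebra S A] {e : A}
    (he : IsIdempotentElem e) : Module S he.Corner where
  one_smul x := Subtype.ext (one_smul S x.1)
  mul_smul s t x := Subtype.ext (mul_smul s t x.1)
  smul_zero s := Subtype.ext (smul_zero s)
  smul_add s x y := Subtype.ext (smul_add s x.1 y.1)
  add_smul s t x := Subtype.ext (add_smul s t x.1)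
  zero_smul x := Subtype.ext (zero_smul S x.1)

/-- The corner ring `eAe` of an `S`-algebra `A` as an `S`-algebra (with unit `e`). -/
instance cornerAlgebra {S A : Type*} [CommRing S] [Ring A] [Algebra S A] {e : A}
    (he : IsIdempotentElem e) : Algebra S he.Corner :=
  Algebra.ofModule (fun s x y => Subtype.ext (smul_mul_assoc s x.1 y.1))
    (fun s x y => Subtype.ext (mul_smul_comm s x.1 y.1))

/-- The right ideal `eA` of an `S`-algebra `A`, as an `S`-module. -/
def rightIdealOf (S : Type*) {A : Type*} [CommRing S] [Ring A] [Algebra S A] (e : A) :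
    Submodule S A :=
  LinearMap.range (LinearMap.mulLeft S e)

/-- An `R`-linear involution of an `R`-algebra `A`. -/
structure AlgInvolution (R A : Type*) [CommRing R] [Ring A] [Algebra R A] where
  toLinearMap : A →ₗ[R] A
  map_mul : ∀ a b : A, toLinearMap (a * b) = toLinearMap b * toLinearMap a
  involutive : ∀ a : A, toLinearMap (toLinearMap a) = a

instance (R A : Type*) [CommRing R] [Ring A] [Algebra R A] :
    CoeFun (AlgInvolution R A) (fun _ => A → A) where
  coe σ := σ.toLinearMap

theorem AlgInvolution.map_one {R A : Type*} [CommRing R] [Ring A] [Algebra R A]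
    (σ : AlgInvolution R A) : σ 1 = 1 := by
  have h := σ.map_mul (σ 1) 1
  rw [mul_one, σ.involutive, mul_one] at h
  exact h.symm

/-- The restriction of an involution to the centre, a ring endomorphism of the centre. -/
def AlgInvolution.onCenter {R A : Type*} [CommRing R] [Ring A] [Algebra R A]
    (σ : AlgInvolution R A) : Subalgebra.center R A →+* Subalgebra.center R A where
  toFun s := ⟨σ s.1, Subalgebra.mem_center_iff.mpr fun b => by
    have h := congrArg σ (Subalgebra.mem_center_iff.mp s.2 (σ b))
    simp only [σ.map_mul, σ.involutive] at h
    exact h.symm⟩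
  map_one' := Subtype.ext σ.map_one
  map_mul' s t := Subtype.ext <| by
    change σ (s.1 * t.1) = σ s.1 * σ t.1
    rw [Subalgebra.mem_center_iff.mp t.2 s.1, σ.map_mul]
  map_zero' := Subtype.ext (map_zero σ.toLinearMap)
  map_add' s t := Subtype.ext (map_add σ.toLinearMap s.1 t.1)

/-- `A` is separable projective over `R`: Azumaya over its centre, and the centre is
finite étale over `R`. -/
structure IsSeparableProjective (R A : Type*) [CommRing R] [Ring A] [Algebra R A] : Prop where
  azumaya_center : IsAzumaya (Subalgebra.center R A) A
  finite_center : Module.Finite R (Subalgebra.center R A)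
  etale_center : Algebra.Etale R (Subalgebra.center R A)

/-- `(A, σ)` is an Azumaya algebra with involution over `R`: it is separable projective over `R`,
and `R → A` identifies `R` with the `σ`-fixed elements of the centre of `A`. -/
structure AlgInvolution.IsAzumayaInvolution {R A : Type*} [CommRing R] [Ring A] [Algebra R A]
    (σ : AlgInvolution R A) : Prop where
  separableProjective : IsSeparableProjective R A
  injective : Function.Injective (algebraMap R A)
  fixed : ∀ a ∈ Subalgebra.center R A, σ a = a → a ∈ Set.range (algebraMap R A)

/-- `σ` is symplectic at `p`: over an algebraic closure `L` of the residue field `k(p)`, the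
base change of `A` becomes `End_L(V)` with `V = L ^ m`, in such a way that the base change of
`σ` becomes the involution adjoint to a nondegenerate alternating bilinear form on `V`.
(In particular, `A ⊗ k(p)` is then central over `k(p)`.) -/
def AlgInvolution.IsSymplecticAt {R A : Type*} [CommRing R] [Ring A] [Algebra R A]
    (σ : AlgInvolution R A) (p : PrimeSpectrum R) : Prop :=
  let L := AlgebraicClosure p.asIdeal.ResidueField
  ∃ (m : ℕ) (φ : L ⊗[R] A ≃ₐ[L] Module.End L (Fin m → L))
    (b : LinearMap.BilinForm L (Fin m → L)),
    b.IsAlt ∧ b.Nondegenerate ∧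
      ∀ a : A, LinearMap.IsAdjointPair b b (φ (1 ⊗ₜ[R] a)) (φ (1 ⊗ₜ[R] σ a))

/-- The degree `√(rank_S A)` of an Azumaya `S`-algebra `A`, as a function on `Spec S`. -/
noncomputable def azumayaDegree (S A : Type*) [CommRing S] [Ring A] [Algebra S A]
    (q : PrimeSpectrum S) : ℝ :=
  Real.sqrt (Module.rankAtStalk (R := S) A q)

/-- The reduced rank `rank_S P / deg A` of a projective `A`-module `P`. -/
noncomputable def reducedRank (S A P : Type*) [CommRing S] [Ring A] [Algebra S A]
    [AddCommGroup P] [Module S P] (q : PrimeSpectrum S) : ℝ :=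
  Module.rankAtStalk (R := S) P q / azumayaDegree S A q

/-- Brauer equivalence of Azumaya `S`-algebras: `A ⊗ End(P) ≅ B ⊗ End(Q)` for some faithful
finitely generated projective `S`-modules `P` and `Q`. -/
def BrauerEquivalent.{u, v, w} (S : Type u) (A : Type v) (B : Type w) [CommRing S] [Ring A]
    [Algebra S A] [Ring B] [Algebra S B] : Prop :=
  ∃ (P Q : Type u) (_ : AddCommGroup P) (_ : Module S P) (_ : AddCommGroup Q) (_ : Module S Q),
    Module.Projective S P ∧ Module.Finite S P ∧ FaithfulSMul S P ∧
    Module.Projective S Q ∧ Module.Finite S Q ∧ FaithfulSMul S Q ∧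
    Nonempty ((A ⊗[S] Module.End S P) ≃ₐ[S] (B ⊗[S] Module.End S Q))

/-- The index of an Azumaya `S`-algebra `A`, as a function on `Spec S`: the pointwise greatest
common divisor of the degrees of the Azumaya `S`-algebras `B` in the Brauer class of `A`.
(These are finitely generated `S`-modules, so it is enough to let `B` range over the universe
of `S`.) -/
noncomputable def azumayaIndex.{u, v} (S : Type u) (A : Type v) [CommRing S] [Ring A]
    [Algebra S A] (q : PrimeSpectrum S) : ℕ :=
  sSup {d : ℕ | ∀ (B : Type u) [Ring B] [Algebra S B], IsAzumaya S B → BrauerEquivalent S A B →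
    ∀ m : ℕ, azumayaDegree S B q = m → d ∣ m}

/-!
Put `τ = σ|_S`. The proof produces an idempotent `f` of `A` of reduced rank `n`, not related to `σ`,
and then replaces it by an equivalent symmetric one; equivalent idempotents generate isomorphic
modules, so the ranks do not change.

*The idempotent `f`.* If `B` is Brauer equivalent to `A`, Morita theory turns the isomorphism of
`A ⊗ End P` with `B ⊗ End Q` into a finite projective `A`-module of rank `deg A · deg B`
(`BrauerEquivalent.exists_isModuleRank`). Rank functions of `A`-modules are closed under sums, under
restriction to clopen sets and, over a semilocal ring, under nonnegative differences. Since
`ind A ∣ n`, near each point `n · deg A` is a difference of rank functions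
(`exists_isModuleRank_of_index_dvd`), so it is itself a rank function by compactness of `Spec S`.
As `n ≤ deg A`, the free module `A` surjects onto a module of that rank, which is therefore of the
form `Af` (`exists_idempotent_of_index_dvd`).

*From `f` to a symmetric idempotent.* Suppose `x` is such that `fx σ(fx)` is invertible as an
element of `f A σ(f)`, with inverse `w`. Then `e = σ(fx) w (fx)` is idempotent and equivalent to
`f`, and it is symmetric when `fx σ(fx)` is. In other words, `fA` is a nondegenerate subspace of the
hermitian space `A`. By Nakayama's lemma invertibility may be tested modulo the maximal ideals `q`
of `S`, of which there are finitely many, and by the Chinese remainder theorem the element `x` may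
be chosen separately modulo each of them (`exists_symmetric_idempotent_of_forall_mul_sub_mem`).

*Modulo `q` with `τ(q) ≠ q`.* As `n` is `τ`-invariant, `f` and `σ(f)` have the same rank, so they
are equivalent modulo `q` (`exists_equivalence_sub_mem`). The equivalence serves as `x` at one of
the two conjugate maximal ideals, and `f` at the other.

*Modulo `q` with `τ(q) = q`.* Now `σ` acts on the simple artinian ring `A / qA`. Let `g` be an
idempotent of it that generates a minimal right ideal. If `y σ(y) ≠ 0` for some `y` in `g (A / qA)`,
then the form diagonalizes and has nondegenerate subspaces of every dimension; otherwise it is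
alternating, and hyperbolic planes provide those of every even dimension
(`exists_mul_star_mul_eq`). The alternating case is exactly where `n` has to be even: there
`g (A / qA) g` is commutative, `A / qA` is split with `σ` adjoint to an alternating form, and `τ`
is trivial on `S / q`. As `2` is invertible, `S / q` is then the residue field of the prime of `R`
below `q`, and as `S` is étale over `R`, this prime generates `q`, so that `A / qA` is the fibre of
`A` there. Hence `σ` is symplectic there (`isSymplecticAt_of_alternating`) and `n(q)` is even by
hypothesis.

*The corner ring.* The isomorphism `A ⊗ Aᵒᵖ ≅ End A` restricts to one of `eAe ⊗ (eAe)ᵒᵖ` with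
`End (eAe)` (`bijective_mulLeftRight_corner`), whence `eAe` is central over the image of `S` and
Azumaya over its centre. The degree of `eAe` is computed from
`rank (eAe) · rank A = rank (eA) · rank (Ae)` (`IsAzumaya.rankAtStalk_peirce`).
-/

/-! ### Idempotents and their multiplicities -/

/-- `g` is a division idempotent: a nonzero idempotent whose corner `gΛg` is a division ring. -/
structure IsDivisionIdempotent {Λ : Type*} [Ring Λ] (g : Λ) : Prop where
  idem : g * g = g
  ne_zero : g ≠ 0
  exists_mul_eq : ∀ z, g * z = z → z * g = z → z ≠ 0 → ∃ w, z * w = g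

/-- The idempotent `e` is the sum of `n` orthogonal idempotents equivalent to `g`, witnessed by
matrix units `u i`, `v i`; equivalently `Λe ≅ (Λg)ⁿ`. -/
def HasMultiplicity {Λ : Type*} [Ring Λ] (g e : Λ) (n : ℕ) : Prop :=
  ∃ u v : Fin n → Λ, (∀ i, u i * g = u i) ∧ (∀ i, g * v i = v i) ∧
    (∀ i j, v i * u j = if i = j then g else 0) ∧ ∑ i, u i * v i = e

section Multiplicity

variable {Λ : Type*} [Ring Λ] {g e e' : Λ} {n m : ℕ}

theorem HasMultiplicity.zero : HasMultiplicity g 0 0 :=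
  ⟨Fin.elim0, Fin.elim0, fun i => i.elim0, fun i => i.elim0, fun i => i.elim0, by simp⟩

theorem HasMultiplicity.of_mul {u v : Λ} (hu : u * g = u) (hv : g * v = v) (h : v * u = g) :
    HasMultiplicity g (u * v) 1 :=
  ⟨fun _ => u, fun _ => v, fun _ => hu, fun _ => hv,
    fun i j => by simp [Subsingleton.elim i j, h], by simp⟩

theorem mul_sum_eq_of_matrixUnits {u v : Fin n → Λ} (hv : ∀ i, g * v i = v i)
    (h : ∀ i j, v i * u j = if i = j then g else 0) (i : Fin n) :
    v i * ∑ j, u j * v j = v i := by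
  simp [Finset.mul_sum, ← mul_assoc, h, ite_mul, hv]

theorem sum_mul_eq_of_matrixUnits {u v : Fin n → Λ} (hu : ∀ i, u i * g = u i)
    (h : ∀ i j, v i * u j = if i = j then g else 0) (i : Fin n) :
    (∑ j, u j * v j) * u i = u i := by
  simp [Finset.sum_mul, mul_assoc, h, hu]

theorem HasMultiplicity.isIdempotentElem (h : HasMultiplicity g e n) : e * e = e := by
  obtain ⟨u, v, hu, hv, huv, rfl⟩ := h
  conv_lhs => rw [Finset.sum_mul]
  refine Finset.sum_congr rfl fun i _ => ?_
  rw [mul_assoc, mul_sum_eq_of_matrixUnits hv huv]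

theorem HasMultiplicity.add (h : HasMultiplicity g e n) (h' : HasMultiplicity g e' m)
    (h₁ : e * e' = 0) (h₂ : e' * e = 0) : HasMultiplicity g (e + e') (n + m) := by
  obtain ⟨u, v, hu, hv, huv, rfl⟩ := h
  obtain ⟨u', v', hu', hv', huv', rfl⟩ := h'
  refine ⟨Fin.append u u', Fin.append v v', ?_, ?_, ?_, ?_⟩
  · intro i
    refine Fin.addCases (fun i => ?_) (fun i => ?_) i <;> simp [hu, hu']
  · intro i
    refine Fin.addCases (fun i => ?_) (fun i => ?_) i <;> simp [hv, hv']
  · have c₁ : ∀ i j, v i * u' j = 0 := fun i j => by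
      rw [← mul_sum_eq_of_matrixUnits hv huv i, ← sum_mul_eq_of_matrixUnits hu' huv' j, mul_assoc,
        ← mul_assoc _ _ (u' j), h₁, zero_mul, mul_zero]
    have c₂ : ∀ i j, v' i * u j = 0 := fun i j => by
      rw [← mul_sum_eq_of_matrixUnits hv' huv' i, ← sum_mul_eq_of_matrixUnits hu huv j, mul_assoc,
        ← mul_assoc _ _ (u j), h₂, zero_mul, mul_zero]
    intro i j
    refine Fin.addCases (fun i => ?_) (fun i => ?_) i <;>
    refine Fin.addCases (fun j => ?_) (fun j => ?_) j
    · simp [huv]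
    · simp only [Fin.append_left, Fin.append_right, c₁]
      rw [if_neg]
      simp [Fin.ext_iff]; omega
    · simp only [Fin.append_left, Fin.append_right, c₂]
      rw [if_neg]
      simp [Fin.ext_iff]; omega
    · simp [huv']
  · simp [Fin.sum_univ_add]

/-- Idempotents of the same multiplicity are equivalent. -/
theorem HasMultiplicity.exists_equivalence (h : HasMultiplicity g e n)
    (h' : HasMultiplicity g e' n) :
    ∃ a b : Λ, a * b = e ∧ b * a = e' ∧ e * a = a ∧ a * e' = a ∧ e' * b = b ∧ b * e = b := by
  obtain ⟨u, v, hu, hv, huv, rfl⟩ := h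
  obtain ⟨u', v', hu', hv', huv', rfl⟩ := h'
  have key : ∀ {u v u' v' : Fin n → Λ} (_ : ∀ i, u i * g = u i)
      (_ : ∀ i, g * v' i = v' i) (_ : ∀ i j, v i * u j = if i = j then g else 0),
      (∑ i, u' i * v i) * (∑ i, u i * v' i) = ∑ i, u' i * v' i := by
    intro u v u' v' hu hv' h
    rw [Finset.sum_mul_sum]
    refine Finset.sum_congr rfl fun i _ => ?_
    have : ∀ j, u' i * v i * (u j * v' j) = if i = j then u' i * v' i else 0 := fun j => by
      rw [mul_assoc, ← mul_assoc (v i), h]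
      split_ifs with hij
      · subst hij; rw [hv']
      · simp
    simp [this]
  refine ⟨∑ i, u i * v' i, ∑ i, u' i * v i, key hu' hv huv', key hu hv' huv, key hu hv' huv,
    key hu' hv' huv', key hu' hv huv', key hu hv huv⟩

/-- The centre of `gΛg` comes from the centre of `Λ`. -/
theorem exists_central_mul_eq {r : ℕ} (h1 : HasMultiplicity g 1 r) {d : Λ} (hd₁ : g * d = d)
    (hd : ∀ a, g * a * g * d = d * (g * a * g)) :
    ∃ c, (∀ a, a * c = c * a) ∧ d = c * g := by
  obtain ⟨u, v, hu, hv, huv, h⟩ := h1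
  have key : ∀ a, (∑ i, u i * d * v i) * a = a * ∑ i, u i * d * v i := by
    intro a
    calc (∑ i, u i * d * v i) * a = (∑ i, u i * d * v i) * a * ∑ j, u j * v j := by rw [h, mul_one]
      _ = ∑ i, ∑ j, u i * d * v i * a * (u j * v j) := by
        rw [Finset.sum_mul, Finset.sum_mul_sum]
      _ = ∑ i, ∑ j, (u i * v i) * (a * (u j * d * v j)) := by
        refine Finset.sum_congr rfl fun i _ => Finset.sum_congr rfl fun j _ => ?_
        have := hd (v i * a * u j)
        have e : g * (v i * a * u j) * g = v i * a * u j := by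
          rw [← mul_assoc, ← mul_assoc, hv, mul_assoc _ _ g, hu]
        rw [e] at this
        calc u i * d * v i * a * (u j * v j) = u i * (d * (v i * a * u j)) * v j := by
              simp only [mul_assoc]
          _ = _ := by rw [← this]; simp only [mul_assoc]
      _ = a * ∑ i, u i * d * v i := by
        rw [← Finset.sum_mul_sum, h, one_mul, Finset.mul_sum]
  refine ⟨_, fun a => (key a).symm, ?_⟩
  calc d = (∑ i, u i * v i) * d := by rw [h, one_mul]
    _ = (∑ i, u i * d * v i) * g := by
      rw [Finset.sum_mul, Finset.sum_mul]
      refine Finset.sum_congr rfl fun i _ => ?_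
      have := hd (v i)
      rw [hv, mul_assoc, hd₁] at this
      rw [mul_assoc, this, mul_assoc, mul_assoc]

end Multiplicity

/-! ### Hermitian forms over a division idempotent -/

section Star

variable {Λ : Type*} [Ring Λ] {g : Λ}

/-- In the division ring `gΛg`, right inverses are two-sided. -/
theorem IsDivisionIdempotent.left_inverse (hg : IsDivisionIdempotent g) {z : Λ} (h₁ : g * z = z)
    (h₂ : z * g = z) (h₀ : z ≠ 0) : ∃ w, g * w = w ∧ w * g = w ∧ z * w = g ∧ w * z = g := by
  obtain ⟨w, hw⟩ := hg.exists_mul_eq z h₁ h₂ h₀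
  have hgg := hg.idem
  have hw₀ : z * (g * w * g) = g := by
    rw [← mul_assoc, ← mul_assoc, h₂, hw, hgg]
  have e₁ : g * (g * w * g) = g * w * g := by simp only [← mul_assoc, hgg]
  have e₂ : g * w * g * g = g * w * g := by rw [mul_assoc, hgg]
  have hw₁ : g * w * g ≠ 0 := fun h => hg.ne_zero (by rw [← hw₀, h, mul_zero])
  obtain ⟨t, ht⟩ := hg.exists_mul_eq _ e₁ e₂ hw₁
  refine ⟨g * w * g, e₁, e₂, hw₀, ?_⟩
  have hz : z = g * t := by
    calc z = z * (g * w * g * t) := by rw [ht, h₂]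
      _ = g * t := by rw [← mul_assoc, hw₀]
  calc g * w * g * z = g * w * g * g * t := by rw [hz, mul_assoc _ g t]
    _ = g := by rw [e₂, ht]

variable [StarRing Λ]

/-- A nonzero element of `gΛg*` is invertible, that is, an isomorphism `Λg ≅ Λg*`. -/
theorem IsDivisionIdempotent.exists_inverse_star (hg : IsDivisionIdempotent g)
    (hprime : ∀ x y : Λ, (∀ a, x * a * y = 0) → x = 0 ∨ y = 0) {z : Λ} (h₁ : g * z = z)
    (h₂ : z * star g = z) (h₀ : z ≠ 0) :
    ∃ w, star g * w = w ∧ w * g = w ∧ z * w = g ∧ w * z = star g := by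
  have hgg := hg.idem
  have hsg : star g * star g = star g := by rw [← star_mul, hgg]
  have right : ∀ {z : Λ}, g * z = z → z * star g = z → z ≠ 0 →
      ∃ w, star g * w = w ∧ w * g = w ∧ z * w = g := by
    intro z h₁ h₂ h₀
    obtain ⟨a, ha⟩ : ∃ a, z * a * g ≠ 0 := by
      by_contra! h
      exact (hprime z g h).elim h₀ hg.ne_zero
    obtain ⟨w, hw₁, hw₂, hw₃, -⟩ := hg.left_inverse (z := z * a * g)
      (by rw [← mul_assoc, ← mul_assoc, h₁]) (by rw [mul_assoc, hgg]) ha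
    refine ⟨star g * a * g * w, by simp only [← mul_assoc, hsg], by rw [mul_assoc, hw₂], ?_⟩
    rw [← mul_assoc, ← mul_assoc, ← mul_assoc, h₂, hw₃]
  obtain ⟨w, hw₁, hw₂, hw₃⟩ := right h₁ h₂ h₀
  refine ⟨w, hw₁, hw₂, hw₃, ?_⟩
  -- the left inverse is the adjoint of a right inverse of `star z`
  obtain ⟨t, ht₁, ht₂, ht₃⟩ := right (z := star z) (by simpa using congrArg star h₂)
    (by rw [← star_mul, h₁]) (by simpa using h₀)
  have ht : star t * z = star g := by simpa using congrArg star ht₃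
  have : w = star t * g := by
    rw [← hw₃, ← mul_assoc, ht, hw₁]
  rw [this, mul_assoc, h₁, ht]

/-- The pairing `(x, y) ↦ x y*` between `gΛe` and itself is nondegenerate. -/
theorem exists_mul_star_ne_zero
    (hprime : ∀ x y : Λ, (∀ a, x * a * y = 0) → x = 0 ∨ y = 0) {e : Λ} (hg₁ : g * g = g)
    (hg₀ : g ≠ 0) (he : star e = e) (hee : e * e = e) {y : Λ} (hy : y ≠ 0) (hye : y * e = y) :
    ∃ x, g * x = x ∧ x * e = x ∧ x * star y ≠ 0 := by
  obtain ⟨a, ha⟩ : ∃ a, g * a * star y ≠ 0 := by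
    by_contra! h
    exact (hprime g (star y) h).elim hg₀ (by simpa using hy)
  have : e * star y = star y := by simpa [he] using congrArg star hye
  exact ⟨g * a * e, by simp only [← mul_assoc, hg₁], by rw [mul_assoc, hee],
    by rwa [mul_assoc, this]⟩

/-- An element `y` of `gΛ` with `y y* ≠ 0` spans a line on which the hermitian form is
nondegenerate; `e` is the orthogonal projection to that line. -/
theorem IsDivisionIdempotent.exists_projection_line (hg : IsDivisionIdempotent g)
    (hprime : ∀ x y : Λ, (∀ a, x * a * y = 0) → x = 0 ∨ y = 0) {c y : Λ} (hgy : g * y = y)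
    (hyc : y * c = y) (hy : y * star y ≠ 0) :
    ∃ e, star e = e ∧ e * c = e ∧ HasMultiplicity g e 1 := by
  have hyg : star y * star g = star y := by simpa using congrArg star hgy
  obtain ⟨w, hw₁, hw₂, hw₃, hw₄⟩ := hg.exists_inverse_star hprime (z := y * star y)
    (by rw [← mul_assoc, hgy]) (by rw [mul_assoc, hyg]) hy
  have hw : star w = w := by
    have h₁ : star w * (y * star y) = star g := by simpa using congrArg star hw₃
    have h₂ : star w * g = star w := by simpa using congrArg star hw₁
    rw [← h₂, ← hw₃, ← mul_assoc, h₁, hw₁]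
  refine ⟨star y * w * y, by simp [hw, mul_assoc], by rw [mul_assoc, hyc], ?_⟩
  exact HasMultiplicity.of_mul (by rw [mul_assoc, hw₂]) hgy (by rw [← mul_assoc, hw₃])

variable (hg : IsDivisionIdempotent g)
  (hprime : ∀ x y : Λ, (∀ a, x * a * y = 0) → x = 0 ∨ y = 0)
include hg hprime

/-- If the form `(x, y) ↦ x y*` on `gΛ` is not alternating, neither is its restriction to a nonzero
nondegenerate subspace `gΛe`, so that a projection onto a line can be split off from `e`. -/
theorem exists_symmetric_of_not_alternating (h2 : ∀ x : Λ, x + x = 0 → x = 0)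
    {y₀ : Λ} (hgy₀ : g * y₀ = y₀) (hy₀ : y₀ * star y₀ ≠ 0) {e : Λ} (he : star e = e)
    (hee : e * e = e) (he₀ : e ≠ 0) :
    ∃ e₁, star e₁ = e₁ ∧ e₁ * e = e₁ ∧ HasMultiplicity g e₁ 1 := by
  have hgg := hg.idem
  by_cases h : ∃ y, g * y = y ∧ y * e = y ∧ y * star y ≠ 0
  · obtain ⟨y, h₁, h₂, h₃⟩ := h
    exact hg.exists_projection_line hprime h₁ h₂ h₃
  · exfalso
    push Not at h
    have anti : ∀ x y, g * x = x → x * e = x → g * y = y → y * e = y →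
        x * star y = -(y * star x) := fun x y h₁ h₂ h₃ h₄ => by
      have := h (x + y) (by rw [mul_add, h₁, h₃]) (by rw [add_mul, h₂, h₄])
      rw [star_add, mul_add, add_mul, add_mul, h x h₁ h₂, h y h₃ h₄] at this
      rw [eq_neg_iff_add_eq_zero, add_comm]
      simpa using this
    obtain ⟨a, ha⟩ : ∃ a, g * a * e ≠ 0 := by
      by_contra! h
      exact (hprime g e h).elim hg.ne_zero he₀
    have hy₁ : g * (g * a * e) = g * a * e := by simp only [← mul_assoc, hgg]
    have hy₂ : g * a * e * e = g * a * e := by rw [mul_assoc, hee]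
    set y := g * a * e
    obtain ⟨x, hx₁, hx₂, hx₃⟩ := exists_mul_star_ne_zero hprime hgg hg.ne_zero he hee ha hy₂
    obtain ⟨w, hw₁, hw₂, hw₃, hw₄⟩ := hg.exists_inverse_star hprime (z := x * star y)
      (by rw [← mul_assoc, hx₁]) (by rw [mul_assoc]; congr 1; simpa using congrArg star hy₁) hx₃
    -- after rescaling `x`, the value of the form at `(x, y)` is the symmetric element `y₀ y₀*`
    have hc : y₀ * star y₀ * w * x * star y = y₀ * star y₀ := by
      rw [mul_assoc, mul_assoc, hw₄, mul_assoc]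
      congr 1
      simpa using congrArg star hgy₀
    have := anti (y₀ * star y₀ * w * x) y (by simp only [← mul_assoc, hgy₀])
      (by rw [mul_assoc, hx₂]) hy₁ hy₂
    have hs : y * star (y₀ * star y₀ * w * x) = y₀ * star y₀ := by
      have := congrArg star hc
      rw [star_mul, star_star] at this
      rw [this]
      simp
    rw [hs, hc, eq_neg_iff_add_eq_zero] at this
    exact hy₀ (h2 _ this)

/-- If the form `(x, y) ↦ x y*` on `gΛ` is alternating, a projection onto a hyperbolic plane can be
split off from every nonzero symmetric idempotent. -/
theorem exists_symmetric_of_alternating (halt : ∀ y, g * y = y → y * star y = 0) {e : Λ}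
    (he : star e = e) (hee : e * e = e) (he₀ : e ≠ 0) :
    ∃ e₁, star e₁ = e₁ ∧ e₁ * e = e₁ ∧ HasMultiplicity g e₁ 2 := by
  have hgg := hg.idem
  have anti : ∀ x y, g * x = x → g * y = y → y * star x = -(x * star y) := fun x y h₁ h₃ => by
    have := halt (x + y) (by rw [mul_add, h₁, h₃])
    rw [star_add, mul_add, add_mul, add_mul, halt x h₁, halt y h₃] at this
    rw [eq_neg_iff_add_eq_zero]
    simpa using this
  obtain ⟨a, ha⟩ : ∃ a, g * a * e ≠ 0 := by
    by_contra! h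
    exact (hprime g e h).elim hg.ne_zero he₀
  have hy₁ : g * (g * a * e) = g * a * e := by simp only [← mul_assoc, hgg]
  have hy₂ : g * a * e * e = g * a * e := by rw [mul_assoc, hee]
  set y := g * a * e
  obtain ⟨x, hx₁, hx₂, hx₃⟩ := exists_mul_star_ne_zero hprime hgg hg.ne_zero he hee ha hy₂
  obtain ⟨w, hw₁, hw₂, hw₃, hw₄⟩ := hg.exists_inverse_star hprime (z := x * star y)
    (by rw [← mul_assoc, hx₁]) (by rw [mul_assoc]; congr 1; simpa using congrArg star hy₁) hx₃
  have hyx := anti x y hx₁ hy₁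
  have hxx := halt x hx₁
  have hyy := halt y hy₁
  have hsw : star w = -w := by
    have h₁ : star w * (y * star x) = star g := by simpa using congrArg star hw₃
    have h₂ : star w * g = star w := by simpa using congrArg star hw₁
    rw [hyx, mul_neg, neg_eq_iff_eq_neg] at h₁
    rw [← h₂, ← hw₃, ← mul_assoc, h₁, neg_mul, hw₁]
  have hyc : y * (star y * w) = 0 := by rw [← mul_assoc, hyy, zero_mul]
  have hxc : x * (star x * w) = 0 := by rw [← mul_assoc, hxx, zero_mul]
  have hyx' : y * (star x * w) = -g := by rw [← mul_assoc, hyx, neg_mul, hw₃]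
  have hxy' : x * (star y * w) = g := by rw [← mul_assoc, hw₃]
  have hsum := fun (c₁ c₂) => HasMultiplicity.add
    (HasMultiplicity.of_mul (u := star y * w) (v := x) (by rw [mul_assoc, hw₂]) hx₁ hxy')
    (HasMultiplicity.of_mul (u := -(star x * w)) (v := y) (by rw [neg_mul, mul_assoc, hw₂]) hy₁
      (by rw [mul_neg, hyx', neg_neg])) c₁ c₂
  refine ⟨_, ?_, ?_, hsum ?_ ?_⟩
  · simp only [star_add, star_neg, star_mul, star_star, neg_mul, hsw, mul_neg, neg_neg, mul_assoc]
    rw [add_comm]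
  · rw [add_mul, mul_assoc _ x, mul_assoc _ y, hx₂, hy₂]
  · rw [mul_assoc, ← mul_assoc x, mul_neg, hxc]; simp
  · rw [mul_assoc, ← mul_assoc y, hyc]; simp

/-- Symmetric idempotents of every multiplicity exist, except that only even multiplicities are
attained when the form is alternating. -/
theorem exists_symmetric_hasMultiplicity (h2 : ∀ x : Λ, x + x = 0 → x = 0) {r : ℕ}
    (hr : ∀ i, HasMultiplicity g 1 i → i = r) {j : ℕ} (hj : j ≤ r)
    (heven : (∀ y, g * y = y → y * star y = 0) → Even j) :
    ∃ e, star e = e ∧ HasMultiplicity g e j := by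
  have step : ∀ {i m}, i < r → (∃ e, star e = e ∧ HasMultiplicity g e i) →
      (∀ e : Λ, star e = e → e * e = e → e ≠ 0 →
        ∃ e₁, star e₁ = e₁ ∧ e₁ * e = e₁ ∧ HasMultiplicity g e₁ m) →
      ∃ e, star e = e ∧ HasMultiplicity g e (i + m) := by
    rintro i m hi ⟨e, he, hm⟩ H
    have hee := hm.isIdempotentElem
    have hne : 1 - e ≠ 0 := fun h => hi.ne (hr i (by rwa [sub_eq_zero.mp h]))
    obtain ⟨e₁, h₁, h₂, h₃⟩ := H (1 - e) (by simp [he])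
      (by rw [mul_sub, sub_mul, sub_mul, hee]; simp) hne
    have h₄ : e₁ * e = 0 := by
      rw [mul_sub, mul_one, sub_eq_self] at h₂
      exact h₂
    exact ⟨e + e₁, by rw [star_add, he, h₁],
      hm.add h₃ (by simpa [he, h₁] using congrArg star h₄) h₄⟩
  by_cases halt : ∀ y, g * y = y → y * star y = 0
  · obtain ⟨k, rfl⟩ := heven halt
    clear heven
    induction k with
    | zero => exact ⟨0, star_zero _, .zero⟩
    | succ k ih =>
      have := step (m := 2) (by omega) (ih (by omega))
        fun e h₁ h₂ h₃ => exists_symmetric_of_alternating hg hprime halt h₁ h₂ h₃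
      rwa [show k + k + 2 = k + 1 + (k + 1) by ring] at this
  · push Not at halt
    obtain ⟨y₀, hy₀, hy₁⟩ := halt
    clear heven
    induction j with
    | zero => exact ⟨0, star_zero _, .zero⟩
    | succ k ih =>
      exact step (by omega) (ih (by omega))
        fun e h₁ h₂ h₃ => exists_symmetric_of_not_alternating hg hprime h2 hy₀ hy₁ h₁ h₂ h₃

/-- An idempotent `f`, of even multiplicity if the form `(x, y) ↦ x y*` on `gΛ` is alternating, is
equivalent to a symmetric idempotent. An equivalence `x` between the two gives the nondegenerate
hermitian form `x x*` on `f`. -/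
theorem exists_mul_star_mul_eq (h2 : ∀ x : Λ, x + x = 0 → x = 0) {r : ℕ}
    (hr : ∀ i, HasMultiplicity g 1 i → i = r) {f : Λ} {j : ℕ} (hf : HasMultiplicity g f j)
    (hj : j ≤ r) (heven : (∀ y, g * y = y → y * star y = 0) → Even j) :
    ∃ x w, f * x = x ∧ x * star x * w = f := by
  obtain ⟨e, he, hm⟩ := exists_symmetric_hasMultiplicity hg hprime h2 hr hj heven
  obtain ⟨a, b, hab, hba, ha₁, ha₂, hb₁, hb₂⟩ := hm.exists_equivalence hf
  refine ⟨b, star a * a, hb₁, ?_⟩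
  rw [mul_assoc, ← mul_assoc (star b), ← star_mul, hab, he, ha₁, hba]

/-- In the alternating case, a nonzero `z ∈ gΛg*` intertwines `d ∈ gΛg` and `d*`. -/
theorem exists_intertwiner_of_alternating (halt : ∀ y, g * y = y → y * star y = 0) :
    ∃ z w, g * z = z ∧ z * star g = z ∧ star g * w = w ∧ w * g = w ∧ z * w = g ∧
      w * z = star g ∧ ∀ d, g * d = d → d * g = d → d * z = z * star d := by
  have hgg := hg.idem
  obtain ⟨a, ha⟩ : ∃ a, g * a * star g ≠ 0 := by
    by_contra! h
    exact (hprime g (star g) h).elim hg.ne_zero (by simpa using hg.ne_zero)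
  have h₁ : g * (g * a * star g) = g * a * star g := by simp only [← mul_assoc, hgg]
  have h₂ : g * a * star g * star g = g * a * star g := by rw [mul_assoc, ← star_mul, hgg]
  generalize g * a * star g = z at ha h₁ h₂
  obtain ⟨w, hw₁, hw₂, hw₃, hw₄⟩ := hg.exists_inverse_star hprime h₁ h₂ ha
  refine ⟨z, w, h₁, h₂, hw₁, hw₂, hw₃, hw₄, fun d hd₁ hd₂ => ?_⟩
  have anti : ∀ x, g * x = x → x * star g = -(g * star x) := fun x h => by
    have := halt (x + g) (by rw [mul_add, h, hgg])
    rw [star_add, mul_add, add_mul, add_mul, halt x h, halt g hgg] at this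
    rw [eq_neg_iff_add_eq_zero, add_comm]
    simpa using this
  have e₁ := anti (d * z) (by rw [← mul_assoc, hd₁])
  have e₂ := anti z h₁
  rw [h₂] at e₂
  rw [mul_assoc d z, h₂, star_mul, ← mul_assoc] at e₁
  rw [e₁, ← neg_mul, ← e₂]

/-- In the alternating case the division ring `gΛg` is commutative, since `d ↦ d*` reverses
products. -/
theorem mul_comm_of_alternating (halt : ∀ y, g * y = y → y * star y = 0) {d d' : Λ}
    (hd₁ : g * d = d) (hd₂ : d * g = d) (hd₁' : g * d' = d') (hd₂' : d' * g = d') :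
    d * d' = d' * d := by
  obtain ⟨z, w, hz₁, hz₂, hw₁, hw₂, hw₃, hw₄, H⟩ := exists_intertwiner_of_alternating hg hprime halt
  have e₁ : d * d' * z = d' * d * z := by
    rw [mul_assoc, H d' hd₁' hd₂', ← mul_assoc, H d hd₁ hd₂, mul_assoc, ← star_mul,
      ← H (d' * d) (by rw [← mul_assoc, hd₁']) (by rw [mul_assoc, hd₂])]
  have := congrArg (· * w) e₁
  simpa only [mul_assoc, hw₃, hd₂, hd₂'] using this

/-- In the alternating case the involution is of the first kind. -/
theorem star_eq_of_alternating (halt : ∀ y, g * y = y → y * star y = 0) {c : Λ}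
    (hc : ∀ a, a * c = c * a) : star c = c := by
  have hgg := hg.idem
  have hc' : ∀ a, a * star c = star c * a := fun a => by
    simpa using (congrArg star (hc (star a))).symm
  obtain ⟨z, w, hz₁, hz₂, hw₁, hw₂, hw₃, hw₄, H⟩ := exists_intertwiner_of_alternating hg hprime halt
  have e₁ := H (c * g) (by rw [← mul_assoc, hc, mul_assoc, hgg]) (by rw [mul_assoc, hgg])
  rw [mul_assoc, hz₁, star_mul, ← mul_assoc, hz₂, hc'] at e₁
  have e₂ : (star c - c) * g = 0 := by
    rw [← hw₃, ← mul_assoc, sub_mul, e₁, sub_self, zero_mul]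
  refine sub_eq_zero.mp ((hprime (star c - c) g fun a => ?_).resolve_right hg.ne_zero)
  rw [sub_mul, ← hc, ← hc', ← mul_sub, mul_assoc, e₂, mul_zero]

end Star

/-! ### Azumaya algebras modulo a maximal ideal -/

/-- Nakayama's lemma over all maximal ideals at once. -/
theorem Submodule.eq_top_of_forall_sup_smul_top_eq_top {S M : Type*} [CommRing S] [AddCommGroup M]
    [Module S M] [Module.Finite S M] (N : Submodule S M)
    (h : ∀ q : Ideal S, q.IsMaximal → N ⊔ q • ⊤ = ⊤) : N = ⊤ := by
  by_contra hN
  have : Nontrivial (M ⧸ N) := Submodule.Quotient.nontrivial_iff.mpr hN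
  obtain ⟨q, hq, hle⟩ := Ideal.exists_le_maximal (Module.annihilator S (M ⧸ N))
    (fun h => by
      have := Module.annihilator_eq_top_iff.mp h
      exact not_subsingleton _ this)
  have key : (⊤ : Submodule S (M ⧸ N)) ≤ q • ⊤ := by
    have := congrArg (Submodule.map N.mkQ) (h q hq)
    rw [Submodule.map_sup, Submodule.map_smul'', Submodule.map_top, Submodule.range_mkQ,
      Submodule.mkQ_map_self, bot_sup_eq] at this
    exact this.ge
  obtain ⟨r, hr, hr'⟩ := Submodule.exists_sub_one_mem_and_smul_eq_zero_of_fg_of_le_smul q ⊤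
    Module.Finite.fg_top key
  have : r ∈ q := hle (Module.mem_annihilator.mpr fun m => hr' m trivial)
  exact hq.ne_top ((Ideal.eq_top_iff_one q).mpr (by simpa using q.sub_mem this hr))

section Extension

variable {S A : Type*} [CommRing S] [Ring A] [Algebra S A] (q : Ideal S)

instance isTwoSided_map_algebraMap : (q.map (algebraMap S A)).IsTwoSided where
  mul_mem_of_left {a} b ha := by
    induction ha using Submodule.span_induction with
    | mem x hx =>
      obtain ⟨s, hs, rfl⟩ := hx
      change algebraMap S A s * b ∈ _
      rw [Algebra.commutes]
      exact Ideal.mul_mem_left _ _ (Ideal.mem_map_of_mem _ hs)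
    | zero => rw [zero_mul]; exact zero_mem _
    | add x y _ _ hx hy => rw [add_mul]; exact add_mem hx hy
    | smul c x _ hx => rw [smul_eq_mul, mul_assoc]; exact Ideal.mul_mem_left _ _ hx

variable {X : Type*} [AddCommGroup X] [Module S X] [Module A X] [IsScalarTower S A X]

theorem restrictScalars_map_smul_top :
    ((q.map (algebraMap S A)) • (⊤ : Submodule A X)).restrictScalars S =
      q • (⊤ : Submodule S X) := by
  apply le_antisymm
  · intro x hx
    rw [Submodule.restrictScalars_mem] at hx
    induction hx using Submodule.smul_induction_on' with
    | smul a ha x _ =>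
      clear * - ha
      induction ha using Submodule.span_induction generalizing x with
      | mem a ha =>
        obtain ⟨s, hs, rfl⟩ := ha
        rw [algebraMap_smul]
        exact Submodule.smul_mem_smul hs trivial
      | zero => rw [zero_smul]; exact zero_mem _
      | add a b _ _ ha hb => rw [add_smul]; exact add_mem (ha x) (hb x)
      | smul c a _ ha =>
        rw [smul_eq_mul, mul_smul]
        have := Submodule.mem_map_of_mem (f := Algebra.lsmul S S X c) (ha x)
        rw [Submodule.map_smul''] at this
        exact Submodule.smul_mono le_rfl le_top this
    | add x _ y _ hx hy => exact add_mem hx hy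
  · rw [Submodule.smul_le]
    intro s hs x _
    rw [Submodule.restrictScalars_mem, ← algebraMap_smul A]
    exact Submodule.smul_mem_smul (Ideal.mem_map_of_mem _ hs) trivial

theorem mem_map_algebraMap_iff {a : A} :
    a ∈ q.map (algebraMap S A) ↔ a ∈ q • (⊤ : Submodule S A) := by
  rw [← restrictScalars_map_smul_top (A := A), Submodule.restrictScalars_mem, smul_eq_mul,
    Ideal.mul_top]

/-- An element of a projective module outside `qM` can be moved to any other element modulo `qM`. -/
theorem exists_linearMap_sub_mem {M N : Type*} [AddCommGroup M] [Module S M] [Module.Projective S M]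
    [AddCommGroup N] [Module S N] (hq : q.IsMaximal) {x : M} (hx : x ∉ q • (⊤ : Submodule S M))
    (y : N) : ∃ f : M →ₗ[S] N, f x - y ∈ q • (⊤ : Submodule S N) := by
  obtain ⟨s, hs⟩ := Module.projective_def'.mp ‹Module.Projective S M›
  -- some coordinate of `x` in a free module containing `M` as a summand is nonzero modulo `q`
  obtain ⟨i, hi⟩ : ∃ i, s x i ∉ q := by
    by_contra! h
    apply hx
    have : Finsupp.linearCombination S id (s x) = x := LinearMap.congr_fun hs x
    rw [← this, Finsupp.linearCombination_apply]
    exact Submodule.sum_mem _ fun i _ => Submodule.smul_mem_smul (h i) trivial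
  obtain ⟨r, hr⟩ := Ideal.IsMaximal.exists_inv hq hi
  obtain ⟨t, ht, hr⟩ := hr
  refine ⟨LinearMap.toSpanSingleton S N (r • y) ∘ₗ Finsupp.lapply i ∘ₗ s, ?_⟩
  have : (LinearMap.toSpanSingleton S N (r • y) ∘ₗ Finsupp.lapply i ∘ₗ s) x - y = (-t) • y := by
    simp only [LinearMap.comp_apply, LinearMap.toSpanSingleton_apply, Finsupp.lapply_apply,
      smul_smul]
    rw [mul_comm, eq_sub_of_add_eq hr, sub_smul, one_smul, neg_smul]
    abel
  rw [this]
  exact Submodule.smul_mem_smul (q.neg_mem ht) trivial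

/-- An ideal of an Azumaya algebra is stable under all linear endomorphisms. -/
theorem IsAzumaya.map_mem_of_twoSided [IsAzumaya S A] (J : Ideal A) [J.IsTwoSided]
    (f : Module.End S A) {x : A} (hx : x ∈ J) : f x ∈ J := by
  obtain ⟨t, rfl⟩ := (AlgHom.mulLeftRight_bij S A).2 f
  induction t with
  | zero => simp
  | tmul a b => rw [AlgHom.mulLeftRight_apply]; exact J.mul_mem_right _ (J.mul_mem_left _ hx)
  | add t t' h h' => rw [map_add, LinearMap.add_apply]; exact J.add_mem h h'

variable {q}

theorem IsAzumaya.one_notMem [IsAzumaya S A] (hq : q.IsMaximal) :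
    (1 : A) ∉ q • (⊤ : Submodule S A) := by
  intro h
  have h' : (⊤ : Submodule S A) ≤ q • ⊤ := by
    intro a _
    have := Submodule.mem_map_of_mem (f := Algebra.lsmul S S A a) h
    rw [Submodule.map_smul''] at this
    simpa using Submodule.smul_mono le_rfl le_top this
  obtain ⟨r, hr, hr'⟩ := Submodule.exists_sub_one_mem_and_smul_eq_zero_of_fg_of_le_smul q ⊤
    Module.Finite.fg_top h'
  have : r = 0 := FaithfulSMul.eq_of_smul_eq_smul (α := A) fun a => by
    rw [hr' a trivial, zero_smul]
  rw [this, zero_sub, neg_mem_iff] at hr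
  exact hq.ne_top ((Ideal.eq_top_iff_one q).mpr hr)

theorem IsAzumaya.nontrivial_quotient [IsAzumaya S A] (hq : q.IsMaximal) :
    Nontrivial (A ⧸ q.map (algebraMap S A)) := by
  rw [Ideal.Quotient.nontrivial_iff, Ne, Ideal.eq_top_iff_one, mem_map_algebraMap_iff]
  exact IsAzumaya.one_notMem hq

/-- A proper ideal of `A` containing `qA` is stable under `End A`, which acts transitively on the
nonzero elements of `A / qA`. -/
theorem IsAzumaya.isSimpleRing_quotient [IsAzumaya S A] (hq : q.IsMaximal) :
    IsSimpleRing (A ⧸ q.map (algebraMap S A)) := by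
  have := IsAzumaya.nontrivial_quotient (A := A) hq
  refine isSimpleRing_iff_isTwoSided_imp.mpr ⟨this, fun J hJ => or_iff_not_imp_left.mpr fun h => ?_⟩
  obtain ⟨x, hx, hx₀⟩ := Submodule.exists_mem_ne_zero_of_ne_bot h
  obtain ⟨x, rfl⟩ := Ideal.Quotient.mk_surjective x
  rw [Ne, Ideal.Quotient.eq_zero_iff_mem, mem_map_algebraMap_iff] at hx₀
  obtain ⟨f, hf⟩ := exists_linearMap_sub_mem q hq hx₀ (1 : A)
  rw [← mem_map_algebraMap_iff, ← Ideal.Quotient.mk_eq_mk_iff_sub_mem] at hf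
  have := IsAzumaya.map_mem_of_twoSided (S := S) (J.comap (Ideal.Quotient.mk _)) f hx
  rw [Ideal.mem_comap, hf, map_one] at this
  exact (Ideal.eq_top_iff_one J).mpr this

theorem IsAzumaya.isArtinianRing_quotient [IsAzumaya S A] (hq : q.IsMaximal) :
    IsArtinianRing (A ⧸ q.map (algebraMap S A)) := by
  let _ := Ideal.Quotient.field q
  have ht : Module.IsTorsionBySet S (A ⧸ q.map (algebraMap S A)) q := by
    rintro x ⟨s, hs⟩
    obtain ⟨a, rfl⟩ := Ideal.Quotient.mk_surjective x
    change Ideal.Quotient.mk _ (s • a) = 0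
    rw [Ideal.Quotient.eq_zero_iff_mem, mem_map_algebraMap_iff]
    exact Submodule.smul_mem_smul hs trivial
  have : IsSemisimpleModule S (A ⧸ q.map (algebraMap S A)) := by
    let _ := ht.module
    exact ht.isSemisimpleModule_iff.mp inferInstance
  have : Module.Finite S (A ⧸ q.map (algebraMap S A)) :=
    Module.Finite.of_surjective (Ideal.Quotient.mkₐ S _).toLinearMap Ideal.Quotient.mk_surjective
  have : IsArtinian S (A ⧸ q.map (algebraMap S A)) := inferInstance
  exact isArtinian_of_tower S this

end Extension

/-! ### Multiplicities in a simple artinian ring -/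

section Simple

variable {Λ : Type*} [Ring Λ]

/-- Simple rings are prime. -/
theorem IsSimpleRing.eq_zero_or_eq_zero_of_forall_mul_mul [IsSimpleRing Λ] (x y : Λ)
    (h : ∀ a, x * a * y = 0) : x = 0 ∨ y = 0 := by
  let J : TwoSidedIdeal Λ := .mk' {a | ∀ b, a * b * y = 0} (by simp)
    (fun {a a'} ha ha' b => by rw [add_mul, add_mul, ha, ha', add_zero])
    (fun {a} ha b => by rw [neg_mul, neg_mul, ha, neg_zero])
    (fun {a a'} ha b => by rw [mul_assoc a, mul_assoc a, ha, mul_zero])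
    (fun {a a'} ha b => by rw [mul_assoc a, ha])
  refine or_iff_not_imp_left.mpr fun hx => ?_
  have := IsSimpleRing.one_mem_of_ne_zero_mem J hx ((TwoSidedIdeal.mem_mk' ..).mpr h)
  simpa using (TwoSidedIdeal.mem_mk' ..).mp this 1

/-- A minimal left ideal is generated by a division idempotent, by Schur's lemma. -/
theorem exists_isDivisionIdempotent [IsSemisimpleRing Λ] [Nontrivial Λ] :
    ∃ g : Λ, IsDivisionIdempotent g ∧ IsSimpleModule Λ (Ideal.span {g}) := by
  obtain ⟨T, hT⟩ := IsAtomic.exists_atom (Submodule Λ Λ)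
  rw [← isSimpleModule_iff_isAtom] at hT
  obtain ⟨g, hg, rfl⟩ := IsSemisimpleRing.ideal_eq_span_idempotent T
  have hgg : g * g = g := hg
  have hg₀ : g ≠ 0 := by
    rintro rfl
    have := IsSimpleModule.nontrivial Λ (Ideal.span {(0 : Λ)})
    obtain ⟨x, hx⟩ := exists_ne (0 : Ideal.span {(0 : Λ)})
    exact hx (Subtype.ext (by simpa using x.2))
  have inv : ∀ z, g * z = z → z * g = z → z ≠ 0 → ∃ w, g * w = w ∧ w * g = w ∧ w * z = g := by
    intro z h₁ h₂ h₀
    have hle : Ideal.span {z} ≤ Ideal.span {g} := by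
      rw [Ideal.span_singleton_le_iff_mem, ← h₂]
      exact Ideal.mul_mem_left _ _ (Ideal.mem_span_singleton_self g)
    have := (isSimpleModule_iff_isAtom.mp hT).le_iff.mp hle
    rw [Ideal.span_singleton_eq_bot, or_iff_right h₀] at this
    obtain ⟨w, hw⟩ := Ideal.mem_span_singleton'.mp
      (this.symm ▸ Ideal.mem_span_singleton_self g : g ∈ Ideal.span {z})
    refine ⟨g * w * g, by simp only [← mul_assoc, hgg], by rw [mul_assoc, hgg], ?_⟩
    rw [mul_assoc, h₁, mul_assoc, hw, hgg]
  refine ⟨g, ⟨hgg, hg₀, fun z h₁ h₂ h₀ => ?_⟩, hT⟩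
  obtain ⟨w, hw₁, hw₂, hw₃⟩ := inv z h₁ h₂ h₀
  obtain ⟨t, ht₁, ht₂, ht₃⟩ := inv w hw₁ hw₂ (by rintro rfl; exact hg₀ (by rw [← hw₃, zero_mul]))
  refine ⟨w, ?_⟩
  have : z = t := by rw [← h₁, ← ht₃, mul_assoc, hw₃, ht₂]
  rw [this, ht₃]

/-- Over a simple artinian ring every finite module is a power of a given simple module. -/
theorem IsSimpleRing.exists_linearEquiv_fin_fun [IsSimpleRing Λ] [IsArtinianRing Λ]
    (T : Ideal Λ) [IsSimpleModule Λ T] (M : Type*) [AddCommGroup M] [Module Λ M]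
    [Module.Finite Λ M] : ∃ n : ℕ, Nonempty (M ≃ₗ[Λ] Fin n → T) := by
  have h := IsSimpleRing.isIsotypic Λ (M × Λ)
  refine IsIsotypicOfType.linearEquiv_fun (fun m hm => ?_)
  have e₁ := Submodule.equivMapOfInjective (LinearMap.inl Λ M Λ) LinearMap.inl_injective m
  have e₂ := Submodule.equivMapOfInjective (LinearMap.inr Λ M Λ) LinearMap.inr_injective T
  have := IsSimpleModule.congr e₁.symm
  have := IsSimpleModule.congr e₂.symm
  obtain ⟨e⟩ := h (Submodule.map (LinearMap.inr Λ M Λ) T) (Submodule.map (LinearMap.inl Λ M Λ) m)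
  exact ⟨e₁.trans (e.trans e₂.symm)⟩

/-- An isomorphism `Λe ≅ (Λg)ⁿ` amounts to matrix units. -/
theorem hasMultiplicity_of_linearEquiv {g e : Λ} (hg : g * g = g) (he : e * e = e) {n : ℕ}
    (φ : Ideal.span {e} ≃ₗ[Λ] (Fin n → Ideal.span {g})) : HasMultiplicity g e n := by
  have mem : ∀ {e : Λ}, e * e = e → ∀ x : Ideal.span {e}, (x : Λ) * e = x := by
    rintro e he ⟨x, hx⟩
    obtain ⟨a, rfl⟩ := Ideal.mem_span_singleton'.mp hx
    exact (mul_assoc a e e).trans (by rw [he])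
  let e₀ : Ideal.span {e} := ⟨e, Ideal.mem_span_singleton_self e⟩
  let g₀ : Ideal.span {g} := ⟨g, Ideal.mem_span_singleton_self g⟩
  have hgs : g • g₀ = g₀ := Subtype.ext hg
  have hφ : ∀ x, φ x = (x : Λ) • φ e₀ := fun x => by
    rw [← map_smul]
    exact congrArg φ (Subtype.ext (mem he x).symm)
  refine ⟨fun i => φ e₀ i, fun i => φ.symm (Pi.single i g₀), fun i => mem hg _, fun i => ?_,
    fun i j => ?_, ?_⟩
  · change ((g • φ.symm (Pi.single i g₀) : Ideal.span {e}) : Λ) = _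
    rw [← map_smul, ← Pi.single_smul, hgs]
  · have := congrFun (hφ (φ.symm (Pi.single i g₀))) j
    rw [LinearEquiv.apply_symm_apply] at this
    have := congrArg (Subtype.val) this
    refine this.symm.trans ?_
    by_cases h : i = j
    · subst h; simp [g₀]
    · simp [h]
  · have key : ∑ i, (φ e₀ i : Λ) • φ.symm (Pi.single i g₀) = e₀ := by
      apply φ.injective
      ext j
      simp only [map_sum, map_smul, LinearEquiv.apply_symm_apply, Finset.sum_apply, Pi.smul_apply]
      rw [Finset.sum_eq_single j]
      · simp [g₀, mem hg]
      · intro i _ hij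
        simp [Pi.single_eq_of_ne (Ne.symm hij)]
      · simp
    simpa using congrArg Subtype.val key

end Simple

/-! ### Fibre ranks -/

section FiberRank

variable {S : Type*} [CommRing S] (q : Ideal S) [q.IsPrime] {M N : Type*} [AddCommGroup M]
  [Module S M] [AddCommGroup N] [Module S N]

/-- The dimension of the fibre of a module at a prime. -/
noncomputable def fiberRank (M : Type*) [AddCommGroup M] [Module S M] : ℕ :=
  Module.finrank q.ResidueField (q.ResidueField ⊗[S] M)

theorem fiberRank_congr (e : M ≃ₗ[S] N) : fiberRank q M = fiberRank q N :=
  (e.baseChange S q.ResidueField _ _).finrank_eq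

theorem fiberRank_fin_fun [Module.Finite S M] (n : ℕ) :
    fiberRank q (Fin n → M) = n * fiberRank q M := by
  rw [fiberRank,
    (TensorProduct.piRight S q.ResidueField q.ResidueField fun _ : Fin n => M).finrank_eq,
    Module.finrank_pi_fintype]
  simp [fiberRank]

theorem fiberRank_eq_rankAtStalk [Module.Finite S M] [Module.Flat S M] :
    fiberRank q M = Module.rankAtStalk (R := S) M ⟨q, inferInstance⟩ :=
  Ideal.finrank_fiber_eq_rankAtStalk q

theorem fiberRank_eq_of_surjective (π : M →ₗ[S] N) (hπ : Function.Surjective π)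
    (hker : LinearMap.ker π ≤ q • ⊤) : fiberRank q M = fiberRank q N := by
  refine LinearEquiv.finrank_eq (LinearEquiv.ofBijective (π.baseChange q.ResidueField) ⟨?_, ?_⟩)
  · rw [← LinearMap.ker_eq_bot, eq_bot_iff]
    have hex := lTensor_exact q.ResidueField (LinearMap.exact_subtype_ker_map π) hπ
    intro t ht
    obtain ⟨t, rfl⟩ := (hex t).mp ht
    have zero : ∀ c : q.ResidueField, ∀ x ∈ q • (⊤ : Submodule S M), c ⊗ₜ[S] x = 0 := by
      intro c x hx
      induction hx using Submodule.smul_induction_on' with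
      | smul s hs x _ =>
        rw [← TensorProduct.smul_tmul, Algebra.smul_def,
          Ideal.algebraMap_residueField_eq_zero.mpr hs, zero_mul, TensorProduct.zero_tmul]
      | add x _ y _ hx hy => rw [TensorProduct.tmul_add, hx, hy, add_zero]
    rw [Submodule.mem_bot, show LinearMap.lTensor q.ResidueField (LinearMap.ker π).subtype = 0 from
      TensorProduct.ext' fun c x => by
        rw [LinearMap.lTensor_tmul]; exact zero c x (hker x.2), LinearMap.zero_apply]
  · exact LinearMap.lTensor_surjective _ hπ

end FiberRank

/-! ### Ranks of Peirce components -/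

section Peirce

variable (S : Type*) {A : Type*} [CommRing S] [Ring A] [Algebra S A]

/-- The Peirce component `eAe'` of an algebra. -/
def peirceComponent (e e' : A) : Submodule S A :=
  LinearMap.range (LinearMap.mulLeft S e ∘ₗ LinearMap.mulRight S e')

variable {S}

theorem mem_peirce {e e' x : A} (he : e * e = e) (he' : e' * e' = e') :
    x ∈ peirceComponent S e e' ↔ e * x = x ∧ x * e' = x := by
  constructor
  · rintro ⟨y, rfl⟩
    simp only [LinearMap.comp_apply, LinearMap.mulLeft_apply, LinearMap.mulRight_apply]
    exact ⟨by rw [← mul_assoc, he], by rw [mul_assoc, mul_assoc, he']⟩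
  · rintro ⟨h₁, h₂⟩
    exact ⟨x, by simp [h₁, h₂]⟩

instance [Module.Finite S A] (e e' : A) : Module.Finite S (peirceComponent S e e') :=
  Module.Finite.range _

theorem peirce_projective [Module.Projective S A] {e e' : A} (he : e * e = e) (he' : e' * e' = e') :
    Module.Projective S (peirceComponent S e e') := by
  refine Module.Projective.of_split (peirceComponent S e e').subtype
    ((LinearMap.mulLeft S e ∘ₗ LinearMap.mulRight S e').rangeRestrict) ?_
  refine LinearMap.ext fun x => Subtype.ext ?_
  obtain ⟨h₁, h₂⟩ := (mem_peirce he he').mp x.2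
  change e * ((x : A) * e') = x
  rw [h₂, h₁]

theorem range_mulLeft_eq_peirce (e : A) :
    LinearMap.range (LinearMap.mulLeft S e) = peirceComponent S e 1 := by
  rw [peirceComponent, LinearMap.mulRight_one]; rfl

theorem restrictScalars_span_singleton (e : A) :
    (Ideal.span {e}).restrictScalars S = peirceComponent S 1 e := by
  ext x
  rw [Submodule.restrictScalars_mem, Ideal.mem_span_singleton', peirceComponent,
    LinearMap.mulLeft_one]
  rfl

/-- The left ideal `Ae`, as an `S`-module. -/
noncomputable def spanSingletonEquivPeirce (e : A) : Ideal.span {e} ≃ₗ[S] peirceComponent S 1 e :=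
  (LinearEquiv.ofEq _ _ (restrictScalars_span_singleton e) :
    (Ideal.span {e}).restrictScalars S ≃ₗ[S] peirceComponent S 1 e)

/-- `eAe'` consists of `n × m` matrices over `gAg` when `e` and `e'` have multiplicities `n` and
`m`. -/
theorem HasMultiplicity.nonempty_peirce_equiv {g e e' : A} {n m : ℕ} (hg : g * g = g)
    (h : HasMultiplicity g e n) (h' : HasMultiplicity g e' m) :
    Nonempty (peirceComponent S e e' ≃ₗ[S] (Fin n → Fin m → peirceComponent S g g)) := by
  have hee := h.isIdempotentElem
  have hee' := h'.isIdempotentElem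
  obtain ⟨u, v, hu, hv, huv, he⟩ := h
  obtain ⟨u', v', hu', hv', huv', he'⟩ := h'
  have hue : ∀ i, e * u i = u i := fun i => he ▸ sum_mul_eq_of_matrixUnits hu huv i
  have hve' : ∀ i, v' i * e' = v' i := fun i => he' ▸ mul_sum_eq_of_matrixUnits hv' huv' i
  refine ⟨LinearEquiv.ofLinearMap
    (LinearMap.pi fun i => LinearMap.pi fun j => LinearMap.codRestrict _
      ((LinearMap.mulLeft S (v i) ∘ₗ LinearMap.mulRight S (u' j)) ∘ₗ
        (peirceComponent S e e').subtype)
      fun x => (mem_peirce hg hg).mpr ⟨?_, ?_⟩)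
    (LinearMap.codRestrict _ (∑ i, ∑ j, (LinearMap.mulLeft S (u i) ∘ₗ LinearMap.mulRight S (v' j))
      ∘ₗ (peirceComponent S g g).subtype ∘ₗ LinearMap.proj j ∘ₗ LinearMap.proj i)
      fun y => (mem_peirce hee hee').mpr ⟨?_, ?_⟩) ?_ ?_⟩
  · simp [← mul_assoc, hv]
  · simp [mul_assoc, hu']
  · simp [Finset.mul_sum, ← mul_assoc, hue]
  · simp [Finset.sum_mul, mul_assoc, hve']
  · refine LinearMap.ext fun y => ?_
    ext i j
    have hy := fun i j => (mem_peirce hg hg).mp (y i j).2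
    simp only [LinearMap.comp_apply, LinearMap.pi_apply, LinearMap.codRestrict_apply,
      LinearMap.sum_apply, Submodule.subtype_apply, LinearMap.proj_apply, LinearMap.mulLeft_apply,
      LinearMap.mulRight_apply, Finset.mul_sum, Finset.sum_mul, LinearMap.id_apply]
    have : ∀ k l, v i * (u k * (y k l * v' l) * u' j) =
        if i = k then (if l = j then (y k l : A) else 0) else 0 := fun k l => by
      rw [show v i * (u k * (y k l * v' l) * u' j) = (v i * u k) * y k l * (v' l * u' j) by
        simp only [mul_assoc], huv, huv']
      split_ifs <;> simp [(hy k l).1, (hy k l).2]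
    simp [this]
  · refine LinearMap.ext fun x => ?_
    ext
    obtain ⟨h₁, h₂⟩ := (mem_peirce hee hee').mp x.2
    simp only [LinearMap.comp_apply, LinearMap.pi_apply, LinearMap.codRestrict_apply,
      LinearMap.sum_apply, Submodule.subtype_apply, LinearMap.proj_apply, LinearMap.mulLeft_apply,
      LinearMap.mulRight_apply, LinearMap.id_apply]
    have : ∀ i j, u i * (v i * (x * u' j) * v' j) =
        (u i * v i) * (x * (u' j * v' j)) := fun i j => by
      simp only [mul_assoc]
    simp only [this, ← Finset.mul_sum, he', ← Finset.sum_mul, he, h₁, h₂]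

theorem HasMultiplicity.fiberRank_peirce [Module.Finite S A] (q : Ideal S) [q.IsPrime]
    {g e e' : A} {n m : ℕ} (hg : g * g = g)
    (h : HasMultiplicity g e n) (h' : HasMultiplicity g e' m) :
    fiberRank q (peirceComponent S e e') = n * (m * fiberRank q (peirceComponent S g g)) := by
  obtain ⟨φ⟩ := h.nonempty_peirce_equiv (S := S) hg h'
  rw [fiberRank_congr q φ, fiberRank_fin_fun, fiberRank_fin_fun]

end Peirce

section Reduction

variable {S A : Type*} [CommRing S] [Ring A] [Algebra S A] (q : Ideal S)

/-- The Peirce components of `A` and of `A / qA` have the same fibre at `q`. -/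
theorem fiberRank_peirce_quotient [q.IsPrime] {e e' : A} (he : e * e = e) (he' : e' * e' = e') :
    fiberRank q (peirceComponent S e e') =
      fiberRank q (peirceComponent S (Ideal.Quotient.mk (q.map (algebraMap S A)) e)
        (Ideal.Quotient.mk (q.map (algebraMap S A)) e')) := by
  let p := LinearMap.mulLeft S e ∘ₗ LinearMap.mulRight S e'
  let π : peirceComponent S e e' →ₗ[S]
      peirceComponent S (Ideal.Quotient.mk (q.map (algebraMap S A)) e) (Ideal.Quotient.mk _ e') :=
    (Ideal.Quotient.mkₐ S (q.map (algebraMap S A))).toLinearMap.restrict (by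
      rintro _ ⟨x, rfl⟩
      exact ⟨Ideal.Quotient.mk _ x, by simp⟩)
  refine fiberRank_eq_of_surjective q π ?_ ?_
  · rintro ⟨_, x, rfl⟩
    obtain ⟨x, rfl⟩ := Ideal.Quotient.mk_surjective x
    exact ⟨⟨_, x, rfl⟩, Subtype.ext (by simp [π])⟩
  · intro x hx
    have h₁ : (x : A) ∈ q.map (algebraMap S A) :=
      Ideal.Quotient.eq_zero_iff_mem.mp (congrArg Subtype.val hx)
    rw [mem_map_algebraMap_iff] at h₁
    have h₂ := Submodule.mem_map_of_mem (f := p.rangeRestrict) h₁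
    rw [Submodule.map_smul''] at h₂
    have h₃ : p.rangeRestrict x = x := by
      obtain ⟨e₁, e₂⟩ := (mem_peirce he he').mp x.2
      ext
      simp [p, e₁, e₂]
    rw [h₃] at h₂
    exact Submodule.smul_mono le_rfl le_top h₂

variable {X : Type*} [AddCommGroup X] [Module S X] [Module A X] [IsScalarTower S A X]

theorem fiberRank_quotient_smul_top [q.IsPrime] :
    fiberRank q X = fiberRank q (X ⧸ (q.map (algebraMap S A)) • (⊤ : Submodule A X)) := by
  let π : X →ₗ[S] X ⧸ (q.map (algebraMap S A)) • (⊤ : Submodule A X) :=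
    { toFun := Submodule.Quotient.mk
      map_add' := fun _ _ => rfl
      map_smul' := fun _ _ => rfl }
  refine fiberRank_eq_of_surjective q π (Submodule.Quotient.mk_surjective _) fun x hx => ?_
  have h₁ : (Submodule.Quotient.mk x : X ⧸ (q.map (algebraMap S A)) • (⊤ : Submodule A X)) = 0 := hx
  rw [Submodule.Quotient.mk_eq_zero] at h₁
  rw [← restrictScalars_map_smul_top (A := A), Submodule.restrictScalars_mem]
  exact h₁

instance isScalarTower_quotient_smul_top : IsScalarTower S (A ⧸ q.map (algebraMap S A))
    (X ⧸ (q.map (algebraMap S A)) • (⊤ : Submodule A X)) where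
  smul_assoc s a x := by
    obtain ⟨a, rfl⟩ := Ideal.Quotient.mk_surjective a
    obtain ⟨x, rfl⟩ := Submodule.Quotient.mk_surjective _ x
    change Submodule.Quotient.mk ((s • a) • x) = Submodule.Quotient.mk (s • a • x)
    rw [smul_assoc]

end Reduction

theorem rankAtStalk_pos_of_faithful {S : Type*} [CommRing S] (M : Type*) [AddCommGroup M]
    [Module S M] [Module.Finite S M] [Module.Flat S M] [FaithfulSMul S M] (p : PrimeSpectrum S) :
    0 < Module.rankAtStalk (R := S) M p := by
  rw [Module.rankAtStalk_pos_iff_mem_support, Module.support_eq_zeroLocus,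
    Module.annihilator_eq_bot.mpr ‹_›]
  simp

section Azumaya

variable {S A : Type*} [CommRing S] [Ring A] [Algebra S A] [IsAzumaya S A]

/-- Numerical data of an Azumaya algebra modulo a maximal ideal: the quotient is a matrix ring of
size `r` over a division ring of dimension `c`, and idempotents have multiplicities. -/
theorem IsAzumaya.exists_divisionIdempotent {q : Ideal S} (hq : q.IsMaximal) :
    ∃ g : A ⧸ q.map (algebraMap S A), IsDivisionIdempotent g ∧
      IsSimpleModule (A ⧸ q.map (algebraMap S A)) (Ideal.span {g}) ∧
      (∀ e, e * e = e → ∃ n, HasMultiplicity g e n) ∧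
      fiberRank q (peirceComponent S g g) ≠ 0 := by
  have := IsAzumaya.isSimpleRing_quotient (A := A) hq
  have := IsAzumaya.isArtinianRing_quotient (A := A) hq
  have := IsAzumaya.nontrivial_quotient (A := A) hq
  obtain ⟨g, hg, hs⟩ := exists_isDivisionIdempotent (Λ := A ⧸ q.map (algebraMap S A))
  have H : ∀ e, e * e = e → ∃ n, HasMultiplicity g e n := fun e he => by
    obtain ⟨n, ⟨φ⟩⟩ := IsSimpleRing.exists_linearEquiv_fin_fun (Ideal.span {g}) (Ideal.span {e})
    exact ⟨n, hasMultiplicity_of_linearEquiv hg.idem he φ⟩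
  refine ⟨g, hg, hs, H, fun h₀ => ?_⟩
  obtain ⟨r, hr⟩ := H 1 (mul_one 1)
  have : Module.Finite S (A ⧸ q.map (algebraMap S A)) :=
    Module.Finite.of_surjective (Ideal.Quotient.mkₐ S _).toLinearMap Ideal.Quotient.mk_surjective
  have h₁ := hr.fiberRank_peirce (S := S) q hg.idem hr
  have h₂ := fiberRank_peirce_quotient (A := A) q (mul_one 1) (mul_one 1)
  rw [map_one, h₁, h₀, ← range_mulLeft_eq_peirce, LinearMap.mulLeft_one, LinearMap.range_id,
    fiberRank_congr q Submodule.topEquiv, fiberRank_eq_rankAtStalk] at h₂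
  have h₃ := rankAtStalk_pos_of_faithful A (⟨q, hq.isPrime⟩ : PrimeSpectrum S)
  simp only [mul_zero] at h₂
  omega

/-- For an idempotent `e` of an Azumaya algebra `A`, the left and right ideals `Ae` and `eA` have
the same rank, and the rank of `eAe` is `(rank eA)² / rank A`. -/
theorem IsAzumaya.rankAtStalk_peirce {e : A} (he : e * e = e) (p : PrimeSpectrum S) :
    Module.rankAtStalk (R := S) (peirceComponent S e 1) p =
      Module.rankAtStalk (R := S) (peirceComponent S 1 e) p ∧
    Module.rankAtStalk (R := S) (peirceComponent S e e) p * Module.rankAtStalk (R := S) A p =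
      Module.rankAtStalk (R := S) (peirceComponent S e 1) p ^ 2 := by
  have := peirce_projective (S := S) he (mul_one 1)
  have := peirce_projective (S := S) (mul_one 1) he
  have := peirce_projective (S := S) he he
  obtain ⟨m, hm, hle⟩ := Ideal.exists_le_maximal p.asIdeal p.2.ne_top
  -- ranks are constant along specialisation, so it suffices to treat a maximal ideal
  have hp : p ≤ ⟨m, hm.isPrime⟩ := hle
  simp only [Module.rankAtStalk_eq_of_le_of_finite_of_flat _ hp, ← fiberRank_eq_rankAtStalk]
  obtain ⟨g, hg, -, H, -⟩ := IsAzumaya.exists_divisionIdempotent (A := A) hm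
  have : Module.Finite S (A ⧸ m.map (algebraMap S A)) :=
    Module.Finite.of_surjective (Ideal.Quotient.mkₐ S _).toLinearMap Ideal.Quotient.mk_surjective
  obtain ⟨r, hr⟩ := H 1 (mul_one 1)
  obtain ⟨n, hn⟩ := H (Ideal.Quotient.mk _ e) (by rw [← map_mul, he])
  have h₁ : fiberRank m A = fiberRank m (peirceComponent S (1 : A) 1) := by
    rw [← range_mulLeft_eq_peirce, LinearMap.mulLeft_one, LinearMap.range_id,
      fiberRank_congr m Submodule.topEquiv]
  rw [h₁, fiberRank_peirce_quotient (A := A) m he (mul_one 1),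
    fiberRank_peirce_quotient (A := A) m (mul_one 1) he, fiberRank_peirce_quotient (A := A) m he he,
    fiberRank_peirce_quotient (A := A) m (mul_one 1) (mul_one 1), map_one,
    hr.fiberRank_peirce m hg.idem hr, hn.fiberRank_peirce m hg.idem hr,
    hr.fiberRank_peirce m hg.idem hn, hn.fiberRank_peirce m hg.idem hn]
  constructor <;> ring

/-- A finite module modulo a maximal ideal is a power of the simple module, and its rank is
determined by the exponent. -/
theorem IsAzumaya.exists_linearEquiv_quotient {q : Ideal S} (hq : q.IsMaximal)
    {g : A ⧸ q.map (algebraMap S A)}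
    (hs : IsSimpleModule (A ⧸ q.map (algebraMap S A)) (Ideal.span {g}))
    (X : Type*) [AddCommGroup X] [Module S X] [Module A X] [IsScalarTower S A X]
    [Module.Finite A X] :
    ∃ n, Nonempty ((X ⧸ (q.map (algebraMap S A)) • (⊤ : Submodule A X))
        ≃ₗ[A ⧸ q.map (algebraMap S A)] (Fin n → Ideal.span {g})) ∧
      fiberRank q X = n * fiberRank q (peirceComponent S 1 g) := by
  have := IsAzumaya.isSimpleRing_quotient (A := A) hq
  have := IsAzumaya.isArtinianRing_quotient (A := A) hq
  have : Module.Finite A (X ⧸ (q.map (algebraMap S A)) • (⊤ : Submodule A X)) := inferInstance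
  have : Module.Finite (A ⧸ q.map (algebraMap S A))
      (X ⧸ (q.map (algebraMap S A)) • (⊤ : Submodule A X)) := by
    have : IsScalarTower A (A ⧸ q.map (algebraMap S A))
        (X ⧸ (q.map (algebraMap S A)) • (⊤ : Submodule A X)) := inferInstance
    exact Module.Finite.of_restrictScalars_finite A _ _
  have : Module.Finite S (A ⧸ q.map (algebraMap S A)) :=
    Module.Finite.of_surjective (Ideal.Quotient.mkₐ S _).toLinearMap Ideal.Quotient.mk_surjective
  obtain ⟨n, ⟨φ⟩⟩ := IsSimpleRing.exists_linearEquiv_fin_fun (Ideal.span {g})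
    (X ⧸ (q.map (algebraMap S A)) • (⊤ : Submodule A X))
  refine ⟨n, ⟨φ⟩, ?_⟩
  rw [fiberRank_quotient_smul_top (A := A), ← fiberRank_fin_fun]
  exact fiberRank_congr q ((φ.restrictScalars S).trans
    (LinearEquiv.piCongrRight fun _ => spanSingletonEquivPeirce g))

end Azumaya

/-! ### Surjections over a semilocal ring -/

/-- The Chinese remainder theorem for the maximal ideals of a semilocal ring. -/
theorem MaximalSpectrum.exists_approximate_idempotents (S : Type*) [CommRing S]
    [Finite (MaximalSpectrum S)] : ∃ s : MaximalSpectrum S → S,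
      (∀ q, s q - 1 ∈ q.asIdeal) ∧ ∀ q q', q ≠ q' → s q ∈ q'.asIdeal := by
  classical
  have := fun q : MaximalSpectrum S => Ideal.exists_forall_sub_mem_ideal
    (I := fun q : MaximalSpectrum S => q.asIdeal)
    (fun i j hij => Ideal.isCoprime_of_isMaximal
      (fun h => hij (MaximalSpectrum.ext h))) (fun q' => if q = q' then 1 else 0)
  choose s hs using this
  refine ⟨s, fun q => by simpa using hs q q, fun q q' h => by
    simpa [h] using hs q q'⟩

section Surjection

variable {S A : Type*} [CommRing S] [Ring A] [Algebra S A]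

/-- Over a semilocal ring, an element prescribed modulo each maximal ideal exists. -/
theorem exists_forall_sub_mem_smul_top [Finite (MaximalSpectrum S)] {M : Type*} [AddCommGroup M]
    [Module S M] (x : MaximalSpectrum S → M) :
    ∃ y : M, ∀ q, y - x q ∈ q.asIdeal • (⊤ : Submodule S M) := by
  classical
  have := Fintype.ofFinite (MaximalSpectrum S)
  obtain ⟨s, hs₁, hs₂⟩ := MaximalSpectrum.exists_approximate_idempotents S
  refine ⟨∑ q, s q • x q, fun q => ?_⟩
  rw [← Finset.add_sum_erase _ _ (Finset.mem_univ q), add_sub_right_comm]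
  refine add_mem ?_ (Submodule.sum_mem _ fun q' hq' => ?_)
  · have : s q • x q - x q = (s q - 1) • x q := by rw [sub_smul, one_smul]
    rw [this]
    exact Submodule.smul_mem_smul (hs₁ q) trivial
  · exact Submodule.smul_mem_smul (hs₂ _ _ (Finset.ne_of_mem_erase hq')) trivial

variable [IsAzumaya S A]
  {X Y : Type*} [AddCommGroup X] [Module S X] [Module A X] [IsScalarTower S A X]
  [AddCommGroup Y] [Module S Y] [Module A Y] [IsScalarTower S A Y]
  [Module.Finite A X] [Module.Finite A Y] [Module.Projective A X]

/-- Modulo `q` finite modules are powers of one simple module, so a module of larger rank maps onto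
one of smaller rank; projectivity lifts the map. -/
theorem exists_linearMap_surjective_mod {q : Ideal S} (hq : q.IsMaximal)
    (h : fiberRank q Y ≤ fiberRank q X) :
    ∃ u : X →ₗ[A] Y, ∀ y, ∃ x, u x - y ∈ q • (⊤ : Submodule S Y) := by
  obtain ⟨g, hg, hs, H, hc⟩ := IsAzumaya.exists_divisionIdempotent (A := A) hq
  obtain ⟨n, ⟨φ⟩, hn⟩ := IsAzumaya.exists_linearEquiv_quotient hq hs X
  obtain ⟨m, ⟨ψ⟩, hm⟩ := IsAzumaya.exists_linearEquiv_quotient hq hs Y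
  have : Module.Finite S (A ⧸ q.map (algebraMap S A)) :=
    Module.Finite.of_surjective (Ideal.Quotient.mkₐ S _).toLinearMap Ideal.Quotient.mk_surjective
  have ht : 0 < fiberRank q (peirceComponent S 1 g) := by
    obtain ⟨r, hr⟩ := H 1 (mul_one 1)
    have := IsAzumaya.nontrivial_quotient (A := A) hq
    have hr₀ : r ≠ 0 := by
      rintro rfl
      obtain ⟨u, v, -, -, -, h⟩ := hr
      simp at h
    have hg1 : HasMultiplicity g g 1 := by
      simpa [hg.idem] using HasMultiplicity.of_mul hg.idem hg.idem hg.idem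
    rw [hr.fiberRank_peirce q hg.idem hg1]
    positivity
  have hmn : m ≤ n := by
    rw [hm, hn] at h
    exact Nat.le_of_mul_le_mul_right h ht
  let I := q.map (algebraMap S A)
  let π : (X ⧸ I • (⊤ : Submodule A X)) →ₗ[A ⧸ I] Y ⧸ I • (⊤ : Submodule A Y) :=
    ψ.symm.toLinearMap ∘ₗ LinearMap.funLeft _ _ (Fin.castLE hmn) ∘ₗ φ.toLinearMap
  have hπ : Function.Surjective π :=
    ψ.symm.surjective.comp ((LinearMap.funLeft_surjective_of_injective (A ⧸ I) _ _
      (Fin.castLE_injective hmn)).comp φ.surjective)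
  obtain ⟨u, hu⟩ := Module.projective_lifting_property (Submodule.mkQ (I • (⊤ : Submodule A Y)))
    (π.restrictScalars A ∘ₗ Submodule.mkQ (I • (⊤ : Submodule A X))) (Submodule.mkQ_surjective _)
  refine ⟨u, fun y => ?_⟩
  obtain ⟨x, hx⟩ := hπ.comp (Submodule.mkQ_surjective _) (Submodule.mkQ _ y)
  refine ⟨x, ?_⟩
  have h₁ := LinearMap.congr_fun hu x
  rw [← restrictScalars_map_smul_top (A := A), Submodule.restrictScalars_mem,
    ← Submodule.Quotient.eq]
  exact h₁.trans hx

/-- Over a semilocal ring, a finite projective module of at least the rank of `Y` at every maximal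
ideal maps onto `Y`. -/
theorem exists_linearMap_surjective [Finite (MaximalSpectrum S)]
    (h : ∀ q : Ideal S, ∀ [q.IsMaximal], fiberRank q Y ≤ fiberRank q X) :
    ∃ u : X →ₗ[A] Y, Function.Surjective u := by
  have := fun q : MaximalSpectrum S =>
    have := q.isMaximal
    exists_linearMap_surjective_mod (A := A) q.isMaximal (h q.asIdeal)
  choose v hv using this
  obtain ⟨u, hu⟩ := exists_forall_sub_mem_smul_top (S := S) v
  have : Module.Finite S Y := Module.Finite.trans A Y
  refine ⟨u, ?_⟩
  have key := Submodule.eq_top_of_forall_sup_smul_top_eq_top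
    (LinearMap.range (u.restrictScalars S)) fun q hq => eq_top_iff.mpr fun y _ => by
      obtain ⟨x, hx⟩ := hv ⟨q, hq⟩ y
      have h₁ := Submodule.mem_map_of_mem (f := (LinearMap.applyₗ' S x :
        (X →ₗ[A] Y) →ₗ[S] Y)) (hu ⟨q, hq⟩)
      rw [Submodule.map_smul''] at h₁
      have h₂ : u x - v ⟨q, hq⟩ x ∈ q • (⊤ : Submodule S Y) := Submodule.smul_mono le_rfl le_top h₁
      have h₃ := add_mem h₂ hx
      rw [sub_add_sub_cancel] at h₃
      rw [← sub_sub_cancel (u x) y]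
      exact sub_mem (Submodule.mem_sup_left ⟨x, rfl⟩) (Submodule.mem_sup_right h₃)
  exact fun y => (key.ge trivial : y ∈ LinearMap.range (u.restrictScalars S))

end Surjection

/-! ### Ranks of modules of homomorphisms, and Morita equivalence -/

section Rank

variable {S : Type*} [CommRing S]

/-- The rank of `Hom(P, N)`; finite presentation lets `Hom` commute with localization. -/
theorem rankAtStalk_linearMap (P N : Type*) [AddCommGroup P] [Module S P] [AddCommGroup N]
    [Module S N] [Module.Finite S P] [Module.Projective S P] [Module.Finite S N]
    [Module.Projective S N] (q : PrimeSpectrum S) :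
    Module.rankAtStalk (R := S) (P →ₗ[S] N) q =
      Module.rankAtStalk (R := S) P q * Module.rankAtStalk (R := S) N q := by
  have : Module.FinitePresentation S P := Module.finitePresentation_of_projective S P
  have := Module.free_of_flat_of_isLocalRing (R := Localization.AtPrime q.asIdeal)
    (P := Localization.AtPrime q.asIdeal ⊗[S] P)
  have := Module.free_of_flat_of_isLocalRing (R := Localization.AtPrime q.asIdeal)
    (P := Localization.AtPrime q.asIdeal ⊗[S] N)
  simp only [Module.rankAtStalk_eq_finrank_tensorProduct]
  rw [(Module.FinitePresentation.isBaseChange_map S P N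
    (Localization.AtPrime q.asIdeal)).equiv.finrank_eq, Module.finrank_linearMap]

theorem rankAtStalk_eq_zero_of_smul_eq_zero {M : Type*} [AddCommGroup M] [Module S M]
    {q : PrimeSpectrum S} {s : S} (hs : s ∉ q.asIdeal) (h : ∀ x : M, s • x = 0) :
    Module.rankAtStalk (R := S) M q = 0 := by
  have : Subsingleton (LocalizedModule q.asIdeal.primeCompl M) :=
    LocalizedModule.subsingleton_iff.mpr fun m => ⟨s, hs, h m⟩
  exact Module.finrank_zero_of_subsingleton

/-- A faithful finite projective module over a semilocal ring has a free summand of rank one. -/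
theorem exists_dual_apply_eq_one [Finite (MaximalSpectrum S)] (P : Type*) [AddCommGroup P]
    [Module S P] [Module.Finite S P] [Module.Projective S P] [FaithfulSMul S P] :
    ∃ (v : P) (φ : Module.Dual S P), φ v = 1 := by
  have key : ∀ q : MaximalSpectrum S, ∃ (v : P) (φ : Module.Dual S P),
      φ v - 1 ∈ q.asIdeal := by
    intro q
    obtain ⟨x, hx⟩ : ∃ x : P, x ∉ q.asIdeal • (⊤ : Submodule S P) := by
      by_contra! h
      obtain ⟨r, hr, hr'⟩ := Submodule.exists_sub_one_mem_and_smul_eq_zero_of_fg_of_le_smul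
        q.asIdeal ⊤ Module.Finite.fg_top fun x _ => h x
      have : r = 0 := FaithfulSMul.eq_of_smul_eq_smul (α := P) fun a => by
        rw [hr' a trivial, zero_smul]
      rw [this, zero_sub, neg_mem_iff] at hr
      exact q.isMaximal.ne_top ((Ideal.eq_top_iff_one _).mpr hr)
    obtain ⟨φ, hφ⟩ := exists_linearMap_sub_mem q.asIdeal q.isMaximal hx (1 : S)
    exact ⟨x, φ, by simpa using hφ⟩
  choose v φ h using key
  obtain ⟨w, hw⟩ := exists_forall_sub_mem_smul_top (S := S) v
  obtain ⟨ψ, hψ⟩ := exists_forall_sub_mem_smul_top (S := S) φ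
  -- `ψ w` is congruent to one modulo every maximal ideal, hence a unit
  have hu : IsUnit (ψ w) := by
    by_contra hu
    obtain ⟨q, hq, hle⟩ := exists_max_ideal_of_mem_nonunits hu
    have h₁ : ψ w - φ ⟨q, hq⟩ w ∈ q := by
      have := Submodule.mem_map_of_mem (f := (LinearMap.applyₗ w : Module.Dual S P →ₗ[S] S))
        (hψ ⟨q, hq⟩)
      rw [Submodule.map_smul''] at this
      simpa using Submodule.smul_mono le_rfl le_top this
    have h₂ : φ ⟨q, hq⟩ w - φ ⟨q, hq⟩ (v ⟨q, hq⟩) ∈ q := by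
      have := Submodule.mem_map_of_mem (f := φ ⟨q, hq⟩) (hw ⟨q, hq⟩)
      rw [Submodule.map_smul''] at this
      simpa using Submodule.smul_mono le_rfl le_top this
    have h₃ := q.sub_mem hle (add_mem h₁ (add_mem h₂ (h ⟨q, hq⟩)))
    exact hq.ne_top ((Ideal.eq_top_iff_one q).mpr (by simpa using h₃))
  obtain ⟨u, hu⟩ := hu
  exact ⟨w, (↑u⁻¹ : S) • ψ, by rw [LinearMap.smul_apply, ← hu, smul_eq_mul, Units.inv_mul]⟩

/-- The Morita decomposition of an algebra `C` containing `End P`: with `ε = v ⊗ φ` a projection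
onto a line of `P`, every left ideal `Ch` is `P ⊗ εCh`. -/
theorem nonempty_tensor_peirce_equiv {P : Type*} [AddCommGroup P] [Module S P] [Module.Finite S P]
    [Module.Projective S P] {C : Type*} [Ring C] [Algebra S C] (θ : Module.End S P →ₐ[S] C)
    {v : P} {φ : Module.Dual S P} (hφ : φ v = 1) {h : C} (hh : h * h = h) :
    Nonempty (P ⊗[S] peirceComponent S (θ (φ.smulRight v)) h ≃ₗ[S] peirceComponent S 1 h) := by
  obtain ⟨n, f, g, -, -, hfg⟩ := Module.Finite.exists_comp_eq_id_of_projective S P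
  let x : Fin n → P := fun i => f (Pi.single i 1)
  let ξ : Fin n → Module.Dual S P := fun i => LinearMap.proj i ∘ₗ g
  have hx : ∀ p, ∑ i, ξ i p • x i = p := fun p => by
    have := LinearMap.congr_fun hfg p
    simp only [LinearMap.comp_apply, LinearMap.id_apply] at this
    conv_rhs => rw [← this, pi_eq_sum_univ' (g p)]
    simp [x, ξ]
  have hE : ∀ (α β : Module.Dual S P) (a b : P), θ (α.smulRight a) * θ (β.smulRight b) =
      α b • θ (β.smulRight a) := fun α β a b => by
    rw [← map_mul, ← map_smul]
    congr 1
    ext p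
    simp [smul_smul, mul_comm]
  have hε : θ (φ.smulRight v) * θ (φ.smulRight v) = θ (φ.smulRight v) := by
    rw [hE, hφ, one_smul]
  have hsum : ∑ i, θ ((ξ i).smulRight (x i)) = 1 := by
    rw [← map_sum, ← map_one θ]
    congr 1
    ext p
    simpa using hx p
  let F : P →ₗ[S] peirceComponent S (θ (φ.smulRight v)) h →ₗ[S] peirceComponent S 1 h :=
    LinearMap.mk₂ S (fun p c => ⟨θ (φ.smulRight p) * c, (mem_peirce (mul_one 1) hh).mpr
        ⟨one_mul _, by rw [mul_assoc, ((mem_peirce hε hh).mp c.2).2]⟩⟩)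
      (fun p p' c => Subtype.ext (by
        change θ _ * (c : C) = θ _ * (c : C) + θ _ * (c : C)
        rw [← add_mul, ← map_add]; congr 2; ext; simp))
      (fun s p c => Subtype.ext (by
        change θ _ * (c : C) = s • (θ _ * (c : C))
        rw [← smul_mul_assoc, ← map_smul]; congr 2; ext; simp [smul_smul, mul_comm]))
      (fun p c c' => Subtype.ext (mul_add _ _ _))
      (fun s p c => Subtype.ext (mul_smul_comm _ _ _))
  let G : peirceComponent S 1 h →ₗ[S] P ⊗[S] peirceComponent S (θ (φ.smulRight v)) h :=
    ∑ i, TensorProduct.mk S _ _ (x i) ∘ₗ LinearMap.codRestrict _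
      (LinearMap.mulLeft S (θ ((ξ i).smulRight v)) ∘ₗ (peirceComponent S 1 h).subtype)
      fun c => (mem_peirce hε hh).mpr ⟨by
        simp only [LinearMap.comp_apply, LinearMap.mulLeft_apply, Submodule.subtype_apply]
        rw [← mul_assoc, hE, hφ, one_smul], by
        simp only [LinearMap.comp_apply, LinearMap.mulLeft_apply, Submodule.subtype_apply]
        rw [mul_assoc, ((mem_peirce (mul_one 1) hh).mp c.2).2]⟩
  refine ⟨LinearEquiv.ofLinearMap (TensorProduct.lift F) G ?_ ?_⟩
  · refine LinearMap.ext fun c => Subtype.ext ?_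
    simp only [G, F, LinearMap.comp_apply, LinearMap.sum_apply, map_sum, TensorProduct.mk_apply,
      TensorProduct.lift.tmul, LinearMap.mk₂_apply, LinearMap.codRestrict_apply,
      LinearMap.mulLeft_apply, Submodule.subtype_apply, ← mul_assoc, hE, hφ, one_smul,
      AddSubmonoidClass.coe_finsetSum, LinearMap.id_apply]
    rw [← Finset.sum_mul, hsum, one_mul]
  · refine TensorProduct.ext' fun p c => ?_
    simp only [G, F, LinearMap.comp_apply, LinearMap.sum_apply, TensorProduct.mk_apply,
      TensorProduct.lift.tmul, LinearMap.mk₂_apply, LinearMap.id_apply]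
    conv_rhs => rw [← hx p, TensorProduct.sum_tmul]
    refine Finset.sum_congr rfl fun i _ => ?_
    rw [TensorProduct.smul_tmul]
    congr 1
    refine Subtype.ext ?_
    simp only [LinearMap.codRestrict_apply, LinearMap.comp_apply, LinearMap.mulLeft_apply,
      Submodule.subtype_apply]
    rw [← mul_assoc, hE, smul_mul_assoc, ((mem_peirce hε hh).mp c.2).1]
    rfl

end Rank

universe u

/-! ### Rank functions of finite projective modules -/

/-- A surjection `u` with section `s` splits its source. -/
theorem LinearMap.nonempty_equiv_prod_ker {A X Y : Type*} [Ring A] [AddCommGroup X]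
    [Module A X] [AddCommGroup Y] [Module A Y] (u : X →ₗ[A] Y) (s : Y →ₗ[A] X)
    (hs : u ∘ₗ s = LinearMap.id) : Nonempty (X ≃ₗ[A] Y × LinearMap.ker u) := by
  have h : ∀ y, u (s y) = y := LinearMap.congr_fun hs
  have hk : ∀ x, (LinearMap.id - s ∘ₗ u : X →ₗ[A] X) x ∈ LinearMap.ker u := fun x => by simp [h]
  refine ⟨LinearEquiv.ofLinearMap (u.prod ((LinearMap.id - s ∘ₗ u).codRestrict _ hk))
    (s.coprod (LinearMap.ker u).subtype) (LinearMap.ext fun y => ?_) (LinearMap.ext fun x => ?_)⟩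
  · refine Prod.ext ?_ (Subtype.ext ?_) <;> simp [h]
  · simp

section ModuleRank

variable {S A : Type u} [CommRing S] [Ring A] [Algebra S A]

variable (S A) in
/-- The functions on `Spec S` that are ranks of finite projective `A`-modules. -/
def IsModuleRank (r : PrimeSpectrum S → ℕ) : Prop :=
  ∃ (X : Type u) (_ : AddCommGroup X) (_ : Module S X) (_ : Module A X) (_ : IsScalarTower S A X),
    Module.Finite A X ∧ Module.Projective A X ∧ Module.rankAtStalk (R := S) X = r

theorem Module.Projective.trans_algebra [Module.Projective S A] (X : Type*) [AddCommGroup X]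
    [Module S X] [Module A X] [IsScalarTower S A X] [Module.Projective A X] :
    Module.Projective S X := by
  obtain ⟨s, hs⟩ := Module.projective_def'.mp ‹Module.Projective A X›
  classical
  have : Module.Projective S (X →₀ A) :=
    .of_equiv (finsuppLequivDFinsupp S).symm
  refine Module.Projective.of_split (s.restrictScalars S)
    ((Finsupp.linearCombination A id).restrictScalars S) ?_
  ext x
  exact LinearMap.congr_fun hs x

theorem IsModuleRank.zero : IsModuleRank S A 0 :=
  ⟨PUnit, inferInstance, inferInstance, inferInstance, inferInstance, inferInstance, inferInstance,
    Module.rankAtStalk_eq_zero_of_subsingleton⟩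

variable [IsAzumaya S A] {r r' : PrimeSpectrum S → ℕ}

theorem IsModuleRank.add (h : IsModuleRank S A r) (h' : IsModuleRank S A r') :
    IsModuleRank S A (r + r') := by
  obtain ⟨X, _, _, _, _, _, _, rfl⟩ := h
  obtain ⟨Y, _, _, _, _, _, _, rfl⟩ := h'
  have := Module.Finite.trans (R := S) A X
  have := Module.Finite.trans (R := S) A Y
  have := Module.Projective.trans_algebra (S := S) (A := A) X
  have := Module.Projective.trans_algebra (S := S) (A := A) Y
  exact ⟨X × Y, inferInstance, inferInstance, inferInstance, inferInstance, inferInstance,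
    inferInstance, Module.rankAtStalk_prod X Y⟩

theorem IsModuleRank.isLocallyConstant (h : IsModuleRank S A r) : IsLocallyConstant r := by
  obtain ⟨X, _, _, _, _, _, _, rfl⟩ := h
  have := Module.Finite.trans (R := S) A X
  have := Module.Projective.trans_algebra (S := S) (A := A) X
  have := Module.finitePresentation_of_projective S X
  exact Module.isLocallyConstant_rankAtStalk

/-- The kernel of a surjection between finite projective modules has the difference of the
ranks. -/
theorem IsModuleRank.sub [Finite (MaximalSpectrum S)] (h : IsModuleRank S A (r + r'))
    (h' : IsModuleRank S A r') : IsModuleRank S A r := by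
  obtain ⟨X, _, _, _, _, _, _, hX⟩ := h
  obtain ⟨Y, _, _, _, _, _, _, rfl⟩ := h'
  have := Module.Finite.trans (R := S) A X
  have := Module.Finite.trans (R := S) A Y
  have := Module.Projective.trans_algebra (S := S) (A := A) X
  have := Module.Projective.trans_algebra (S := S) (A := A) Y
  obtain ⟨u, hu⟩ := exists_linearMap_surjective (S := S) (A := A) (X := X) (Y := Y)
    fun q hq => by
      have := hq.isPrime
      rw [fiberRank_eq_rankAtStalk, fiberRank_eq_rankAtStalk, hX]
      exact Nat.le_add_left _ _
  obtain ⟨s, hs⟩ := Module.projective_lifting_property u LinearMap.id hu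
  obtain ⟨φ⟩ := LinearMap.nonempty_equiv_prod_ker u s hs
  have h₁ : Module.Finite A (LinearMap.ker u) :=
    Module.Finite.of_surjective (LinearMap.snd A Y _ ∘ₗ φ.toLinearMap)
      (Prod.snd_surjective.comp φ.surjective)
  have h₂ : Module.Projective A (LinearMap.ker u) :=
    Module.Projective.of_split (φ.symm.toLinearMap ∘ₗ LinearMap.inr A Y _)
      (LinearMap.snd A Y _ ∘ₗ φ.toLinearMap) (by ext; simp)
  refine ⟨LinearMap.ker u, inferInstance, inferInstance, inferInstance, inferInstance, h₁, h₂, ?_⟩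
  have := Module.Finite.trans (R := S) A (LinearMap.ker u)
  have := Module.Projective.trans_algebra (S := S) (A := A) (LinearMap.ker u)
  rw [Module.rankAtStalk_eq_of_equiv (φ.restrictScalars S), Module.rankAtStalk_prod, add_comm] at hX
  exact add_right_cancel hX

open scoped Classical in
/-- Extension of a rank function by zero from a clopen set. -/
theorem IsModuleRank.indicator (h : IsModuleRank S A r) {U : Set (PrimeSpectrum S)}
    (hU : IsClopen U) : IsModuleRank S A (U.indicator r) := by
  obtain ⟨X, _, _, _, _, _, _, rfl⟩ := h
  have := Module.Finite.trans (R := S) A X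
  have := Module.Projective.trans_algebra (S := S) (A := A) X
  obtain ⟨ε, hε, rfl⟩ := PrimeSpectrum.exists_idempotent_basicOpen_eq_of_isClopen hU
  have hεε : ε * ε = ε := hε
  let p : X →ₗ[A] X := ε • LinearMap.id
  let u : X →ₗ[A] LinearMap.range p := p.rangeRestrict
  let s : LinearMap.range p →ₗ[A] X := (LinearMap.range p).subtype
  have hmem : ∀ x : LinearMap.range p, ε • x = x := by
    rintro ⟨_, x, rfl⟩
    exact Subtype.ext (by simp [p, smul_smul, hεε])
  have hs : u ∘ₗ s = LinearMap.id := LinearMap.ext fun x => hmem x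
  have h₁ : Module.Finite A (LinearMap.range p) := inferInstance
  have h₂ : Module.Projective A (LinearMap.range p) := Module.Projective.of_split s u hs
  refine ⟨LinearMap.range p, inferInstance, inferInstance, inferInstance, inferInstance, h₁, h₂, ?_⟩
  have := Module.Finite.trans (R := S) A (LinearMap.range p)
  have := Module.Projective.trans_algebra (S := S) (A := A) (LinearMap.range p)
  obtain ⟨φ⟩ := LinearMap.nonempty_equiv_prod_ker u s hs
  have : Module.Finite A (LinearMap.ker u) :=
    Module.Finite.of_surjective (LinearMap.snd A _ _ ∘ₗ φ.toLinearMap)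
      (Prod.snd_surjective.comp φ.surjective)
  have : Module.Projective A (LinearMap.ker u) :=
    Module.Projective.of_split (φ.symm.toLinearMap ∘ₗ LinearMap.inr A _ _)
      (LinearMap.snd A _ _ ∘ₗ φ.toLinearMap) (by ext; simp)
  have := Module.Finite.trans (R := S) A (LinearMap.ker u)
  have := Module.Projective.trans_algebra (S := S) (A := A) (LinearMap.ker u)
  ext q
  by_cases hq : q ∈ (PrimeSpectrum.basicOpen ε : Set (PrimeSpectrum S))
  · rw [Set.indicator_of_mem hq, Module.rankAtStalk_eq_of_equiv (φ.restrictScalars S),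
      Module.rankAtStalk_prod, Pi.add_apply,
      rankAtStalk_eq_zero_of_smul_eq_zero (M := LinearMap.ker u) hq, add_zero]
    rintro ⟨x, hx⟩
    exact Subtype.ext (congrArg Subtype.val (LinearMap.mem_ker.mp hx) : ε • x = 0)
  · rw [Set.indicator_of_notMem hq]
    have hq' : ε ∈ q.asIdeal := not_not.mp hq
    refine rankAtStalk_eq_zero_of_smul_eq_zero (s := 1 - ε) (fun h => q.2.ne_top ?_) fun x => ?_
    · exact (Ideal.eq_top_iff_one _).mpr (by simpa using add_mem h hq')
    · rw [sub_smul, one_smul, hmem, sub_self]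

/-- A rank function bounded by the rank of `A` is the rank of a left ideal `Af`, where `f` is an
idempotent. -/
theorem IsModuleRank.exists_idempotent [Finite (MaximalSpectrum S)] (h : IsModuleRank S A r)
    (hle : ∀ q, r q ≤ Module.rankAtStalk (R := S) A q) :
    ∃ f : A, f * f = f ∧ Module.rankAtStalk (R := S) (peirceComponent S 1 f) = r := by
  obtain ⟨X, _, _, _, _, _, _, rfl⟩ := h
  have := Module.Finite.trans (R := S) A X
  have := Module.Projective.trans_algebra (S := S) (A := A) X
  obtain ⟨u, hu⟩ := exists_linearMap_surjective (S := S) (A := A) (X := A) (Y := X)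
    fun q hq => by
      have := hq.isPrime
      rw [fiberRank_eq_rankAtStalk, fiberRank_eq_rankAtStalk]
      exact hle _
  obtain ⟨s, hs⟩ := Module.projective_lifting_property u LinearMap.id hu
  have hs' : ∀ x, u (s x) = x := LinearMap.congr_fun hs
  have hf : ∀ a, s (u a) = a * s (u 1) := fun a => by
    rw [← smul_eq_mul, ← map_smul, ← map_smul, smul_eq_mul, mul_one]
  refine ⟨s (u 1), by rw [← hf, hs'], ?_⟩
  refine Module.rankAtStalk_eq_of_equiv (LinearEquiv.ofBijective
    ((u.restrictScalars S) ∘ₗ (peirceComponent S 1 (s (u 1))).subtype) ⟨?_, fun x => ?_⟩)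
  · rw [injective_iff_map_eq_zero]
    rintro ⟨_, a, rfl⟩ ha
    refine Subtype.ext ?_
    have ha : u (1 * (a * s (u 1))) = 0 := ha
    rw [one_mul, ← hf, hs'] at ha
    change 1 * (a * s (u 1)) = 0
    rw [one_mul, ← hf, ha, map_zero]
  · obtain ⟨a, rfl⟩ := hu x
    refine ⟨⟨1 * (a * s (u 1)), a, rfl⟩, ?_⟩
    change u (1 * (a * s (u 1))) = u a
    rw [one_mul, ← hf, hs']

end ModuleRank

/-! ### The index and idempotents of prescribed rank -/

section Brauer

variable {S A B : Type u} [CommRing S] [Ring A] [Algebra S A] [IsAzumaya S A] [Ring B]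
  [Algebra S B] [IsAzumaya S B]

/-- Left ideals of `B ⊗ End Q` generated by a projection `1 ⊗ (w ⊗ χ)` onto a line of `Q`. -/
theorem nonempty_peirce_equiv_tensor {S B : Type*} [CommRing S] [Ring B] [Algebra S B]
    {Q : Type*} [AddCommGroup Q] [Module S Q] {w : Q}
    {χ : Module.Dual S Q} (hχ : χ w = 1) :
    Nonempty (peirceComponent S 1 ((1 : B) ⊗ₜ[S] (χ.smulRight w : Module.End S Q)) ≃ₗ[S]
      B ⊗[S] Q) := by
  let i : B ⊗[S] Q →ₗ[S] B ⊗[S] Module.End S Q :=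
    LinearMap.lTensor B (LinearMap.smulRightₗ χ : Q →ₗ[S] (Q →ₗ[S] Q))
  let p : B ⊗[S] Module.End S Q →ₗ[S] B ⊗[S] Q :=
    LinearMap.lTensor B (LinearMap.applyₗ w : (Q →ₗ[S] Q) →ₗ[S] Q)
  have hpi : ∀ x, p (i x) = x := fun x => by
    induction x with
    | zero => simp
    | add x y hx hy => rw [map_add, map_add, hx, hy]
    | tmul b x => simp [i, p, hχ]
  have hip : ∀ c, i (p c) = c * ((1 : B) ⊗ₜ[S] (χ.smulRight w : Module.End S Q)) := fun c => by
    induction c with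
    | zero => simp
    | add x y hx hy => rw [map_add, map_add, hx, hy, add_mul]
    | tmul b x =>
      simp only [i, p, LinearMap.lTensor_tmul, Algebra.TensorProduct.tmul_mul_tmul, mul_one]
      congr 1
      ext y
      simp
  refine ⟨(LinearEquiv.ofBijective (i.codRestrict _ fun x => ?_) ⟨?_, ?_⟩).symm⟩
  · refine ⟨i x, ?_⟩
    simp only [LinearMap.comp_apply, LinearMap.mulLeft_apply, LinearMap.mulRight_apply, one_mul]
    rw [← hip, hpi]
  · intro x y hxy
    rw [← hpi x, ← hpi y]
    exact congrArg p (congrArg Subtype.val hxy)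
  · rintro ⟨_, c, rfl⟩
    refine ⟨p c, Subtype.ext ?_⟩
    change i (p c) = 1 * (c * _)
    rw [hip, one_mul]

/-- If `A ⊗ End P ≅ B ⊗ End Q`, the Morita equivalence between `A` and `B` turns `B` into a finite
projective `A`-module, whose rank is the geometric mean of the ranks of `A` and `B`. -/
theorem BrauerEquivalent.exists_isModuleRank [Finite (MaximalSpectrum S)]
    (h : BrauerEquivalent S A B) :
    ∃ r, IsModuleRank S A r ∧ ∀ q, r q ^ 2 =
      Module.rankAtStalk (R := S) A q * Module.rankAtStalk (R := S) B q := by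
  obtain ⟨P, Q, _, _, _, _, _, _, _, _, _, _, ⟨ψ⟩⟩ := h
  obtain ⟨v, φ, hφ⟩ := exists_dual_apply_eq_one (S := S) P
  obtain ⟨w, χ, hχ⟩ := exists_dual_apply_eq_one (S := S) Q
  have : Module.Finite S (Module.End S P) :=
    .equiv (dualTensorHomEquiv S P P)
  have : Module.Projective S (Module.End S P) :=
    .of_equiv (dualTensorHomEquiv S P P)
  have : Module.Finite S (Module.End S Q) :=
    .equiv (dualTensorHomEquiv S Q Q)
  have : Module.Projective S (Module.End S Q) :=
    .of_equiv (dualTensorHomEquiv S Q Q)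
  let θ : Module.End S P →ₐ[S] A ⊗[S] Module.End S P := Algebra.TensorProduct.includeRight
  set g := θ (φ.smulRight v) with hg
  let h' : B ⊗[S] Module.End S Q := 1 ⊗ₜ[S] (χ.smulRight w : Module.End S Q)
  have hh' : h' * h' = h' := by
    simp only [h', Algebra.TensorProduct.tmul_mul_tmul, mul_one]
    congr 1
    ext x
    simp [hχ]
  set h := ψ.symm h' with hh
  have hidem : h * h = h := by rw [hh, ← map_mul, hh']
  have gidem : g * g = g := by
    rw [hg, ← map_mul]
    congr 1
    ext x
    simp [hφ]
  let π : A ⊗[S] Module.End S P →ₗ[A] A ⊗[S] Module.End S P :=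
    { toFun := fun c => g * (c * h)
      map_add' := fun c c' => by rw [add_mul, mul_add]
      map_smul' := fun a c => by
        rw [smul_mul_assoc, RingHom.id_apply]
        induction c * h with
        | zero => simp
        | add x y hx hy => rw [smul_add, mul_add, hx, hy, mul_add, smul_add]
        | tmul x y => simp [g, θ, TensorProduct.smul_tmul'] }
  have hrange : (LinearMap.range π).restrictScalars S = peirceComponent S g h := by
    ext; rfl
  let ρ : LinearMap.range π ≃ₗ[S] peirceComponent S g h :=
    (LinearEquiv.ofEq _ _ hrange :
      (LinearMap.range π).restrictScalars S ≃ₗ[S] peirceComponent S g h)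
  have hproj : Module.Projective A (LinearMap.range π) := by
    refine Module.Projective.of_split (LinearMap.range π).subtype π.rangeRestrict
      (LinearMap.ext fun x => Subtype.ext ?_)
    obtain ⟨h₁, h₂⟩ := (mem_peirce gidem hidem).mp (hrange.le x.2)
    change g * ((x : A ⊗[S] Module.End S P) * h) = x
    rw [h₂, h₁]
  have hfin : Module.Finite A (LinearMap.range π) := inferInstance
  have := Module.Finite.trans (R := S) A (LinearMap.range π)
  have := Module.Projective.trans_algebra (S := S) (A := A) (LinearMap.range π)
  have r₃ : Module.rankAtStalk (R := S) (LinearMap.range π) =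
      Module.rankAtStalk (R := S) (peirceComponent S g h) :=
    Module.rankAtStalk_eq_of_equiv (M := LinearMap.range π) ρ
  refine ⟨_, ⟨LinearMap.range π, inferInstance, inferInstance, inferInstance, inferInstance, hfin,
    hproj, r₃⟩, fun q => ?_⟩
  have := peirce_projective (S := S) gidem hidem
  have e₁ := nonempty_tensor_peirce_equiv θ hφ hidem
  rw [← hg] at e₁
  obtain ⟨e₁⟩ := e₁
  obtain ⟨e₂⟩ := nonempty_peirce_equiv_tensor (B := B) hχ
  have e₃ : peirceComponent S 1 h ≃ₗ[S] peirceComponent S 1 h' := by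
    refine (ψ.toLinearEquiv.submoduleMap _).trans (LinearEquiv.ofEq _ _ ?_)
    ext x
    constructor
    · rintro ⟨_, ⟨c, rfl⟩, rfl⟩
      exact ⟨ψ c, by simp [hh]⟩
    · rintro ⟨c, rfl⟩
      exact ⟨_, ⟨ψ.symm c, rfl⟩, by simp [hh]⟩
  have r₁ := congrFun (Module.rankAtStalk_eq_of_equiv ((e₁.trans e₃).trans e₂)) q
  have r₂ := congrFun (Module.rankAtStalk_eq_of_equiv ψ.toLinearEquiv) q
  have : Module.Finite S (peirceComponent S g h) := .equiv ρ
  rw [Module.rankAtStalk_tensorProduct (M := P) (peirceComponent S g h),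
    Module.rankAtStalk_tensorProduct (M := B) Q] at r₁
  rw [Module.rankAtStalk_tensorProduct, Module.rankAtStalk_tensorProduct] at r₂
  have t : ∀ (M : Type u) [AddCommGroup M] [Module S M] [Module.Finite S M]
      [Module.Projective S M], Module.rankAtStalk (R := S) (Module.End S M) q =
        Module.rankAtStalk (R := S) M q * Module.rankAtStalk (R := S) M q :=
    fun M _ _ _ _ => rankAtStalk_linearMap ..
  simp only [Pi.mul_apply, t] at r₁ r₂
  have h₁ := rankAtStalk_pos_of_faithful P q
  have h₂ := rankAtStalk_pos_of_faithful Q q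
  generalize Module.rankAtStalk (R := S) P q = p at *
  generalize Module.rankAtStalk (R := S) Q q = s at *
  generalize Module.rankAtStalk (R := S) A q = a at *
  generalize Module.rankAtStalk (R := S) B q = b at *
  generalize Module.rankAtStalk (R := S) (peirceComponent S g h) q = r at *
  have : p ^ 2 * r ^ 2 = p ^ 2 * (a * b) := by
    calc p ^ 2 * r ^ 2 = (p * r) ^ 2 := by ring
      _ = b * (b * (s * s)) := by rw [r₁]; ring
      _ = p ^ 2 * (a * b) := by rw [← r₂]; ring
  exact Nat.eq_of_mul_eq_mul_left (by positivity) this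

/-- Every multiple `n` of the index at `q` is a difference of reduced ranks at `q` of finite
projective `A`-modules: the index generates the group spanned by the degrees in the Brauer class,
and each of these degrees is a reduced rank. -/
theorem exists_isModuleRank_of_index_dvd [Finite (MaximalSpectrum S)] (q : PrimeSpectrum S) {n : ℕ}
    (hn : azumayaIndex S A q ∣ n) :
    ∃ r r', IsModuleRank S A r ∧ IsModuleRank S A r' ∧
      (r q : ℝ) = r' q + n * azumayaDegree S A q := by
  let M : Set ℤ := {z | ∃ (B : Type u) (_ : Ring B) (_ : Algebra S B), IsAzumaya S B ∧
    BrauerEquivalent S A B ∧ ∃ m : ℕ, azumayaDegree S B q = m ∧ z = m}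
  -- the subgroup generated by the degrees is generated by the index
  have hmem : (n : ℤ) ∈ AddSubgroup.closure M := by
    obtain ⟨g, hg⟩ := Int.subgroup_cyclic (AddSubgroup.closure M)
    have hgM : AddSubgroup.closure M = AddSubgroup.zmultiples g := by
      rw [hg, AddSubgroup.zmultiples_eq_closure]
    rw [hgM, Int.mem_zmultiples_iff]
    let D : Set ℕ := {d : ℕ | ∀ (B : Type u) [Ring B] [Algebra S B], IsAzumaya S B →
      BrauerEquivalent S A B → ∀ m : ℕ, azumayaDegree S B q = m → d ∣ m}
    have hD : ∀ d ∈ D, d ∣ g.natAbs := fun d hd => by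
      rw [← Int.natCast_dvd, ← Int.mem_zmultiples_iff]
      have : AddSubgroup.closure M ≤ AddSubgroup.zmultiples (d : ℤ) := by
        rw [AddSubgroup.closure_le]
        rintro _ ⟨B, _, _, hB, hAB, m, hm, rfl⟩
        exact Int.mem_zmultiples_iff.mpr (Int.natCast_dvd_natCast.mpr (hd B hB hAB m hm))
      exact this (hgM ▸ AddSubgroup.mem_zmultiples g)
    have hgD : g.natAbs ∈ D := fun B _ _ hB hAB m hm => by
      have : (m : ℤ) ∈ AddSubgroup.closure M :=
        AddSubgroup.subset_closure ⟨B, inferInstance, inferInstance, hB, hAB, m, hm, rfl⟩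
      rw [hgM, Int.mem_zmultiples_iff] at this
      exact Int.natAbs_dvd_natAbs.mpr this
    -- the largest common divisor is the greatest common divisor
    have hind : azumayaIndex S A q = g.natAbs := by
      change sSup D = g.natAbs
      rcases eq_or_ne g.natAbs 0 with h₀ | h₀
      · -- if all degrees vanish, every natural number is a common divisor
        have : D = Set.univ := Set.eq_univ_of_forall fun d B _ _ hB hAB m hm =>
          (dvd_zero d).trans (h₀ ▸ hgD B hB hAB m hm)
        rw [this, h₀]
        exact Nat.sSup_of_not_bddAbove (by simp)
      · exact le_antisymm (csSup_le ⟨_, hgD⟩ fun d hd =>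
          Nat.le_of_dvd (Nat.pos_of_ne_zero h₀) (hD d hd))
          (le_csSup ⟨g.natAbs, fun d hd => Nat.le_of_dvd (Nat.pos_of_ne_zero h₀) (hD d hd)⟩ hgD)
    rw [hind] at hn
    exact Int.natAbs_dvd_natAbs.mp (by simpa using hn)
  have key : ∀ z ∈ AddSubgroup.closure M, ∃ r r', IsModuleRank S A r ∧ IsModuleRank S A r' ∧
      (r q : ℝ) = r' q + z * azumayaDegree S A q := by
    intro z hz
    induction hz using AddSubgroup.closure_induction with
    | mem z hz =>
      obtain ⟨B, _, _, hB, hAB, m, hm, rfl⟩ := hz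
      obtain ⟨r, hr, hr'⟩ := hAB.exists_isModuleRank
      refine ⟨r, 0, hr, .zero, ?_⟩
      have h₁ : (r q : ℝ) ^ 2 = (m * azumayaDegree S A q) ^ 2 := by
        rw [mul_pow, ← hm, azumayaDegree, azumayaDegree, Real.sq_sqrt (Nat.cast_nonneg _),
          Real.sq_sqrt (Nat.cast_nonneg _), mul_comm]
        exact_mod_cast hr' q
      have h₂ : 0 ≤ azumayaDegree S A q := Real.sqrt_nonneg _
      simpa using (sq_eq_sq₀ (Nat.cast_nonneg _) (by positivity)).mp h₁
    | zero => exact ⟨0, 0, .zero, .zero, by simp⟩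
    | add x y _ _ hx hy =>
      obtain ⟨r₁, r₁', h₁, h₁', e₁⟩ := hx
      obtain ⟨r₂, r₂', h₂, h₂', e₂⟩ := hy
      refine ⟨_, _, h₁.add h₂, h₁'.add h₂', ?_⟩
      push_cast [Pi.add_apply, e₁, e₂]
      ring
    | neg x _ hx =>
      obtain ⟨r₁, r₁', h₁, h₁', e₁⟩ := hx
      exact ⟨_, _, h₁', h₁, by push_cast [e₁]; ring⟩
  simpa using key n hmem

/-- If the locally constant function `n` is divisible by the index and bounded by the degree, there
is a left ideal of `A` of reduced rank `n` generated by an idempotent. -/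
theorem exists_idempotent_of_index_dvd [Finite (MaximalSpectrum S)]
    (n : LocallyConstant (PrimeSpectrum S) ℕ) (hind : ∀ q, azumayaIndex S A q ∣ n q)
    (hdeg : ∀ q, (n q : ℝ) ≤ azumayaDegree S A q) :
    ∃ f : A, f * f = f ∧ ∀ q, (Module.rankAtStalk (R := S) (peirceComponent S 1 f) q : ℝ) =
      n q * azumayaDegree S A q := by
  classical
  have hself : IsLocallyConstant (Module.rankAtStalk (R := S) A) :=
    have := Module.finitePresentation_of_projective S A
    Module.isLocallyConstant_rankAtStalk
  have key : ∃ r, IsModuleRank S A r ∧ ∃ U, IsClopen U ∧ Set.univ ⊆ U ∧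
      ∀ q ∈ U, (r q : ℝ) = n q * azumayaDegree S A q := by
    refine isCompact_univ.induction_on (p := fun s => ∃ r, IsModuleRank S A r ∧ ∃ U, IsClopen U ∧
      s ⊆ U ∧ ∀ q ∈ U, (r q : ℝ) = n q * azumayaDegree S A q) ?_ ?_ ?_ ?_
    · exact ⟨0, .zero, ∅, isClopen_empty, subset_rfl, by simp⟩
    · rintro s t hst ⟨r, hr, U, hU, htU, h⟩
      exact ⟨r, hr, U, hU, hst.trans htU, h⟩
    · rintro s t ⟨r, hr, U, hU, hsU, h⟩ ⟨r', hr', V, hV, htV, h'⟩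
      refine ⟨_, (hr.indicator hU).add (hr'.indicator hU.compl), U ∪ V, hU.union hV,
        Set.union_subset_union hsU htV, fun q hq => ?_⟩
      by_cases hqU : q ∈ U
      · simp [hqU, h q hqU]
      · simp [hqU, h' q (hq.resolve_left hqU)]
    · intro q _
      obtain ⟨r, r', hr, hr', h⟩ := exists_isModuleRank_of_index_dvd (A := A) q (hind q)
      let U : Set (PrimeSpectrum S) := {p | r p = r q ∧ r' p = r' q ∧ n p = n q ∧
        Module.rankAtStalk (R := S) A p = Module.rankAtStalk (R := S) A q}
      have hU : IsClopen U :=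
        (hr.isLocallyConstant.isClopen_fiber (r q)).inter
          ((hr'.isLocallyConstant.isClopen_fiber (r' q)).inter
            ((n.isLocallyConstant.isClopen_fiber (n q)).inter (hself.isClopen_fiber _)))
      have hdec : U.indicator r = U.indicator (r - r') + U.indicator r' := by
        ext p
        by_cases hp : p ∈ U
        · have : r' q ≤ r q := by
            have : (r' q : ℝ) ≤ r q := by
              rw [h]
              have : 0 ≤ azumayaDegree S A q := Real.sqrt_nonneg _
              have := mul_nonneg (Nat.cast_nonneg (α := ℝ) (n q)) this
              linarith
            exact_mod_cast this
          simp only [Pi.add_apply, Set.indicator_of_mem hp, Pi.sub_apply, hp.1, hp.2.1]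
          omega
        · simp [hp]
      refine ⟨U, mem_nhdsWithin_of_mem_nhds (hU.isOpen.mem_nhds ⟨rfl, rfl, rfl, rfl⟩), _,
        IsModuleRank.sub (hdec ▸ hr.indicator hU) (hr'.indicator hU), U, hU, subset_rfl,
        fun p hp => ?_⟩
      have h₁ : azumayaDegree S A p = azumayaDegree S A q := by
        rw [azumayaDegree, hp.2.2.2, azumayaDegree]
      have h₂ : r q = (r - r') p + r' q := by
        have := congrFun hdec p
        simpa only [Pi.add_apply, Set.indicator_of_mem hp, hp.1, hp.2.1] using this
      rw [Set.indicator_of_mem hp, h₁, hp.2.2.1]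
      rw [h₂] at h
      push_cast at h
      linarith
  obtain ⟨r, hr, U, -, hU, h⟩ := key
  obtain ⟨f, hf, hfr⟩ := hr.exists_idempotent fun q => by
    have : (r q : ℝ) ≤ Module.rankAtStalk (R := S) A q := by
      rw [h q (hU trivial)]
      calc (n q : ℝ) * azumayaDegree S A q ≤ azumayaDegree S A q * azumayaDegree S A q :=
            mul_le_mul_of_nonneg_right (hdeg q) (Real.sqrt_nonneg _)
        _ = _ := Real.mul_self_sqrt (Nat.cast_nonneg _)
    exact_mod_cast this
  exact ⟨f, hf, fun q => by rw [hfr, h q (hU trivial)]⟩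

end Brauer

/-! ### Split algebras with an alternating involution -/

section Split

variable {R L Λ : Type*} [CommRing R] [Field L] [Algebra R L] [Ring Λ] [Algebra R Λ] {g : Λ}

/-- If `gΛg = R • g`, the coefficient of `g` in `gxg`, with values in an `R`-algebra `L` in which
the annihilator of `g` vanishes. -/
theorem exists_cornerCoefficient (hg : g * g = g)
    (hk : ∀ d, g * d = d → d * g = d → ∃ c : R, d = c • g)
    (hL : ∀ c : R, c • g = 0 → algebraMap R L c = 0) :
    ∃ κ : Λ →ₗ[R] L, (∀ c : R, κ (c • g) = algebraMap R L c) ∧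
      ∀ d d', g * d = d → d * g = d → g * d' = d' → d' * g = d' → κ (d * d') = κ d * κ d' := by
  have hk' : ∀ x, ∃ c : R, g * x * g = c • g := fun x =>
    hk _ (by rw [← mul_assoc, ← mul_assoc, hg]) (by rw [mul_assoc, hg])
  choose c hc using hk'
  have uniq : ∀ a b : R, a • g = b • g → algebraMap R L a = algebraMap R L b := fun a b h => by
    rw [← sub_eq_zero, ← map_sub]
    exact hL _ (by rw [sub_smul, h, sub_self])
  have hκ : ∀ x a, g * x * g = a • g → algebraMap R L (c x) = algebraMap R L a :=
    fun x a h => uniq _ _ (by rw [← hc, h])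
  refine ⟨{ toFun := fun x => algebraMap R L (c x), map_add' := fun x y => ?_,
            map_smul' := fun a x => ?_ }, fun a => ?_, fun d d' h₁ h₂ h₃ h₄ => ?_⟩
  · rw [← map_add]
    exact hκ _ _ (by rw [mul_add, add_mul, hc, hc, add_smul])
  · rw [RingHom.id_apply, Algebra.smul_def a (algebraMap R L _), ← map_mul]
    exact hκ _ _ (by rw [mul_smul_comm, smul_mul_assoc, hc, smul_smul])
  · exact hκ _ _ (by rw [mul_smul_comm, smul_mul_assoc, hg, hg])
  · change algebraMap R L _ = algebraMap R L _ * algebraMap R L _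
    rw [← map_mul]
    refine hκ _ _ ?_
    calc g * (d * d') * g = (g * d * g) * (g * d' * g) := by
          rw [h₁, h₂, h₃, h₄, ← mul_assoc, h₁, mul_assoc, h₄]
      _ = _ := by rw [hc, hc, smul_mul_smul_comm, hg]

/-- Matrix units of an algebra `Λ` with `gΛg = R • g` split it: the matrix entries of `x` are the
coefficients of `v i * x * u j`. -/
theorem exists_matrix_algHom {κ : Λ →ₗ[R] L}
    (hκ : ∀ c : R, κ (c • g) = algebraMap R L c)
    (hmul : ∀ d d', g * d = d → d * g = d → g * d' = d' → d' * g = d' → κ (d * d') = κ d * κ d')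
    {r : ℕ} {u v : Fin r → Λ} (hu : ∀ i, u i * g = u i) (hv : ∀ i, g * v i = v i)
    (huv : ∀ i j, v i * u j = if i = j then g else 0) (h1 : ∑ i, u i * v i = 1) :
    ∃ ρ : Λ →ₐ[R] Matrix (Fin r) (Fin r) L, ∀ x i j, ρ x i j = κ (v i * x * u j) := by
  have hone : κ g = 1 := by simpa using hκ 1
  have l : ∀ i x j, g * (v i * x * u j) = v i * x * u j := fun i x j => by
    rw [← mul_assoc, ← mul_assoc, hv]
  have l' : ∀ i x j, v i * x * u j * g = v i * x * u j := fun i x j => by rw [mul_assoc, hu]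
  have honeM : (Matrix.of fun i j => κ (v i * (1 : Λ) * u j)) = (1 : Matrix (Fin r) (Fin r) L) := by
    ext i j
    rw [Matrix.of_apply, mul_one, huv, Matrix.one_apply]
    split_ifs
    · exact hone
    · exact map_zero κ
  refine ⟨AlgHom.ofLinearMap
    { toFun := fun x => Matrix.of fun i j => κ (v i * x * u j)
      map_add' := fun x y => by ext; simp [mul_add, add_mul]
      map_smul' := fun c x => by ext; simp } honeM fun x y => ?_, fun x i j => rfl⟩
  ext i j
  change κ (v i * (x * y) * u j) = ∑ k, κ (v i * x * u k) * κ (v k * y * u j)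
  simp only [← hmul _ _ (l _ _ _) (l' _ _ _) (l _ _ _) (l' _ _ _), ← map_sum]
  congr 1
  calc v i * (x * y) * u j = v i * x * (∑ k, u k * v k) * y * u j := by
        rw [h1]; simp only [mul_assoc, one_mul]
    _ = _ := by simp only [Finset.mul_sum, Finset.sum_mul, mul_assoc]

/-- A splitting of `Λ` over `L` is a splitting of every ring `A` mapping onto `Λ` with kernel
generated by scalars that vanish in `L`. -/
theorem exists_algEquiv_end {A : Type*} [Ring A] [Algebra R A] (π : A →ₐ[R] Λ)
    (hπ : Function.Surjective π) (hker : ∀ x, π x = 0 → (1 : L) ⊗ₜ[R] x = 0) (hg : g * g = g)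
    (hk : ∀ d, g * d = d → d * g = d → ∃ c : R, d = c • g)
    {κ : Λ →ₗ[R] L} (hκ : ∀ c : R, κ (c • g) = algebraMap R L c)
    {r : ℕ} {u v : Fin r → Λ} (hu : ∀ i, u i * g = u i) (hv : ∀ i, g * v i = v i)
    (huv : ∀ i j, v i * u j = if i = j then g else 0) (h1 : ∑ i, u i * v i = 1)
    {ρ : Λ →ₐ[R] Matrix (Fin r) (Fin r) L} (hρ : ∀ x i j, ρ x i j = κ (v i * x * u j)) :
    ∃ φ : L ⊗[R] A ≃ₐ[L] Module.End L (Fin r → L),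
      ∀ a, φ (1 ⊗ₜ[R] a) = Matrix.toLin' (ρ (π a)) := by
  have hone : κ g = 1 := by simpa using hκ 1
  let φ : L ⊗[R] A →ₐ[L] Matrix (Fin r) (Fin r) L :=
    Algebra.TensorProduct.lift (Algebra.ofId L _) (ρ.comp π) fun c a => Algebra.commutes c _
  have hφ : ∀ c a, φ (c ⊗ₜ[R] a) = c • ρ (π a) := fun c a => by
    rw [Algebra.smul_def]
    exact Algebra.TensorProduct.lift_tmul _ _ _ _ _
  choose b hb using fun i j => hπ (u i * v j)
  let ψ : Matrix (Fin r) (Fin r) L →ₗ[L] L ⊗[R] A :=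
    ∑ i, ∑ j, LinearMap.toSpanSingleton L (L ⊗[R] A) (1 ⊗ₜ[R] b i j) ∘ₗ
      Matrix.entryLinearMap L L i j
  have hψ : ∀ M, ψ M = ∑ i, ∑ j, M i j • ((1 : L) ⊗ₜ[R] b i j) := fun M => by
    simp [ψ, LinearMap.sum_apply]
  have inv₁ : ∀ M, φ (ψ M) = M := fun M => by
    ext k l
    simp only [hψ, map_sum, map_smul, hφ, one_smul, Matrix.sum_apply, Matrix.smul_apply, hb, hρ]
    have : ∀ i j, κ (v k * (u i * v j) * u l) = if k = i then if j = l then 1 else 0 else 0 :=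
      fun i j => by
        rw [← mul_assoc, huv, mul_assoc, huv]
        split_ifs <;> simp [hg, hone]
    simp [this]
  have inv₂ : ∀ t, ψ (φ t) = t := fun t => by
    induction t with
    | zero => simp
    | add x y hx hy => rw [map_add, map_add, hx, hy]
    | tmul c a =>
      rw [hφ, map_smul, ← mul_one c, ← smul_eq_mul, ← TensorProduct.smul_tmul', smul_eq_mul,
        mul_one]
      congr 1
      choose d hd using fun i j => hk (v i * π a * u j) (by rw [← mul_assoc, ← mul_assoc, hv])
        (by rw [mul_assoc, hu])
      have : ψ (ρ (π a)) = 1 ⊗ₜ[R] ∑ i, ∑ j, d i j • b i j := by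
        simp only [hψ, hρ, hd, hκ, TensorProduct.tmul_sum]
        refine Finset.sum_congr rfl fun i _ => Finset.sum_congr rfl fun j _ => ?_
        rw [algebraMap_smul, ← TensorProduct.tmul_smul]
      rw [this, ← sub_eq_zero, ← TensorProduct.tmul_sub]
      refine hker _ ?_
      rw [map_sub, sub_eq_zero]
      simp only [map_sum, map_smul, hb]
      calc ∑ i, ∑ j, d i j • (u i * v j) = ∑ i, ∑ j, u i * (v i * π a * u j) * v j := by
            refine Finset.sum_congr rfl fun i _ => Finset.sum_congr rfl fun j _ => ?_
            rw [hd, mul_smul_comm, hu, smul_mul_assoc]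
        _ = (∑ i, u i * v i) * π a * ∑ j, u j * v j := by
            rw [Finset.sum_mul, Finset.sum_mul_sum]
            simp only [mul_assoc]
        _ = π a := by rw [h1, one_mul, mul_one]
  refine ⟨(AlgEquiv.ofBijective φ ⟨Function.LeftInverse.injective inv₂,
    Function.RightInverse.surjective inv₁⟩).trans Matrix.toLinAlgEquiv', fun a => ?_⟩
  change Matrix.toLin' (φ (1 ⊗ₜ[R] a)) = _
  rw [hφ, one_smul]

/-- The matrix of the alternating form to which an alternating involution of a split algebra is
adjoint. -/
theorem exists_alternating_matrix [StarRing Λ]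
    (hstar : ∀ (c : R) (x : Λ), star (c • x) = c • star x)
    (hg : IsDivisionIdempotent g) (hprime : ∀ x y : Λ, (∀ a, x * a * y = 0) → x = 0 ∨ y = 0)
    (halt : ∀ y, g * y = y → y * star y = 0)
    (hk : ∀ d, g * d = d → d * g = d → ∃ c : R, d = c • g)
    {κ : Λ →ₗ[R] L} (hκ : ∀ c : R, κ (c • g) = algebraMap R L c)
    (hmul : ∀ d d', g * d = d → d * g = d → g * d' = d' → d' * g = d' → κ (d * d') = κ d * κ d')
    {r : ℕ} {u v : Fin r → Λ} (hu : ∀ i, u i * g = u i) (hv : ∀ i, g * v i = v i)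
    (huv : ∀ i j, v i * u j = if i = j then g else 0) (h1 : ∑ i, u i * v i = 1)
    {ρ : Λ →ₐ[R] Matrix (Fin r) (Fin r) L} (hρ : ∀ x i j, ρ x i j = κ (v i * x * u j)) :
    ∃ B : Matrix (Fin r) (Fin r) L, B.transpose = -B ∧ B.det ≠ 0 ∧
      ∀ x, (ρ x).transpose * B = B * ρ (star x) := by
  have hone : κ g = 1 := by simpa using hκ 1
  obtain ⟨z, w, hz₁, hz₂, hw₁, hw₂, hw₃, hw₄, -⟩ :=
    exists_intertwiner_of_alternating hg hprime halt
  have sq : ∀ x, x * g = x → z * star x * x = 0 := fun x hx => by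
    have := halt (z * star x) (by rw [← mul_assoc, hz₁])
    rw [star_mul, star_star] at this
    have h := congrArg (· * star w) this
    simp only [zero_mul, mul_assoc] at h
    rw [← star_mul, hw₄, star_star, hx, ← mul_assoc] at h
    exact h
  let B : Matrix (Fin r) (Fin r) L := Matrix.of fun i j => κ (z * star (u i) * u j)
  let C : Matrix (Fin r) (Fin r) L := Matrix.of fun i j => κ (v i * star (v j) * w)
  have hB₁ : ∀ i j, g * (z * star (u i) * u j) = z * star (u i) * u j := fun i j => by
    rw [← mul_assoc, ← mul_assoc, hz₁]
  have hB₂ : ∀ i j, z * star (u i) * u j * g = z * star (u i) * u j := fun i j => by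
    rw [mul_assoc, hu]
  have hBC : B * C = 1 := by
    ext i k
    rw [Matrix.mul_apply, Matrix.one_apply]
    change ∑ j, κ (z * star (u i) * u j) * κ (v j * star (v k) * w) = _
    have : ∀ j, κ (z * star (u i) * u j) * κ (v j * star (v k) * w) =
        κ (z * star (u i) * u j * (v j * star (v k) * w)) := fun j =>
      (hmul _ _ (hB₁ i j) (hB₂ i j) (by rw [← mul_assoc, ← mul_assoc, hv])
        (by rw [mul_assoc, hw₂])).symm
    simp only [this, ← map_sum]
    have : ∑ j, z * star (u i) * u j * (v j * star (v k) * w) = z * star (v k * u i) * w := by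
      rw [star_mul]
      calc _ = z * star (u i) * (∑ j, u j * v j) * star (v k) * w := by
            simp only [Finset.mul_sum, Finset.sum_mul, mul_assoc]
        _ = _ := by rw [h1]; simp only [mul_assoc, one_mul]
    rw [this, huv]
    by_cases h : i = k
    · rw [if_pos h, if_pos h.symm, hz₂, hw₃, hone]
    · rw [if_neg h, if_neg (Ne.symm h), star_zero, mul_zero, zero_mul, map_zero]
  refine ⟨B, ?_, fun h₀ => ?_, fun x => ?_⟩
  · ext i j
    change κ (z * star (u j) * u i) = -κ (z * star (u i) * u j)
    rw [eq_neg_iff_add_eq_zero, ← map_add]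
    have := sq (u i + u j) (by rw [add_mul, hu, hu])
    rw [star_add, mul_add, mul_add, add_mul, add_mul, sq _ (hu i), sq _ (hu j), zero_add,
      add_zero] at this
    rw [this, map_zero]
  · have := congrArg Matrix.det hBC
    rw [Matrix.det_mul, h₀, zero_mul, Matrix.det_one] at this
    exact zero_ne_one this
  · ext i j
    rw [Matrix.mul_apply, Matrix.mul_apply]
    simp only [Matrix.transpose_apply, hρ]
    change ∑ k, κ (v k * x * u i) * κ (z * star (u k) * u j) =
      ∑ k, κ (z * star (u i) * u k) * κ (v k * star x * u j)
    have l : ∀ i x j, g * (v i * x * u j) = v i * x * u j := fun i x j => by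
      rw [← mul_assoc, ← mul_assoc, hv]
    have l' : ∀ i x j, v i * x * u j * g = v i * x * u j := fun i x j => by rw [mul_assoc, hu]
    simp only [← hmul _ _ (hB₁ _ _) (hB₂ _ _) (l _ _ _) (l' _ _ _), ← map_sum]
    choose d hd using fun k => hk _ (l k x i) (l' k x i)
    have hxu : x * u i = ∑ k, d k • u k := by
      calc x * u i = (∑ k, u k * v k) * x * u i := by rw [h1, one_mul]
        _ = ∑ k, u k * (v k * x * u i) := by simp only [Finset.sum_mul, mul_assoc]
        _ = _ := Finset.sum_congr rfl fun k _ => by rw [hd, mul_smul_comm, hu]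
    have e₁ : ∑ k, z * star (u i) * u k * (v k * star x * u j) = z * star (x * u i) * u j := by
      rw [star_mul]
      calc _ = z * star (u i) * (∑ k, u k * v k) * star x * u j := by
            simp only [Finset.mul_sum, Finset.sum_mul, mul_assoc]
        _ = _ := by rw [h1]; simp only [mul_assoc, one_mul]
    rw [e₁, hxu]
    simp only [hd, hκ, star_sum, hstar, Finset.mul_sum, Finset.sum_mul, mul_smul_comm,
      smul_mul_assoc, map_sum, map_smul, Algebra.smul_def _ (κ _)]

end Split

/-! ### Alternating involutions modulo a maximal ideal are symplectic -/

section QuotientStar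

variable {R A : Type*} [CommRing R] [Ring A] [Algebra R A]

/-- The involution induced on the quotient by a stable two-sided ideal, as a star ring structure. -/
abbrev AlgInvolution.quotientStarRing (σ : AlgInvolution R A) (I : Ideal A) [I.IsTwoSided]
    (hI : ∀ a ∈ I, σ a ∈ I) : StarRing (A ⧸ I) where
  star := Quotient.map' σ fun a b h => by
    rw [Submodule.quotientRel_def] at h ⊢
    simpa only [map_sub] using hI _ h
  star_involutive x := by
    obtain ⟨a, rfl⟩ := Ideal.Quotient.mk_surjective x
    exact congrArg (Ideal.Quotient.mk I) (σ.involutive a)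
  star_mul x y := by
    obtain ⟨a, rfl⟩ := Ideal.Quotient.mk_surjective x
    obtain ⟨b, rfl⟩ := Ideal.Quotient.mk_surjective y
    exact congrArg (Ideal.Quotient.mk I) (σ.map_mul a b)
  star_add x y := by
    obtain ⟨a, rfl⟩ := Ideal.Quotient.mk_surjective x
    obtain ⟨b, rfl⟩ := Ideal.Quotient.mk_surjective y
    exact congrArg (Ideal.Quotient.mk I) (map_add σ.toLinearMap a b)

end QuotientStar

section Semilinear

variable {R S A : Type*} [CommRing R] [CommRing S] [Ring A] [Algebra S A]
  [Algebra R A] {σ : AlgInvolution R A} {τ : S →+* S}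
  (hτ : ∀ s, σ (algebraMap S A s) = algebraMap S A (τ s)) {q : Ideal S}
include hτ

theorem AlgInvolution.map_mem_map_algebraMap {q q' : Ideal S} (hq : ∀ s ∈ q, τ s ∈ q') (a : A)
    (ha : a ∈ q.map (algebraMap S A)) : σ a ∈ q'.map (algebraMap S A) := by
  induction ha using Submodule.span_induction with
  | mem x hx =>
    obtain ⟨s, hs, rfl⟩ := hx
    rw [hτ]
    exact Ideal.mem_map_of_mem _ (hq s hs)
  | zero => rw [map_zero]; exact zero_mem _
  | add x y _ _ hx hy => rw [map_add]; exact add_mem hx hy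
  | smul c x _ hx => rw [smul_eq_mul, σ.map_mul]; exact Ideal.mul_mem_right _ _ hx

end Semilinear

section Azumaya

variable {S A : Type*} [CommRing S] [Ring A] [Algebra S A] [IsAzumaya S A] {q : Ideal S}

/-- `S / q` embeds in `A / qA`. -/
theorem IsAzumaya.mem_of_algebraMap_mem (hq : q.IsMaximal) {s : S}
    (h : algebraMap S A s ∈ q.map (algebraMap S A)) : s ∈ q := by
  by_contra hs
  obtain ⟨r, t, ht, hr⟩ := hq.exists_inv hs
  refine IsAzumaya.one_notMem (A := A) hq ((mem_map_algebraMap_iff q).mp ?_)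
  rw [← map_one (algebraMap S A), ← hr, map_add, map_mul]
  exact add_mem (Ideal.mul_mem_left _ _ h) (Ideal.mem_map_of_mem _ ht)

/-- The centre of `A / qA` consists of scalars. -/
theorem IsAzumaya.exists_algebraMap_sub_mem (hq : q.IsMaximal) {a : A}
    (ha : ∀ b, b * a - a * b ∈ q.map (algebraMap S A)) :
    ∃ s, a - algebraMap S A s ∈ q.map (algebraMap S A) := by
  -- a functional `f` with `f 1 = 1` modulo `q`; as an endomorphism of `A` it commutes with `a`
  obtain ⟨f, hf⟩ := exists_linearMap_sub_mem q hq (IsAzumaya.one_notMem (A := A) hq) (1 : S)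
  have comm : ∀ F : Module.End S A, F a - a * F 1 ∈ q.map (algebraMap S A) := fun F => by
    obtain ⟨t, rfl⟩ := (AlgHom.mulLeftRight_bij S A).2 F
    induction t with
    | zero => simp
    | tmul x y =>
      rw [AlgHom.mulLeftRight_apply, AlgHom.mulLeftRight_apply, mul_one, ← mul_assoc, ← sub_mul]
      exact Ideal.mul_mem_right _ _ (ha x)
    | add t t' h h' =>
      rw [map_add, LinearMap.add_apply, LinearMap.add_apply, mul_add, add_sub_add_comm]
      exact add_mem h h'
  refine ⟨f a, ?_⟩
  have h₁ := comm (Algebra.linearMap S A ∘ₗ f)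
  simp only [LinearMap.comp_apply, Algebra.linearMap_apply] at h₁
  have h₂ : a * algebraMap S A (f 1) - a ∈ q.map (algebraMap S A) := by
    have : f 1 - 1 ∈ q := by simpa using hf
    have := Ideal.mul_mem_left _ a (Ideal.mem_map_of_mem (algebraMap S A) this)
    rwa [map_sub, map_one (algebraMap S A), mul_sub, mul_one] at this
  have := neg_mem (add_mem h₁ h₂)
  rwa [sub_add_sub_cancel, neg_sub] at this

end Azumaya

section Symplectic

variable {R S A : Type*} [CommRing R] [CommRing S] [Ring A] [Algebra R S] [Algebra S A]
  [Algebra R A] [IsScalarTower R S A] [IsAzumaya S A] {σ : AlgInvolution R A} {τ : S →+* S}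
  {q : Ideal S}

/-- If `τ` is trivial modulo `q`, every element of `S` is congruent to an element of `R`. -/
theorem exists_algebraMap_sub_mem_of_involution (h2 : IsUnit (2 : R)) (hττ : ∀ s, τ (τ s) = s)
    (hfix : ∀ s, τ s = s → s ∈ Set.range (algebraMap R S))
    (hR : ∀ r, τ (algebraMap R S r) = algebraMap R S r)
    (htriv : ∀ s, τ s - s ∈ q) (s : S) :
    ∃ r : R, s - algebraMap R S r ∈ q ∧ ∃ t, τ t = -t ∧ t ∈ q ∧ s = algebraMap R S r + t := by
  obtain ⟨h, hh⟩ := h2.exists_left_inv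
  have hh' : algebraMap R S h * 2 = 1 := by
    rw [← map_ofNat (algebraMap R S) 2, ← map_mul, hh, map_one]
  obtain ⟨r, hr⟩ := hfix (algebraMap R S h * (s + τ s)) (by
    rw [map_mul, map_add, hR, hττ, add_comm])
  have ht : s - algebraMap R S r = algebraMap R S h * -(τ s - s) := by
    rw [hr]
    linear_combination (-s) * hh'
  refine ⟨r, ?_, s - algebraMap R S r, ?_, ?_, by ring⟩
  · rw [ht]; exact q.mul_mem_left _ (neg_mem (htriv s))
  · rw [ht, map_mul, map_neg, map_sub, hR, hττ]; ring
  · rw [ht]; exact q.mul_mem_left _ (neg_mem (htriv s))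

/-- If `τ` is trivial modulo `q`, then `q` is unramified over `R` with the same residue field, so it
is generated by its contraction. -/
theorem map_comap_eq_of_involution [Module.Finite R S] [Algebra.FormallyUnramified R S]
    (h2 : IsUnit (2 : R)) (hττ : ∀ s, τ (τ s) = s)
    (hfix : ∀ s, τ s = s → s ∈ Set.range (algebraMap R S))
    (hR : ∀ r, τ (algebraMap R S r) = algebraMap R S r)
    (hq : q.IsMaximal) (htriv : ∀ s, τ s - s ∈ q) :
    (q.comap (algebraMap R S)).map (algebraMap R S) = q := by
  refine le_antisymm Ideal.map_comap_le fun s hs => ?_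
  have : Algebra.IsIntegral R S := inferInstance
  have hm : (q.comap (algebraMap R S)).IsMaximal :=
    Ideal.isMaximal_comap_of_isIntegral_of_isMaximal q
  have hrad := Algebra.FormallyUnramified.isRadical_map_isMaximal R (B := S)
    (p := q.comap (algebraMap R S))
  obtain ⟨r, hr, t, ht, htq, rfl⟩ :=
    exists_algebraMap_sub_mem_of_involution h2 hττ hfix hR htriv s
  refine add_mem (Ideal.mem_map_of_mem _ ?_) (@hrad t ⟨2, ?_⟩)
  · rw [Ideal.mem_comap]
    exact (Submodule.add_mem_iff_left q htq).mp hs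
  · obtain ⟨c, hc⟩ := hfix (t ^ 2) (by rw [map_pow, ht, neg_sq])
    rw [← hc]
    refine Ideal.mem_map_of_mem _ ?_
    rw [Ideal.mem_comap, hc]
    exact Ideal.pow_mem_of_mem _ htq 2 two_pos

/-- If the involution is alternating modulo `q`, then `gΛg` consists of multiples of `g` by elements
of `R`. -/
theorem exists_smul_eq_of_alternating (h2 : IsUnit (2 : R)) (hττ : ∀ s, τ (τ s) = s)
    (hfix : ∀ s, τ s = s → s ∈ Set.range (algebraMap R S))
    (hR : ∀ r, τ (algebraMap R S r) = algebraMap R S r)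
    (hτ : ∀ s, σ (algebraMap S A s) = algebraMap S A (τ s)) (hq : q.IsMaximal)
    (hstab : ∀ a ∈ q.map (algebraMap S A), σ a ∈ q.map (algebraMap S A))
    {g : A ⧸ q.map (algebraMap S A)} (hg : IsDivisionIdempotent g) {r : ℕ}
    (h1 : HasMultiplicity g 1 r)
    (halt : letI := σ.quotientStarRing _ hstab; ∀ y, g * y = y → y * star y = 0) :
    (∀ s, τ s - s ∈ q) ∧ ∀ d, g * d = d → d * g = d → ∃ c : R, d = c • g := by
  let _ := σ.quotientStarRing _ hstab
  have := IsAzumaya.isSimpleRing_quotient (A := A) hq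
  have hprime := IsSimpleRing.eq_zero_or_eq_zero_of_forall_mul_mul
    (Λ := A ⧸ q.map (algebraMap S A))
  have htriv : ∀ s, τ s - s ∈ q := fun s => by
    refine IsAzumaya.mem_of_algebraMap_mem (A := A) hq ?_
    rw [map_sub, ← Ideal.Quotient.mk_eq_mk_iff_sub_mem, ← hτ]
    refine star_eq_of_alternating hg hprime halt
      (c := Ideal.Quotient.mk (q.map (algebraMap S A)) (algebraMap S A s)) fun a => ?_
    obtain ⟨a, rfl⟩ := Ideal.Quotient.mk_surjective a
    rw [← map_mul, ← map_mul, Algebra.commutes]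
  refine ⟨htriv, fun d hd₁ hd₂ => ?_⟩
  obtain ⟨c, hc, rfl⟩ := exists_central_mul_eq h1 hd₁ fun a =>
    mul_comm_of_alternating hg hprime halt (by rw [← mul_assoc, ← mul_assoc, hg.idem])
      (by rw [mul_assoc, hg.idem]) hd₁ hd₂
  obtain ⟨c, rfl⟩ := Ideal.Quotient.mk_surjective c
  obtain ⟨s, hs⟩ := IsAzumaya.exists_algebraMap_sub_mem hq (a := c) fun b => by
    rw [← Ideal.Quotient.mk_eq_mk_iff_sub_mem, map_mul, map_mul]
    exact hc _
  obtain ⟨t, ht, -⟩ := exists_algebraMap_sub_mem_of_involution h2 hττ hfix hR htriv s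
  refine ⟨t, ?_⟩
  rw [Algebra.smul_def]
  congr 1
  change Ideal.Quotient.mk (q.map (algebraMap S A)) c =
    Ideal.Quotient.mk (q.map (algebraMap S A)) (algebraMap R A t)
  rw [Ideal.Quotient.mk_eq_mk_iff_sub_mem, IsScalarTower.algebraMap_apply R S A]
  have := add_mem hs (Ideal.mem_map_of_mem (algebraMap S A) ht)
  rwa [map_sub, sub_add_sub_cancel] at this

/-- If the involution is alternating modulo `q`, it is symplectic at the prime of `R` below `q`. -/
theorem isSymplecticAt_of_alternating [Module.Finite R S] [Algebra.FormallyUnramified R S]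
    (h2 : IsUnit (2 : R)) (hττ : ∀ s, τ (τ s) = s)
    (hfix : ∀ s, τ s = s → s ∈ Set.range (algebraMap R S))
    (hR : ∀ r, τ (algebraMap R S r) = algebraMap R S r)
    (hτ : ∀ s, σ (algebraMap S A s) = algebraMap S A (τ s)) (hq : q.IsMaximal)
    (hstab : ∀ a ∈ q.map (algebraMap S A), σ a ∈ q.map (algebraMap S A))
    {g : A ⧸ q.map (algebraMap S A)} (hg : IsDivisionIdempotent g) {r : ℕ}
    (h1 : HasMultiplicity g 1 r)
    (halt : letI := σ.quotientStarRing _ hstab; ∀ y, g * y = y → y * star y = 0) :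
    σ.IsSymplecticAt (PrimeSpectrum.comap (algebraMap R S) ⟨q, hq.isPrime⟩) := by
  obtain ⟨htriv, hk⟩ := exists_smul_eq_of_alternating h2 hττ hfix hR hτ hq hstab hg h1 halt
  have hmap := map_comap_eq_of_involution h2 hττ hfix hR hq htriv
  let _ := σ.quotientStarRing _ hstab
  have := IsAzumaya.isSimpleRing_quotient (A := A) hq
  have hprime := IsSimpleRing.eq_zero_or_eq_zero_of_forall_mul_mul
    (Λ := A ⧸ q.map (algebraMap S A))
  set p := PrimeSpectrum.comap (algebraMap R S) ⟨q, hq.isPrime⟩ with hp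
  let L := AlgebraicClosure p.asIdeal.ResidueField
  have hLp : ∀ c ∈ p.asIdeal, algebraMap R L c = 0 := fun c hc => by
    rw [IsScalarTower.algebraMap_apply R p.asIdeal.ResidueField L,
      Ideal.algebraMap_residueField_eq_zero.mpr hc, map_zero]
  have hL : ∀ c : R, c • g = 0 → algebraMap R L c = 0 := fun c hc => hLp c <| by
    by_contra h
    obtain ⟨b, t, ht, hb⟩ := hq.exists_inv (x := algebraMap R S c) h
    refine hg.ne_zero ?_
    have h₁ : algebraMap R S c • g = 0 := by
      rw [← hc, ← algebraMap_smul S c g]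
    have h₂ : t • g = 0 := by
      obtain ⟨a, rfl⟩ := Ideal.Quotient.mk_surjective g
      rw [Algebra.smul_def]
      change Ideal.Quotient.mk (q.map (algebraMap S A)) (algebraMap S A t) * _ = 0
      rw [Ideal.Quotient.eq_zero_iff_mem.mpr (Ideal.mem_map_of_mem _ ht), zero_mul]
    rw [← one_smul S g, ← hb, add_smul, mul_smul, h₁, h₂, smul_zero, add_zero]
  obtain ⟨κ, hκ, hmul⟩ := exists_cornerCoefficient hg.idem hk hL
  obtain ⟨u, v, hu, hv, huv, h1⟩ := h1
  obtain ⟨ρ, hρ⟩ := exists_matrix_algHom hκ hmul hu hv huv h1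
  obtain ⟨B, hBt, hBd, hB⟩ := exists_alternating_matrix
    (fun c x => by
      obtain ⟨x, rfl⟩ := Ideal.Quotient.mk_surjective x
      exact congrArg (Ideal.Quotient.mk _) (map_smul σ.toLinearMap c x))
    hg hprime halt hk hκ hmul hu hv huv h1 hρ
  have hker : ∀ x : A, Ideal.Quotient.mkₐ R (q.map (algebraMap S A)) x = 0 →
      (1 : L) ⊗ₜ[R] x = 0 := fun x hx => by
    have hx' : x ∈ q.map (algebraMap S A) := Ideal.Quotient.eq_zero_iff_mem.mp hx
    rw [← hmap, Ideal.map_map, ← IsScalarTower.algebraMap_eq] at hx'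
    clear hx
    induction hx' using Submodule.span_induction with
    | mem x hx =>
      obtain ⟨c, hc, rfl⟩ := hx
      rw [Algebra.algebraMap_eq_smul_one, ← TensorProduct.smul_tmul, Algebra.smul_def, hLp c hc,
        zero_mul, TensorProduct.zero_tmul]
    | zero => exact TensorProduct.tmul_zero _ _
    | add x y _ _ hx hy => rw [TensorProduct.tmul_add, hx, hy, add_zero]
    | smul c x _ hx =>
      rw [smul_eq_mul, ← mul_one (1 : L), ← Algebra.TensorProduct.tmul_mul_tmul, hx, mul_zero]
  obtain ⟨φ, hφ⟩ := exists_algEquiv_end (Ideal.Quotient.mkₐ R (q.map (algebraMap S A)))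
    Ideal.Quotient.mk_surjective hker hg.idem hk hκ hu hv huv h1 hρ
  refine ⟨r, φ, Matrix.toBilin' B, fun x => ?_,
    LinearMap.BilinForm.nondegenerate_toBilin'_of_det_ne_zero' _ hBd, fun a => ?_⟩
  · have h2L : (2 : L) ≠ 0 := by
      have := h2.map (algebraMap R L)
      rw [map_ofNat] at this
      exact this.ne_zero
    have : Matrix.toBilin' B x x = -Matrix.toBilin' B x x := by
      conv_lhs => rw [Matrix.toBilin'_apply, Finset.sum_comm]
      rw [Matrix.toBilin'_apply, ← Finset.sum_neg_distrib]
      refine Finset.sum_congr rfl fun i _ => ?_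
      rw [← Finset.sum_neg_distrib]
      refine Finset.sum_congr rfl fun j _ => ?_
      have := congrFun (congrFun hBt i) j
      rw [Matrix.transpose_apply, Matrix.neg_apply] at this
      rw [this]
      ring
    have : (2 : L) * Matrix.toBilin' B x x = 0 := by linear_combination this
    exact (mul_eq_zero.mp this).resolve_left h2L
  · rw [hφ, hφ]
    exact isAdjointPair_toLinearMap₂' _ _ _ _ |>.mpr (hB _)

end Symplectic

/-! ### Corner rings of Azumaya algebras -/

section Center

variable {S C : Type*} [CommRing S] [Ring C] [Algebra S C] [Module.Finite S C]
  [Module.Projective S C]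

/-- Even if `C` is not faithful over `S`, some functional takes `1` to a scalar acting as the
identity. -/
theorem exists_dual_smul_one (S C : Type*) [CommRing S] [Ring C] [Algebra S C] [Module.Finite S C]
    [Module.Projective S C] : ∃ f : Module.Dual S C, f 1 • (1 : C) = 1 := by
  obtain ⟨m, x, s, hx⟩ : ∃ (m : ℕ) (x : Fin m → C) (s : Fin m → Module.Dual S C),
      ∀ c, ∑ i, s i c • x i = c := by
    obtain ⟨m, p, i, -, -, hpi⟩ := Module.Finite.exists_comp_eq_id_of_projective S C
    refine ⟨m, fun k => p (Pi.single k 1), fun k => LinearMap.proj k ∘ₗ i, fun c => ?_⟩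
    calc _ = p (∑ k, i c k • Pi.single k 1) := by simp [map_sum]
      _ = p (i c) := by rw [← pi_eq_sum_univ' (i c)]
      _ = c := LinearMap.congr_fun hpi c
  let T : Ideal S := LinearMap.range (Module.Dual.eval S C 1)
  have hT : (⊤ : Submodule S C) ≤ T • ⊤ := fun c _ => by
    rw [← mul_one c, ← hx 1, Finset.mul_sum]
    refine Submodule.sum_mem _ fun i _ => ?_
    rw [mul_smul_comm]
    exact Submodule.smul_mem_smul ⟨s i, rfl⟩ trivial
  obtain ⟨r, hr, hr'⟩ := Submodule.exists_sub_one_mem_and_smul_eq_zero_of_fg_of_le_smul T ⊤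
    Module.Finite.fg_top hT
  obtain ⟨f, hf⟩ := T.neg_mem hr
  refine ⟨f, ?_⟩
  change Module.Dual.eval S C 1 f • (1 : C) = 1
  rw [hf, neg_sub, sub_smul, hr' 1 trivial, one_smul, sub_zero]

variable (h : Function.Bijective (AlgHom.mulLeftRight S C))
include h

/-- A central element commutes with the endomorphisms `x ↦ f x • 1`, which makes it a scalar. -/
theorem isCentral_of_bijective_mulLeftRight : Algebra.IsCentral S C where
  out := fun c hc => by
    obtain ⟨f, hf⟩ := exists_dual_smul_one S C
    have comm : ∀ F : Module.End S C, F c = F 1 * c := fun F => by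
      obtain ⟨t, rfl⟩ := h.2 F
      induction t with
      | zero => simp
      | tmul a b =>
        rw [AlgHom.mulLeftRight_apply, AlgHom.mulLeftRight_apply, mul_one, mul_assoc, mul_assoc,
          Subalgebra.mem_center_iff.mp hc]
      | add t t' h h' => rw [map_add, LinearMap.add_apply, LinearMap.add_apply, h, h', add_mul]
    have := comm (f.smulRight 1)
    rw [LinearMap.smulRight_apply, LinearMap.smulRight_apply, hf, one_mul] at this
    exact Algebra.mem_bot.mpr ⟨f c, by rw [Algebra.algebraMap_eq_smul_one, this]⟩

/-- A finite projective `S`-algebra with `C ⊗ Cᵒᵖ ≅ End C` is Azumaya over its centre, even when it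
is not faithful over `S`. -/
theorem isAzumaya_center_of_bijective_mulLeftRight : IsAzumaya (Subalgebra.center S C) C := by
  have := isCentral_of_bijective_mulLeftRight h
  have hsurj : Function.Surjective (algebraMap S (Subalgebra.center S C)) := fun z => by
    obtain ⟨s, hs⟩ := Algebra.mem_bot.mp (Algebra.IsCentral.out z.2)
    exact ⟨s, Subtype.ext hs⟩
  have tower : IsScalarTower S (Subalgebra.center S C) C := ⟨fun s z c => smul_mul_assoc s z.1 c⟩
  let κ : C ⊗[S] Cᵐᵒᵖ →ₗ[S] C ⊗[Subalgebra.center S C] Cᵐᵒᵖ :=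
    TensorProduct.mapOfCompatibleSMul (Subalgebra.center S C) S S C Cᵐᵒᵖ
  have hκ : ∀ t x, AlgHom.mulLeftRight (Subalgebra.center S C) C (κ t) x =
      AlgHom.mulLeftRight S C t x := fun t x => by
    induction t with
    | zero => simp
    | tmul a b =>
      rw [TensorProduct.mapOfCompatibleSMul_tmul, AlgHom.mulLeftRight_apply,
        AlgHom.mulLeftRight_apply]
    | add t t' h h' =>
      rw [map_add, map_add, map_add, LinearMap.add_apply, LinearMap.add_apply, h, h']
  exact {
    toProjective := .of_lifting_property'' fun f hf => by
      obtain ⟨s, hs⟩ := Module.projective_lifting_property (f.restrictScalars S) LinearMap.id hf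
      exact ⟨s.extendScalarsOfSurjective hsurj, LinearMap.ext fun c => LinearMap.congr_fun hs c⟩
    toFaithfulSMul := ⟨fun {z z'} hz => Subtype.ext (by
      have : z.1 * 1 = z'.1 * 1 := hz 1
      simpa only [mul_one] using this)⟩
    toFinite := Module.Finite.of_restrictScalars_finite S _ _
    bij := by
      constructor
      · rw [injective_iff_map_eq_zero]
        intro t ht
        obtain ⟨t, rfl⟩ := TensorProduct.mapOfCompatibleSMul_surjective _ S S C Cᵐᵒᵖ t
        have : t = 0 := h.1 (LinearMap.ext fun x => by
          rw [← hκ, map_zero, LinearMap.zero_apply]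
          exact LinearMap.congr_fun ht x)
        rw [this, map_zero]
      · intro F
        obtain ⟨t, ht⟩ := h.2 (F.restrictScalars S)
        exact ⟨κ t, LinearMap.ext fun x => by rw [hκ, ht]; rfl⟩ }

end Center

section Corner

variable {S A : Type*} [CommRing S] [Ring A] [Algebra S A] {e : A}

/-- The inclusion of the corner ring `eAe` in `A`. -/
def cornerInclusion (S : Type*) {A : Type*} [CommRing S] [Ring A] [Algebra S A] {e : A}
    (he : IsIdempotentElem e) : he.Corner →ₗ[S] A where
  toFun := Subtype.val
  map_add' _ _ := rfl
  map_smul' _ _ := rfl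

/-- The projection `x ↦ exe` of `A` onto the corner ring `eAe`. -/
def cornerProjection (S : Type*) {A : Type*} [CommRing S] [Ring A] [Algebra S A] {e : A}
    (he : IsIdempotentElem e) : A →ₗ[S] he.Corner where
  toFun x := ⟨e * x * e, x, rfl⟩
  map_add' x y := Subtype.ext (by change e * (x + y) * e = e * x * e + e * y * e; noncomm_ring)
  map_smul' s x := Subtype.ext (by change e * (s • x) * e = s • (e * x * e); simp)

theorem cornerProjection_cornerInclusion (he : IsIdempotentElem e) (c : he.Corner) :
    cornerProjection S he (cornerInclusion S he c) = c := by
  obtain ⟨h₁, h₂⟩ := (Subsemigroup.mem_corner_iff he).mp c.2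
  exact Subtype.ext (by change e * c.1 * e = c.1; rw [h₁, h₂])

/-- The corner ring `eAe`, as a module. -/
noncomputable def cornerEquivPeirce (he : IsIdempotentElem e) :
    he.Corner ≃ₗ[S] peirceComponent S e e :=
  LinearEquiv.ofBijective ((cornerInclusion S he).codRestrict _ fun c => by
    obtain ⟨h₁, h₂⟩ := (Subsemigroup.mem_corner_iff he).mp c.2
    exact (mem_peirce he he).mpr ⟨h₁, h₂⟩)
    ⟨fun c c' h => Subtype.ext (congrArg (fun x : peirceComponent S e e => (x : A)) h), fun x => by
      obtain ⟨h₁, h₂⟩ := (mem_peirce he he).mp x.2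
      exact ⟨⟨x, (Subsemigroup.mem_corner_iff he).mpr ⟨h₁, h₂⟩⟩, rfl⟩⟩

/-- Cutting `A ⊗ Aᵒᵖ ≅ End A` by `e ⊗ e` gives `eAe ⊗ (eAe)ᵒᵖ ≅ End (eAe)`. -/
theorem bijective_mulLeftRight_corner [IsAzumaya S A] (he : IsIdempotentElem e) :
    Function.Bijective (AlgHom.mulLeftRight S he.Corner) := by
  let ι := cornerInclusion S he
  let p := cornerProjection S he
  let op {M N : Type _} [Ring M] [Ring N] [Algebra S M] [Algebra S N] (f : M →ₗ[S] N) :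
    Mᵐᵒᵖ →ₗ[S] Nᵐᵒᵖ :=
      (MulOpposite.opLinearEquiv S).toLinearMap ∘ₗ f ∘ₗ
        (MulOpposite.opLinearEquiv S).symm.toLinearMap
  have hpι : ∀ c, p (ι c) = c := cornerProjection_cornerInclusion he
  have hιp : ∀ x, ι (p x) = e * x * e := fun x => rfl
  have hι : ∀ c d, ι (c * d) = ι c * ι d := fun _ _ => rfl
  have hιe : ∀ c, e * ι c = ι c ∧ ι c * e = ι c := fun c => (Subsemigroup.mem_corner_iff he).mp c.2
  constructor
  · rw [injective_iff_map_eq_zero]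
    intro t ht
    have key : ∀ (t : he.Corner ⊗[S] he.Cornerᵐᵒᵖ) x,
        AlgHom.mulLeftRight S A (TensorProduct.map ι (op ι) t) x =
          ι (AlgHom.mulLeftRight S he.Corner t (p x)) := fun t x => by
      induction t with
      | zero => simp
      | tmul a b =>
        rw [TensorProduct.map_tmul, AlgHom.mulLeftRight_apply, AlgHom.mulLeftRight_apply, hι, hι,
          hιp]
        change ι a * x * ι b.unop = _
        obtain ⟨h₁, h₂⟩ := hιe a
        obtain ⟨h₃, h₄⟩ := hιe b.unop
        calc ι a * x * ι b.unop = (ι a * e) * x * (e * ι b.unop) := by rw [h₂, h₃]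
          _ = _ := by simp only [mul_assoc]
      | add t t' h h' =>
        rw [map_add, map_add, LinearMap.add_apply, h, h', map_add, LinearMap.add_apply, map_add]
    have h₀ : TensorProduct.map ι (op ι) t = 0 := by
      refine (IsAzumaya.AlgHom.mulLeftRight_bij S A).1 ?_
      ext x
      rw [key, ht, map_zero, LinearMap.zero_apply, map_zero, LinearMap.zero_apply]
    have h₁ : ∀ t, TensorProduct.map p (op p) (TensorProduct.map ι (op ι) t) = t := fun t => by
      induction t with
      | zero => simp
      | tmul a b =>
        rw [TensorProduct.map_tmul, TensorProduct.map_tmul, hpι]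
        congr 1
        exact congrArg MulOpposite.op (hpι _)
      | add t t' h h' => rw [map_add, map_add, h, h']
    rw [← h₁ t, h₀, map_zero]
  · intro F
    obtain ⟨t, ht⟩ := (IsAzumaya.AlgHom.mulLeftRight_bij S A).2 (ι ∘ₗ F ∘ₗ p)
    refine ⟨TensorProduct.map p (op p) t, LinearMap.ext fun c => ?_⟩
    have key : ∀ t, AlgHom.mulLeftRight S he.Corner (TensorProduct.map p (op p) t) c =
        p (AlgHom.mulLeftRight S A t (ι c)) := fun t => by
      induction t with
      | zero => simp
      | tmul a b =>
        rw [TensorProduct.map_tmul, AlgHom.mulLeftRight_apply, AlgHom.mulLeftRight_apply]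
        refine Subtype.ext ?_
        change e * a * e * ι c * (e * b.unop * e) = e * (a * ι c * b.unop) * e
        obtain ⟨h₁, h₂⟩ := hιe c
        calc e * a * e * ι c * (e * b.unop * e) = e * a * (e * (ι c * e)) * b.unop * e := by
              simp only [mul_assoc]
          _ = _ := by rw [h₂, h₁]; simp only [mul_assoc]
      | add t t' h h' => rw [map_add, map_add, LinearMap.add_apply, h, h', map_add,
          LinearMap.add_apply, map_add]
    rw [key, ht, LinearMap.comp_apply, LinearMap.comp_apply, hpι, hpι]

end Corner

/-! ### The action of the involution on ranks -/

section Transport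

/-- Ranks are transported by semilinear bijections. -/
theorem rankAtStalk_of_semilinear {S S' M N : Type*} [CommRing S] [CommRing S'] [AddCommGroup M]
    [Module S M] [AddCommGroup N] [Module S' N] [Module.Finite S M] [Module.Flat S M]
    (τ : S →+* S') (hτ : Function.Surjective τ) (φ : M →+ N) (hφ : Function.Bijective φ)
    (h : ∀ s m, φ (s • m) = τ s • φ m) (p : PrimeSpectrum S') :
    Module.rankAtStalk (R := S') N p = Module.rankAtStalk (R := S) M (PrimeSpectrum.comap τ p) := by
  let _ := τ.toAlgebra
  let _ : Module S N := Module.compHom N τ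
  have : IsScalarTower S S' N := ⟨fun s t x => mul_smul (τ s) t x⟩
  let f : M →ₗ[S] N := { φ with map_smul' := h }
  have hpure : ∀ t : S' ⊗[S] M, ∃ m, t = 1 ⊗ₜ m := fun t => by
    induction t with
    | zero => exact ⟨0, by simp⟩
    | tmul c m =>
      obtain ⟨s, rfl⟩ := hτ c
      refine ⟨s • m, ?_⟩
      rw [← TensorProduct.smul_tmul, Algebra.smul_def, mul_one]
      rfl
    | add x y hx hy =>
      obtain ⟨a, rfl⟩ := hx
      obtain ⟨b, rfl⟩ := hy
      exact ⟨a + b, (TensorProduct.tmul_add _ _ _).symm⟩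
  have hbij : Function.Bijective (f.liftBaseChange S') := by
    constructor
    · rw [injective_iff_map_eq_zero]
      intro t ht
      obtain ⟨m, rfl⟩ := hpure t
      rw [LinearMap.liftBaseChange_tmul, one_smul] at ht
      rw [hφ.1 (ht.trans (map_zero φ).symm), TensorProduct.tmul_zero]
    · intro x
      obtain ⟨m, rfl⟩ := hφ.2 x
      exact ⟨1 ⊗ₜ m, by rw [LinearMap.liftBaseChange_tmul, one_smul]; rfl⟩
  have hbc : IsBaseChange S' f := IsBaseChange.of_equiv (LinearEquiv.ofBijective _ hbij) fun m => by
    rw [LinearEquiv.ofBijective_apply, LinearMap.liftBaseChange_tmul, one_smul]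
  exact Module.rankAtStalk_isBaseChange hbc p

variable {R S A : Type*} [CommRing R] [CommRing S] [Ring A] [Algebra S A]
  [Algebra R A] [IsAzumaya S A] {σ : AlgInvolution R A} {τ : S →+* S}
  (hτ : ∀ s, σ (algebraMap S A s) = algebraMap S A (τ s)) (hττ : ∀ s, τ (τ s) = s)
include hτ hττ

theorem AlgInvolution.rankAtStalk_comap (p : PrimeSpectrum S) :
    Module.rankAtStalk (R := S) A (PrimeSpectrum.comap τ p) = Module.rankAtStalk (R := S) A p :=
  (rankAtStalk_of_semilinear τ (fun s => ⟨_, hττ s⟩) σ.toLinearMap.toAddMonoidHom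
    ⟨fun x y h => by rw [← σ.involutive x, ← σ.involutive y]; exact congrArg σ h,
      fun x => ⟨σ x, σ.involutive x⟩⟩ (fun s a => by
        change σ (s • a) = τ s • σ a
        rw [Algebra.smul_def, Algebra.smul_def, σ.map_mul, hτ, Algebra.commutes]) p).symm

/-- The involution exchanges `fA` and `Aσ(f)`. -/
theorem AlgInvolution.rankAtStalk_peirce {f : A} (hf : f * f = f) (p : PrimeSpectrum S) :
    Module.rankAtStalk (R := S) (peirceComponent S 1 (σ f)) p =
      Module.rankAtStalk (R := S) (peirceComponent S 1 f) (PrimeSpectrum.comap τ p) := by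
  have hσf : σ f * σ f = σ f := by rw [← σ.map_mul, hf]
  have := peirce_projective (S := S) hf (mul_one 1)
  rw [← (IsAzumaya.rankAtStalk_peirce hf _).1]
  refine rankAtStalk_of_semilinear τ (fun s => ⟨_, hττ s⟩)
    { toFun := fun x : peirceComponent S f 1 => ⟨σ x, (mem_peirce (mul_one 1) hσf).mpr
        ⟨one_mul _, by rw [← σ.map_mul, ((mem_peirce hf (mul_one 1)).mp x.2).1]⟩⟩
      map_zero' := Subtype.ext (map_zero σ.toLinearMap)
      map_add' := fun x y => Subtype.ext (map_add σ.toLinearMap (x : A) y) }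
    ⟨fun x y h => ?_, fun x => ?_⟩ (fun s x => ?_) p
  · have := congrArg (fun y : peirceComponent S 1 (σ f) => σ (y : A)) h
    refine Subtype.ext ?_
    rw [← σ.involutive x, ← σ.involutive y]
    exact this
  · refine ⟨⟨σ x, (mem_peirce hf (mul_one 1)).mpr ⟨?_, mul_one _⟩⟩, Subtype.ext (σ.involutive _)⟩
    conv_rhs => rw [← ((mem_peirce (mul_one 1) hσf).mp x.2).2]
    rw [σ.map_mul, σ.involutive]
  · refine Subtype.ext ?_
    change σ (s • (x : A)) = τ s • σ x
    rw [Algebra.smul_def, Algebra.smul_def, σ.map_mul, hτ, Algebra.commutes]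

end Transport

/-! ### From hermitian forms to symmetric idempotents -/

section Symmetrize

variable {R S A : Type*} [CommRing R] [CommRing S] [Ring A] [Algebra S A]
  [Algebra R A] {σ : AlgInvolution R A}

/-- If `w = fxσ(x)σ(f)` generates `fA` modulo every maximal ideal, then `xσ(x)` restricts to an
invertible hermitian form on `fA`, and `f` is equivalent to a symmetric idempotent. -/
theorem exists_symmetric_idempotent_of_forall_mul_sub_mem [Module.Finite S A] {f x : A}
    (hf : f * f = f) (h : ∀ q : Ideal S, q.IsMaximal →
      ∃ w, f * x * σ x * σ f * w - f ∈ q • (⊤ : Submodule S A)) :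
    ∃ e, e * e = e ∧ σ e = e ∧
      Nonempty (peirceComponent S 1 e ≃ₗ[S] peirceComponent S 1 f) := by
  have hσf : σ f * σ f = σ f := by rw [← σ.map_mul, hf]
  obtain ⟨w, hw⟩ : ∃ w, w = f * x * σ x * σ f := ⟨_, rfl⟩
  have hfw : f * w = w := by simp only [hw, ← mul_assoc, hf]
  have hwf : w * σ f = w := by rw [hw, mul_assoc, hσf]
  have hσw : σ w = w := by simp only [hw, σ.map_mul, σ.involutive, mul_assoc]
  obtain ⟨a, ha⟩ : ∃ a, w * a = f := by
    have htop : LinearMap.range (LinearMap.mulLeft S w) ⊔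
        LinearMap.range (LinearMap.mulLeft S (1 - f)) = ⊤ := by
      refine Submodule.eq_top_of_forall_sup_smul_top_eq_top _ fun q hq => ?_
      rw [eq_top_iff]
      rintro y -
      obtain ⟨v, hv⟩ := h q hq
      rw [← hw] at hv
      have hy : y = (w * (v * y) + (1 - f) * y) + (-(w * v - f)) * y := by noncomm_ring
      rw [hy]
      refine add_mem (Submodule.mem_sup_left (add_mem (Submodule.mem_sup_left ⟨_, rfl⟩)
        (Submodule.mem_sup_right ⟨_, rfl⟩))) (Submodule.mem_sup_right ?_)
      have := Submodule.mem_map_of_mem (f := LinearMap.mulRight S y) (neg_mem hv)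
      rw [Submodule.map_smul''] at this
      exact Submodule.smul_mono le_rfl le_top this
    obtain ⟨_, ⟨a, rfl⟩, _, ⟨b, rfl⟩, hab⟩ := Submodule.mem_sup.mp (htop.ge (trivial : f ∈ ⊤))
    refine ⟨a, ?_⟩
    have := congrArg (f * ·) hab
    simp only [LinearMap.mulLeft_apply, mul_add, ← mul_assoc, hfw, mul_sub, mul_one, hf, sub_self,
      zero_mul, add_zero] at this
    exact this
  -- the inverse of `w` in `σ(f)Af` is symmetric as well
  obtain ⟨b, hb₁, hb₂, hb₃⟩ : ∃ b, w * b = f ∧ σ f * b = b ∧ b * f = b :=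
    ⟨σ f * a * f, by rw [← mul_assoc, ← mul_assoc, hwf, ha, hf],
      by rw [← mul_assoc, ← mul_assoc, hσf], by rw [mul_assoc, hf]⟩
  have hσb : σ b = b := by
    have h₁ : σ b * w = σ f := by rw [← hσw, ← σ.map_mul, hb₁]
    have h₂ : σ b * f = σ b := by
      have := congrArg σ hb₂
      rwa [σ.map_mul, σ.involutive] at this
    rw [← h₂, ← hb₁, ← mul_assoc, h₁, hb₂]
  have hx : f * x * σ (f * x) = w := by rw [σ.map_mul, ← mul_assoc, hw]
  obtain ⟨u, hu⟩ : ∃ u, u = σ (f * x) * b := ⟨_, rfl⟩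
  have hxu : f * x * u = f := by rw [hu, ← mul_assoc, hx, hb₁]
  have huf : u * f = u := by rw [hu, mul_assoc, hb₃]
  have he : (u * (f * x)) * (u * (f * x)) = u * (f * x) := by
    rw [mul_assoc, ← mul_assoc (f * x), hxu, ← mul_assoc u, huf]
  refine ⟨u * (f * x), he, ?_, ⟨LinearEquiv.ofLinearMap
    ((LinearMap.mulRight S u).restrict fun y hy => (mem_peirce (mul_one 1) hf).mpr
      ⟨one_mul _, by rw [LinearMap.mulRight_apply, mul_assoc, huf]⟩)
    ((LinearMap.mulRight S (f * x)).restrict fun y hy => (mem_peirce (mul_one 1) he).mpr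
      ⟨one_mul _, by
        rw [LinearMap.mulRight_apply, mul_assoc, ← mul_assoc (f * x), hxu, ← mul_assoc f, hf]⟩)
    (LinearMap.ext fun y => Subtype.ext ?_) (LinearMap.ext fun y => Subtype.ext ?_)⟩⟩
  · rw [hu, σ.map_mul (_ * b), σ.map_mul _ b, σ.involutive, hσb, mul_assoc]
  · change (y : A) * (f * x) * u = y
    rw [mul_assoc, hxu, ((mem_peirce (mul_one 1) hf).mp y.2).2]
  · change (y : A) * u * (f * x) = y
    rw [mul_assoc, ((mem_peirce (mul_one 1) he).mp y.2).2]

end Symmetrize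

/-! ### The involution modulo a stable maximal ideal -/

theorem azumayaDegree_mul_self {S A : Type*} [CommRing S] [Ring A] [Algebra S A]
    (p : PrimeSpectrum S) :
    azumayaDegree S A p * azumayaDegree S A p = Module.rankAtStalk (R := S) A p :=
  Real.mul_self_sqrt (Nat.cast_nonneg _)

section Local

variable {R S A : Type*} [CommRing R] [CommRing S] [Ring A] [Algebra R S] [Algebra S A]
  [Algebra R A] [IsScalarTower R S A] [IsAzumaya S A] {σ : AlgInvolution R A} {τ : S →+* S}
  {q : Ideal S}

/-- The rank of `Af` at `q`, for `A / qA` a matrix ring of size `r` over a division ring and `f` of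
multiplicity `j` modulo `q`. -/
theorem IsAzumaya.rankAtStalk_eq_mul_mul (hq : q.IsMaximal) {g : A ⧸ q.map (algebraMap S A)}
    (hg : IsDivisionIdempotent g) {r j : ℕ} (hr : HasMultiplicity g 1 r) {f : A} (hf : f * f = f)
    (hj : HasMultiplicity g (Ideal.Quotient.mk _ f) j) :
    Module.rankAtStalk (R := S) (peirceComponent S 1 f) ⟨q, hq.isPrime⟩ =
      r * (j * fiberRank q (peirceComponent S g g)) := by
  have := peirce_projective (S := S) (mul_one 1) hf
  have : Module.Finite S (A ⧸ q.map (algebraMap S A)) :=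
    Module.Finite.of_surjective (Ideal.Quotient.mkₐ S _).toLinearMap Ideal.Quotient.mk_surjective
  rw [← fiberRank_eq_rankAtStalk, fiberRank_peirce_quotient (A := A) q (mul_one 1) hf, map_one,
    hr.fiberRank_peirce q hg.idem hj]

theorem IsAzumaya.rankAtStalk_eq_mul_self (hq : q.IsMaximal) {g : A ⧸ q.map (algebraMap S A)}
    (hg : IsDivisionIdempotent g) {r : ℕ} (hr : HasMultiplicity g 1 r) :
    Module.rankAtStalk (R := S) A ⟨q, hq.isPrime⟩ =
      r * (r * fiberRank q (peirceComponent S g g)) := by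
  have e : Module.rankAtStalk (R := S) A =
      Module.rankAtStalk (R := S) (peirceComponent S (1 : A) 1) := by
    refine Module.rankAtStalk_eq_of_equiv ((LinearEquiv.ofTop _ ?_).symm)
    rw [← range_mulLeft_eq_peirce, LinearMap.mulLeft_one, LinearMap.range_id]
  rw [e, IsAzumaya.rankAtStalk_eq_mul_mul hq hg hr (mul_one 1) (by rwa [map_one])]

theorem IsAzumaya.azumayaDegree_pos (p : PrimeSpectrum S) : 0 < azumayaDegree S A p :=
  Real.sqrt_pos.mpr (Nat.cast_pos.mpr (rankAtStalk_pos_of_faithful A p))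

/-- At a maximal ideal stable under the involution, a suitable hermitian form on `fA` modulo `q` is
nondegenerate; the parity condition enters when the involution is alternating modulo `q`. -/
theorem exists_mul_sub_mem_of_stable [Module.Finite R S] [Algebra.FormallyUnramified R S]
    (h2 : IsUnit (2 : R)) (hττ : ∀ s, τ (τ s) = s)
    (hfix : ∀ s, τ s = s → s ∈ Set.range (algebraMap R S))
    (hR : ∀ r, τ (algebraMap R S r) = algebraMap R S r)
    (hτ : ∀ s, σ (algebraMap S A s) = algebraMap S A (τ s)) (hq : q.IsMaximal)
    (hstab : ∀ s ∈ q, τ s ∈ q) {f : A} (hf : f * f = f) {n : ℕ}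
    (hn : (Module.rankAtStalk (R := S) (peirceComponent S 1 f) ⟨q, hq.isPrime⟩ : ℝ) =
      n * azumayaDegree S A ⟨q, hq.isPrime⟩)
    (hdeg : n ≤ azumayaDegree S A ⟨q, hq.isPrime⟩)
    (heven : σ.IsSymplecticAt (PrimeSpectrum.comap (algebraMap R S) ⟨q, hq.isPrime⟩) → Even n) :
    ∃ x w, f * x * σ x * σ f * w - f ∈ q.map (algebraMap S A) := by
  have hstab' := AlgInvolution.map_mem_map_algebraMap (A := A) hτ hstab
  let _ := σ.quotientStarRing _ hstab'
  have := IsAzumaya.isSimpleRing_quotient (A := A) hq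
  have hprime := IsSimpleRing.eq_zero_or_eq_zero_of_forall_mul_mul
    (Λ := A ⧸ q.map (algebraMap S A))
  obtain ⟨g, hg, -, H, hc⟩ := IsAzumaya.exists_divisionIdempotent (A := A) hq
  obtain ⟨r, hr⟩ := H 1 (mul_one 1)
  obtain ⟨j, hj⟩ := H (Ideal.Quotient.mk _ f) (by rw [← map_mul, hf])
  have hrank := IsAzumaya.rankAtStalk_eq_mul_self hq hg hr
  have hpos := IsAzumaya.azumayaDegree_pos (A := A) ⟨q, hq.isPrime⟩
  have hsq := azumayaDegree_mul_self (A := A) (⟨q, hq.isPrime⟩ : PrimeSpectrum S)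
  rw [IsAzumaya.rankAtStalk_eq_mul_mul hq hg hr hf hj] at hn
  have hrpos : 0 < r := Nat.pos_of_ne_zero fun h => by
    rw [hrank, h] at hsq
    simp [hpos.ne'] at hsq
  rw [hrank] at hsq
  generalize azumayaDegree S A ⟨q, hq.isPrime⟩ = d at *
  have hjr : j ≤ r := by
    have : ((r * (j * fiberRank q (peirceComponent S g g)) : ℕ) : ℝ) ≤
        (r * (r * fiberRank q (peirceComponent S g g)) : ℕ) := by
      rw [hn, ← hsq]
      exact mul_le_mul_of_nonneg_right hdeg hpos.le
    have := Nat.le_of_mul_le_mul_left (Nat.cast_le.mp this) hrpos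
    exact Nat.le_of_mul_le_mul_right this (Nat.pos_of_ne_zero hc)
  obtain ⟨x, w, hx, hw⟩ := exists_mul_star_mul_eq hg hprime (fun x hx => by
      obtain ⟨h, hh⟩ := h2.exists_left_inv
      rw [← one_smul R x, ← hh, mul_smul, ofNat_smul_eq_nsmul, two_nsmul, hx, smul_zero])
    (fun i hi => by
      have := IsAzumaya.rankAtStalk_eq_mul_self hq hg hi
      rw [hrank, ← mul_assoc, ← mul_assoc] at this
      exact (Nat.mul_self_inj.mp (Nat.eq_of_mul_eq_mul_right (Nat.pos_of_ne_zero hc) this)).symm)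
    hj hjr fun halt => by
      have hs := isSymplecticAt_of_alternating h2 hττ hfix hR hτ hq hstab' hg hr halt
      obtain ⟨-, hk⟩ := exists_smul_eq_of_alternating h2 hττ hfix hR hτ hq hstab' hg hr halt
      -- `gΛg` is one-dimensional, so the multiplicity of `f` is its reduced rank
      have hc₁ : fiberRank q (peirceComponent S g g) = 1 := by
        have h₁ : fiberRank q S = 1 := by
          rw [fiberRank, (TensorProduct.AlgebraTensorModule.rid S q.ResidueField
            q.ResidueField).finrank_eq, Module.finrank_self]
        let G : peirceComponent S g g := ⟨g, (mem_peirce hg.idem hg.idem).mpr ⟨hg.idem, hg.idem⟩⟩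
        have hG : Function.Surjective (LinearMap.toSpanSingleton S _ G) := fun x => by
          obtain ⟨e₁, e₂⟩ := (mem_peirce hg.idem hg.idem).mp x.2
          obtain ⟨c, hc⟩ := hk x e₁ e₂
          refine ⟨algebraMap R S c, Subtype.ext ?_⟩
          rw [hc, LinearMap.toSpanSingleton_apply, Submodule.coe_smul, algebraMap_smul]
        have h₂ : fiberRank q (peirceComponent S g g) ≤ fiberRank q S :=
          LinearMap.finrank_le_finrank_of_surjective
            (f := (LinearMap.toSpanSingleton S _ G).baseChange q.ResidueField)
            (LinearMap.lTensor_surjective _ hG)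
        omega
      rw [hc₁, mul_one] at hn hsq
      have hd : d = r := by
        push_cast at hsq
        exact (mul_self_inj hpos.le (Nat.cast_nonneg r)).mp hsq
      rw [hd, Nat.cast_mul, mul_comm] at hn
      have := mul_right_cancel₀ (Nat.cast_ne_zero.mpr hrpos.ne') hn
      rw [Nat.cast_inj.mp this]
      exact heven hs
  obtain ⟨x, rfl⟩ := Ideal.Quotient.mk_surjective x
  obtain ⟨w, rfl⟩ := Ideal.Quotient.mk_surjective w
  refine ⟨x, w, ?_⟩
  rw [← Ideal.Quotient.mk_eq_mk_iff_sub_mem]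
  have : f * x * σ x * σ f * w = f * x * σ (f * x) * w := by rw [σ.map_mul]; simp only [mul_assoc]
  rw [this]
  rw [← map_mul] at hx
  conv_rhs => rw [← hw, ← hx]
  rfl

end Local

/-! ### Gluing over the maximal ideals -/

/-- If `f` has the same rank at `q` and at its conjugate, then `f` and `σ(f)` are equivalent
modulo `q`. -/
theorem exists_equivalence_sub_mem {R : Type*} {S A : Type*} [CommRing R] [CommRing S] [Ring A]
    [Algebra S A] [Algebra R A] [IsAzumaya S A] {σ : AlgInvolution R A} {τ : S →+* S} {q : Ideal S}
    (hττ : ∀ s, τ (τ s) = s)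
    (hτ : ∀ s, σ (algebraMap S A s) = algebraMap S A (τ s)) (hq : q.IsMaximal)
    {f : A} (hf : f * f = f) {n : LocallyConstant (PrimeSpectrum S) ℕ}
    (hinv : ∀ p, n (PrimeSpectrum.comap τ p) = n p)
    (hn : ∀ p, (Module.rankAtStalk (R := S) (peirceComponent S 1 f) p : ℝ) =
      n p * azumayaDegree S A p) :
    ∃ a b, a * b - f ∈ q.map (algebraMap S A) ∧ b * a - σ f ∈ q.map (algebraMap S A) ∧
      f * a - a ∈ q.map (algebraMap S A) ∧ a * σ f - a ∈ q.map (algebraMap S A) := by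
  have hσf : σ f * σ f = σ f := by rw [← σ.map_mul, hf]
  obtain ⟨g, hg, -, H, hc⟩ := IsAzumaya.exists_divisionIdempotent (A := A) hq
  obtain ⟨r, hr⟩ := H 1 (mul_one 1)
  obtain ⟨i, hi⟩ := H (Ideal.Quotient.mk _ f) (by rw [← map_mul, hf])
  obtain ⟨j, hj⟩ := H (Ideal.Quotient.mk _ (σ f)) (by rw [← map_mul, hσf])
  have hrpos : 0 < r := Nat.pos_of_ne_zero fun h => by
    have := rankAtStalk_pos_of_faithful A (⟨q, hq.isPrime⟩ : PrimeSpectrum S)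
    rw [IsAzumaya.rankAtStalk_eq_mul_self hq hg hr, h, zero_mul] at this
    exact this.false
  have hij : i = j := by
    have h₁ := AlgInvolution.rankAtStalk_peirce hτ hττ hf ⟨q, hq.isPrime⟩
    have h₂ : Module.rankAtStalk (R := S) (peirceComponent S 1 f)
        (PrimeSpectrum.comap τ ⟨q, hq.isPrime⟩) =
        Module.rankAtStalk (R := S) (peirceComponent S 1 f) ⟨q, hq.isPrime⟩ := by
      have := (hn (PrimeSpectrum.comap τ ⟨q, hq.isPrime⟩)).trans
        (Eq.trans ?_ (hn ⟨q, hq.isPrime⟩).symm)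
      · exact_mod_cast this
      · rw [hinv, azumayaDegree, azumayaDegree, AlgInvolution.rankAtStalk_comap hτ hττ]
    rw [h₂, IsAzumaya.rankAtStalk_eq_mul_mul hq hg hr hf hi,
      IsAzumaya.rankAtStalk_eq_mul_mul hq hg hr hσf hj] at h₁
    exact (Nat.eq_of_mul_eq_mul_right (Nat.pos_of_ne_zero hc)
      (Nat.eq_of_mul_eq_mul_left hrpos h₁)).symm
  subst hij
  obtain ⟨a, b, hab, hba, ha₁, ha₂, -, -⟩ := hi.exists_equivalence hj
  obtain ⟨a, rfl⟩ := Ideal.Quotient.mk_surjective a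
  obtain ⟨b, rfl⟩ := Ideal.Quotient.mk_surjective b
  simp only [← map_mul, Ideal.Quotient.mk_eq_mk_iff_sub_mem] at hab hba ha₁ ha₂
  exact ⟨a, b, hab, hba, ha₁, ha₂⟩

section Global

variable {R : Type*} {S A : Type u} [CommRing R] [CommRing S] [Ring A] [Algebra R S] [Algebra S A]
  [Algebra R A] [IsScalarTower R S A] [IsAzumaya S A] {σ : AlgInvolution R A} {τ : S →+* S}
  {q : Ideal S}

/-- Elements of `A` prescribed modulo the maximal ideals of `S` that define a nondegenerate form on
`fA` everywhere: at a stable ideal by hermitian diagonalisation, and at a pair of conjugate ideals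
by an equivalence of `f` with `σ(f)`. -/
theorem exists_mul_sub_mem_of_forall [Module.Finite R S] [Algebra.FormallyUnramified R S]
    (h2 : IsUnit (2 : R)) (hττ : ∀ s, τ (τ s) = s)
    (hfix : ∀ s, τ s = s → s ∈ Set.range (algebraMap R S))
    (hR : ∀ r, τ (algebraMap R S r) = algebraMap R S r)
    (hτ : ∀ s, σ (algebraMap S A s) = algebraMap S A (τ s)) {f : A} (hf : f * f = f)
    {n : LocallyConstant (PrimeSpectrum S) ℕ}
    (hinv : ∀ p, n (PrimeSpectrum.comap τ p) = n p)
    (hn : ∀ p, (Module.rankAtStalk (R := S) (peirceComponent S 1 f) p : ℝ) =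
      n p * azumayaDegree S A p)
    (hdeg : ∀ p, n p ≤ azumayaDegree S A p)
    (heven : ∀ p, σ.IsSymplecticAt (PrimeSpectrum.comap (algebraMap R S) p) → Even (n p)) :
    ∃ x : Ideal S → A, ∀ q : Ideal S, q.IsMaximal →
      ∃ w, f * x q * σ (x (q.comap τ)) * σ f * w - f ∈ q.map (algebraMap S A) := by
  classical
  have hcc : ∀ q : Ideal S, (q.comap τ).comap τ = q := fun q => by
    ext s
    rw [Ideal.mem_comap, Ideal.mem_comap, hττ]
  have hmax : ∀ q : Ideal S, q.IsMaximal → (q.comap τ).IsMaximal := fun q hq =>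
    Ideal.comap_isMaximal_of_surjective τ fun s => ⟨_, hττ s⟩
  have key₁ : ∀ q : Ideal S, ∃ x, q.IsMaximal → q.comap τ = q →
      ∃ w, f * x * σ x * σ f * w - f ∈ q.map (algebraMap S A) := fun q => by
    by_cases h : q.IsMaximal ∧ q.comap τ = q
    · obtain ⟨x, w, hw⟩ := exists_mul_sub_mem_of_stable h2 hττ hfix hR hτ h.1
        (fun s hs => by rwa [← Ideal.mem_comap, h.2]) hf (hn _) (hdeg _) (heven _)
      exact ⟨x, fun _ _ => ⟨w, hw⟩⟩
    · exact ⟨0, fun h₁ h₂ => (h ⟨h₁, h₂⟩).elim⟩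
  have key₂ : ∀ q : Ideal S, ∃ a, q.IsMaximal → ∃ b, a * b - f ∈ q.map (algebraMap S A) ∧
      b * a - σ f ∈ q.map (algebraMap S A) ∧ f * a - a ∈ q.map (algebraMap S A) ∧
      a * σ f - a ∈ q.map (algebraMap S A) := fun q => by
    by_cases h : q.IsMaximal
    · obtain ⟨a, b, hab⟩ := exists_equivalence_sub_mem hττ hτ h hf hinv hn
      exact ⟨a, fun _ => ⟨b, hab⟩⟩
    · exact ⟨0, fun h₁ => (h h₁).elim⟩
  choose x hx using key₁
  choose a ha using key₂
  -- an arbitrary linear order distinguishes one member of each pair of conjugate ideals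
  let lt : Ideal S → Ideal S → Prop := WellOrderingRel
  refine ⟨fun q => if q.comap τ = q then x q else if lt q (q.comap τ) then a q else f,
    fun q hq => ?_⟩
  by_cases hqq : q.comap τ = q
  · simp only [hqq, if_true]
    exact hx q hq hqq
  simp only [hcc, if_neg hqq, if_neg (Ne.symm hqq)]
  by_cases hlt : lt q (q.comap τ)
  · have : ¬ lt (q.comap τ) q := asymm hlt
    obtain ⟨b, h₁, -, h₂, h₃⟩ := ha q hq
    rw [if_pos hlt, if_neg this]
    refine ⟨b, ?_⟩
    simp only [← Ideal.Quotient.mk_eq_mk_iff_sub_mem, map_mul] at h₁ h₂ h₃ ⊢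
    rw [h₂, h₃, h₃, h₁]
  · have : lt (q.comap τ) q := ((trichotomous_of lt q (q.comap τ)).resolve_left hlt).resolve_left
      (Ne.symm hqq)
    obtain ⟨b, -, h₁, h₂, h₃⟩ := ha _ (hmax q hq)
    rw [if_neg hlt, if_pos this]
    refine ⟨σ b, ?_⟩
    have hmem := AlgInvolution.map_mem_map_algebraMap (A := A) hτ (q := q.comap τ) (q' := q)
      fun s hs => hs
    have h₁' := hmem _ h₁
    have h₂' := hmem _ h₂
    simp only [map_sub, σ.map_mul, σ.involutive, ← Ideal.Quotient.mk_eq_mk_iff_sub_mem] at h₁' h₂'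
    rw [← Ideal.Quotient.mk_eq_mk_iff_sub_mem]
    rw [map_mul] at h₁' h₂'
    rw [hf, map_mul, map_mul, map_mul, mul_assoc (Ideal.Quotient.mk _ f), h₂', mul_assoc, h₁',
      ← map_mul, hf]

/-- The existence of symmetric idempotents, over a base `S` with a ring involution `τ`. -/
theorem exists_symmetric_idempotent_of_index_dvd [Finite (MaximalSpectrum S)] [Module.Finite R S]
    [Algebra.FormallyUnramified R S]
    (h2 : IsUnit (2 : R)) (hττ : ∀ s, τ (τ s) = s)
    (hfix : ∀ s, τ s = s → s ∈ Set.range (algebraMap R S))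
    (hR : ∀ r, τ (algebraMap R S r) = algebraMap R S r)
    (hτ : ∀ s, σ (algebraMap S A s) = algebraMap S A (τ s))
    (n : LocallyConstant (PrimeSpectrum S) ℕ)
    (hinv : ∀ p, n (PrimeSpectrum.comap τ p) = n p) (hind : ∀ p, azumayaIndex S A p ∣ n p)
    (hdeg : ∀ p, n p ≤ azumayaDegree S A p)
    (heven : ∀ p, σ.IsSymplecticAt (PrimeSpectrum.comap (algebraMap R S) p) → Even (n p)) :
    ∃ e : A, IsIdempotentElem e ∧ σ e = e ∧
      ∀ p, (Module.rankAtStalk (R := S) (peirceComponent S 1 e) p : ℝ) =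
        n p * azumayaDegree S A p := by
  obtain ⟨f, hf, hn⟩ := exists_idempotent_of_index_dvd n hind hdeg
  obtain ⟨x, hx⟩ := exists_mul_sub_mem_of_forall h2 hττ hfix hR hτ hf hinv hn hdeg heven
  obtain ⟨y, hy⟩ := exists_forall_sub_mem_smul_top (S := S) (M := A) fun q => x q.asIdeal
  have hy' : ∀ q : Ideal S, q.IsMaximal → y - x q ∈ q.map (algebraMap S A) := fun q hq =>
    (mem_map_algebraMap_iff q).mpr (hy ⟨q, hq⟩)
  obtain ⟨e, he, hσe, ⟨φ⟩⟩ := exists_symmetric_idempotent_of_forall_mul_sub_mem (S := S) (σ := σ)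
    (x := y) hf fun q hq => by
      obtain ⟨w, hw⟩ := hx q hq
      refine ⟨w, (mem_map_algebraMap_iff q).mp ?_⟩
      have h₁ := hy' q hq
      have h₂ := AlgInvolution.map_mem_map_algebraMap (A := A) hτ (q' := q) (fun s hs => hs) _
        (hy' (q.comap τ) (Ideal.comap_isMaximal_of_surjective τ fun s => ⟨_, hττ s⟩))
      rw [map_sub] at h₂
      rw [← Ideal.Quotient.mk_eq_mk_iff_sub_mem] at h₁ h₂ hw ⊢
      rw [← hw]
      simp only [map_mul, h₁, h₂]
  exact ⟨e, he, hσe, fun p => by rw [← hn, Module.rankAtStalk_eq_of_equiv φ]⟩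

end Global

/-! ### Symmetric idempotents of prescribed degree -/

section Main

/-- A finite algebra over a semilocal ring is semilocal. -/
theorem finite_maximalSpectrum_of_finite (R S : Type*) [CommRing R] [CommRing S] [Algebra R S]
    [Module.Finite R S] [Finite (MaximalSpectrum R)] : Finite (MaximalSpectrum S) := by
  have hm : ∀ q : MaximalSpectrum S, (q.asIdeal.comap (algebraMap R S)).IsMaximal := fun q =>
    have := q.isMaximal
    Ideal.isMaximal_comap_of_isIntegral_of_isMaximal q.asIdeal
  have : ∀ m : MaximalSpectrum R, Finite (m.asIdeal.primesOver S) := fun m =>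
    (Algebra.QuasiFinite.finite_primesOver m.asIdeal).to_subtype
  refine Finite.of_injective (β := Σ m : MaximalSpectrum R, m.asIdeal.primesOver S)
    (fun q => ⟨⟨_, hm q⟩, q.asIdeal, q.isMaximal.isPrime, ⟨rfl⟩⟩) fun q q' h => ?_
  have := congrArg (fun x : Σ m : MaximalSpectrum R, m.asIdeal.primesOver S => x.2.1) h
  exact MaximalSpectrum.ext this

/-- The ranks of `eA` and `eAe`, when `Ae` has reduced rank `n`. -/
theorem IsAzumaya.azumayaDegree_corner {S A : Type*} [CommRing S] [Ring A] [Algebra S A]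
    [IsAzumaya S A] {e : A} (he : IsIdempotentElem e) {p : PrimeSpectrum S} {n : ℕ}
    (h : (Module.rankAtStalk (R := S) (peirceComponent S 1 e) p : ℝ) = n * azumayaDegree S A p) :
    azumayaDegree S he.Corner p = n ∧ reducedRank S A (rightIdealOf S e) p = n := by
  obtain ⟨h₁, h₂⟩ := IsAzumaya.rankAtStalk_peirce (S := S) he p
  have hpos := IsAzumaya.azumayaDegree_pos (A := A) p
  rw [← h₁] at h
  constructor
  · have h₃ : (Module.rankAtStalk (R := S) (peirceComponent S e e) p : ℝ) = n ^ 2 := by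
      have : (Module.rankAtStalk (R := S) (peirceComponent S e e) p : ℝ) *
          Module.rankAtStalk (R := S) A p =
          (Module.rankAtStalk (R := S) (peirceComponent S e 1) p : ℝ) ^ 2 := by exact_mod_cast h₂
      rw [← azumayaDegree_mul_self, h, mul_pow, ← pow_two] at this
      exact mul_right_cancel₀ (pow_ne_zero 2 hpos.ne') this
    rw [azumayaDegree, Module.rankAtStalk_eq_of_equiv (cornerEquivPeirce he), h₃,
      Real.sqrt_sq (Nat.cast_nonneg n)]
  · rw [reducedRank, rightIdealOf, range_mulLeft_eq_peirce, h, mul_div_cancel_right₀ _ hpos.ne']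

end Main

theorem mainTheorem11 {R : Type*} {A : Type*} [CommRing R] [Ring A] [Algebra R A]
    (h2 : IsUnit (2 : R)) [Finite (MaximalSpectrum R)]
    (σ : AlgInvolution R A) (hσ : σ.IsAzumayaInvolution)
    (n : LocallyConstant (PrimeSpectrum (Subalgebra.center R A)) ℕ)
    (hinv : ∀ q, n (PrimeSpectrum.comap σ.onCenter q) = n q)
    (hind : ∀ q, azumayaIndex (Subalgebra.center R A) A q ∣ n q)
    (hdeg : ∀ q, (n q : ℝ) ≤ azumayaDegree (Subalgebra.center R A) A q)
    (hsymp : ∀ q : PrimeSpectrum (Subalgebra.center R A),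
      σ.IsSymplecticAt (PrimeSpectrum.comap (algebraMap R (Subalgebra.center R A)) q) →
        Even (n q)) :
    ∃ (e : A) (he : IsIdempotentElem e), σ e = e ∧
      Algebra.IsCentral (Subalgebra.center R A) he.Corner ∧
      IsAzumaya (Subalgebra.center (Subalgebra.center R A) he.Corner) he.Corner ∧
      (∀ q, azumayaDegree (Subalgebra.center R A) he.Corner q = n q) ∧
      (∀ q, reducedRank (Subalgebra.center R A) A
        (rightIdealOf (Subalgebra.center R A) e) q = n q) := by
  have := hσ.separableProjective.azumaya_center
  have := hσ.separableProjective.finite_center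
  have := hσ.separableProjective.etale_center
  have := finite_maximalSpectrum_of_finite R (Subalgebra.center R A)
  have tower : IsScalarTower R (Subalgebra.center R A) A := ⟨fun r s a => smul_mul_assoc r s.1 a⟩
  have hR : ∀ r, σ (algebraMap R A r) = algebraMap R A r := fun r => by
    rw [Algebra.algebraMap_eq_smul_one, map_smul, σ.map_one]
  obtain ⟨e, he, hσe, hrank⟩ := exists_symmetric_idempotent_of_index_dvd (σ := σ)
    (τ := σ.onCenter) h2 (fun s => Subtype.ext (σ.involutive s.1))
    (fun s hs => by
      obtain ⟨r, hr⟩ := hσ.fixed s.1 s.2 (congrArg Subtype.val hs)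
      exact ⟨r, Subtype.ext hr⟩)
    (fun r => Subtype.ext (hR r)) (fun s => rfl) n hinv hind hdeg hsymp
  have hbij := bijective_mulLeftRight_corner (S := Subalgebra.center R A) he
  have : Module.Finite (Subalgebra.center R A) he.Corner := .equiv (cornerEquivPeirce he).symm
  have : Module.Projective (Subalgebra.center R A) he.Corner :=
    have := peirce_projective (S := Subalgebra.center R A) he he
    .of_equiv (cornerEquivPeirce he).symm
  exact ⟨e, he, hσe, isCentral_of_bijective_mulLeftRight hbij,
    isAzumaya_center_of_bijective_mulLeftRight hbij,
    fun q => (IsAzumaya.azumayaDegree_corner he (hrank q)).1,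
    fun q => (IsAzumaya.azumayaDegree_corner he (hrank q)).2⟩
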